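/- Let $p,q\ge 0$ be integers with $p+q\ge 1$, let $j\in\{\tfrac12,1,\tfrac32,\dots\}$, and work over $\mathbb C$. Put $m=p(2j+1)+2qj$ and $n=2pj+q(2j+1)$, let $sl(m|n)$ be the Lie superalgebra of supertraceless matrices, and let $p\,sl(2j+1|2j)\oplus q\,sl(2j|2j+1)\subset sl(m|n)$ be the regular subalgebra of block-diagonal matrices with supertraceless blocks. *The embedding.* Order the basis of each block so that parities alternate (starting with even for the $p$ blocks $sl(2j+1|2j)$ and with odd for the $q$ blocks $sl(2j|2j+1)$); the simple root vectors $E_{k,k+1}$, $1\le k\le 4j$, are then all odd, and for $j=\tfrac12$, $p=1$, $q=0$ this gives the two odd simple root vectors $e_1=E_{12},e_2=E_{23}$ of $sl(2|1)$, with opposite root vectors $f_1=E_{21},f_2=E_{32}$. A principal embedding of $sl(2|1)$ in $p\,sl(2j+1|2j)\oplus q\,sl(2j|2j+1)$ is an injective homomorphism of Lie superalgebras sending $e_1$ (resp. $e_2$) to a linear combination, with nonzero coefficients, of the $E_{k,k+1}$ of all blocks with $k$ odd (resp. even), and $f_1$ (resp. $f_2$) to such a combination of the $E_{k+1,k}$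 with $k$ odd (resp. even). (The sign of the $u(1)$ charge is thus normalised in the same way in all blocks.) *The representations.* Let $H=\tfrac12([e_1,f_1]-[e_2,f_2])$ (isospin) and $B=\tfrac12([e_1,f_1]+[e_2,f_2])$ (charge). For an integer $r\ge0$, $(0,r)$ denotes the irreducible representation of $sl(2|1)$ with an even highest weight vector, annihilated by $e_1,e_2$, with $H=r$ and $B=0$; $(0,r)'$ is the same representation with odd highest weight vector. The representation $(0,0)$ is trivial. *Claim.* Principal embeddings exist, and for each of them, under the adjoint action of the embedded $sl(2|1)$, $$sl(m|n)=(p+q)\bigoplus_{r=1}^{2j}(0,r)\ \oplus\ \big(p(p-1)+q(q-1)\big)\bigoplus_{r=0}^{2j}(0,r)\ \oplus\ 2pq\bigoplus_{r=0}^{2j}(0,r)'\ \oplus\ (p+q-1)\,(0,0).$$ If $p=q$, one of the last $p+q-1$ trivial summands can be chosen to be the centre $\mathbb C\cdot 1$ of $sl(m|m)$, so that $psl(m|m)$ has the same decomposition with $p+q-2$ in place of $p+q-1$. Moreover $$p\,sl(2j+1|2j)\oplus q\,sl(2j|2j+1)=(p+q)\bigoplus_{r=1}^{2j}(0,r),$$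 and for $p+q=1$, i.e. for $sl(2j+1|2j)$ and $sl(2j|2j+1)$, the adjoint representation is $\bigoplus_{r=1}^{2j}(0,r)$. -/

import Mathlib

/-! Matrix Lie superalgebras.  A finite index set `ι` with a parity `π : ι → ZMod 2` having `m` even
and `n` odd indices gives `gl(m|n)`: all `ι × ι` complex matrices, the matrix unit `E_{i,k}` having
parity `π i + π k`. -/

namespace SuperSL

section MatrixSuperalgebras

/-- The component of parity `s` of a matrix. -/
def homPart {ι : Type} (π : ι → ZMod 2) (s : ZMod 2) (A : Matrix ι ι ℂ) : Matrix ι ι ℂ :=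
  fun i k => if π i + π k = s then A i k else 0

/-- The subspace of matrices of parity `s`. -/
def homSubspace {ι : Type} (π : ι → ZMod 2) (s : ZMod 2) : Submodule ℂ (Matrix ι ι ℂ) where
  carrier := {A | ∀ i k, π i + π k ≠ s → A i k = 0}
  add_mem' := by
    intro A B hA hB i k h
    simp [hA i k h, hB i k h]
  zero_mem' := by
    intro i k _
    rfl
  smul_mem' := by
    intro c A hA i k h
    simp [hA i k h]

/-- The Lie superbracket: the bilinear extension of `[A,B] = AB - (-1)^{|A||B|} BA`. -/
def sbracket {ι : Type} [Fintype ι] (π : ι → ZMod 2) (A B : Matrix ι ι ℂ) : Matrix ι ι ℂ :=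
  ∑ s : ZMod 2, ∑ t : ZMod 2,
    (homPart π s A * homPart π t B
      - (-1 : ℂ) ^ (s.val * t.val) • (homPart π t B * homPart π s A))

/-- The supertrace. -/
def supertrace {ι : Type} [Fintype ι] (π : ι → ZMod 2) : Matrix ι ι ℂ →ₗ[ℂ] ℂ where
  toFun A := ∑ i, (-1 : ℂ) ^ (π i).val * A i i
  map_add' := by
    intro A B
    simp [mul_add, Finset.sum_add_distrib]
  map_smul' := by
    intro c A
    simp only [Matrix.smul_apply, smul_eq_mul, RingHom.id_apply, Finset.mul_sum]
    exact Finset.sum_congr rfl fun i _ => by ring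

/-- `sl(m|n)`: the matrices of supertrace zero. -/
def sl {ι : Type} [Fintype ι] (π : ι → ZMod 2) : Submodule ℂ (Matrix ι ι ℂ) :=
  LinearMap.ker (supertrace π)

theorem supertrace_mul_comm {ι : Type} [Fintype ι] (π : ι → ZMod 2) (s t : ZMod 2)
    (A B : Matrix ι ι ℂ) :
    supertrace π (homPart π s A * homPart π t B) =
      (-1 : ℂ) ^ (s.val * t.val) * supertrace π (homPart π t B * homPart π s A) := by
  simp only [supertrace, LinearMap.coe_mk, AddHom.coe_mk, Matrix.mul_apply, Finset.mul_sum]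
  rw [Finset.sum_comm]
  refine Finset.sum_congr rfl fun k _ => Finset.sum_congr rfl fun i _ => ?_
  simp only [homPart]
  have key : ∀ a b s t : ZMod 2, a + b = s → b + a = t →
      (-1 : ℂ) ^ a.val = (-1 : ℂ) ^ (s.val * t.val) * (-1 : ℂ) ^ b.val := by
    intro a b s t h1 h2
    subst h1 h2
    rw [← pow_add]
    refine (neg_one_pow_congr ?_)
    revert a b
    decide
  by_cases h1 : π i + π k = s
  · by_cases h2 : π k + π i = t
    · rw [if_pos h1, if_pos h2, key _ _ _ _ h1 h2]
      ring
    · simp [h2]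
  · simp [h1]

theorem sbracket_mem_sl {ι : Type} [Fintype ι] (π : ι → ZMod 2) (A B : Matrix ι ι ℂ) :
    sbracket π A B ∈ sl π := by
  simp only [sl, LinearMap.mem_ker, sbracket, map_sum, map_sub, map_smul, smul_eq_mul]
  refine Finset.sum_eq_zero fun s _ => Finset.sum_eq_zero fun t _ => ?_
  rw [supertrace_mul_comm, sub_self]

end MatrixSuperalgebras

section SL21

/-- The parity `0, 1, 0, 1, …` on positions `0, …, N - 1`: in this order of the basis all simple
root vectors `E_{k,k+1}` are odd. -/
def altParity (N : ℕ) : Fin N → ZMod 2 := fun k => ((k : ℕ) : ZMod 2)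

/-- `sl(2|1)`, on a basis whose positions `0, 2` are even and whose position `1` is odd. -/
abbrev sl21 : Submodule ℂ (Matrix (Fin 3) (Fin 3) ℂ) := sl (altParity 3)

/-- The superbracket of `sl(2|1)`. -/
def sl21Bracket (x y : sl21) : sl21 :=
  ⟨sbracket (altParity 3) (x : Matrix (Fin 3) (Fin 3) ℂ) y, sbracket_mem_sl _ _ _⟩

/-- The first (odd) simple root vector. -/
def e1 : sl21 := ⟨!![0, 1, 0; 0, 0, 0; 0, 0, 0], by
  simp [sl, supertrace, Fin.sum_univ_three]⟩

/-- The second (odd) simple root vector. -/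
def e2 : sl21 := ⟨!![0, 0, 0; 0, 0, 1; 0, 0, 0], by
  simp [sl, supertrace, Fin.sum_univ_three]⟩

/-- The root vector opposite to `e1`. -/
def f1 : sl21 := ⟨!![0, 0, 0; 1, 0, 0; 0, 0, 0], by
  simp [sl, supertrace, Fin.sum_univ_three]⟩

/-- The root vector opposite to `e2`. -/
def f2 : sl21 := ⟨!![0, 0, 0; 0, 0, 0; 0, 1, 0], by
  simp [sl, supertrace, Fin.sum_univ_three]⟩

/-- The isospin generator: the Cartan element of `sl(2)`, with eigenvalues `-j, …, j` on the
representation of isospin `j`. -/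
noncomputable def isospin : sl21 := ⟨!![1 / 2, 0, 0; 0, 0, 0; 0, 0, -1 / 2], by
  have h0 : (altParity 3 0).val = 0 := by decide
  have h1 : (altParity 3 1).val = 1 := by decide
  have h2 : (altParity 3 2).val = 0 := by decide
  simp [sl, supertrace, Fin.sum_univ_three, h0, h1, h2]
  norm_num⟩

/-- The `gl(1)` generator commuting with `sl(2)`, with eigenvalues `± 1 / 2` on the odd part of
`sl(2|1)`. -/
noncomputable def baryon : sl21 := ⟨!![1 / 2, 0, 0; 0, 1, 0; 0, 0, 1 / 2], by
  have h0 : (altParity 3 0).val = 0 := by decide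
  have h1 : (altParity 3 1).val = 1 := by decide
  have h2 : (altParity 3 2).val = 0 := by decide
  simp [sl, supertrace, Fin.sum_univ_three, h0, h1, h2]
  norm_num⟩

/-- The name `(b, j)` or `(b, j)'` of an irreducible representation of `sl(2|1)`; `twoJ` is `2j`. -/
structure IrrepLabel where
  b : ℝ
  twoJ : ℕ
  primed : Bool

/-- The representation `(0, r)`. -/
def rep (r : ℕ) : IrrepLabel := ⟨0, 2 * r, false⟩

/-- The representation `(0, r)'`. -/
def rep' (r : ℕ) : IrrepLabel := ⟨0, 2 * r, true⟩

/-- The parity of the highest weight vector.  In the usual statistics the components of integer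
isospin are even and those of half-integer isospin odd; a prime exchanges the two. -/
def IrrepLabel.parity (L : IrrepLabel) : ZMod 2 := (L.twoJ : ZMod 2) + (if L.primed then 1 else 0)

/-- `U` is a subrepresentation of `V`, where `sl(2|1)` acts on the `ZMod 2`-graded space `V` by
`ρ`, and it is an irreducible representation with the given label `(b, j)` or `(b, j)'`: its highest
weight vector is homogeneous of the parity prescribed by the label, has isospin `j` and charge `b`,
and is annihilated by the two simple root vectors (hence by everything that raises the isospin). -/
structure IsIrrep {V : Type} [AddCommGroup V] [Module ℂ V] (grading : ZMod 2 → Submodule ℂ V)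
    (ρ : sl21 → V → V) (L : IrrepLabel) (U : Submodule ℂ V) : Prop where
  graded : ⨆ s, U ⊓ grading s = U
  invariant : ∀ x, ∀ u ∈ U, ρ x u ∈ U
  irreducible : ∀ W : Submodule ℂ V, W ≤ U → (∀ x, ∀ w ∈ W, ρ x w ∈ W) → W = ⊥ ∨ W = U
  highest : ∃ v ∈ U, v ≠ 0 ∧ v ∈ grading L.parity ∧ ρ e1 v = 0 ∧ ρ e2 v = 0 ∧
    ρ isospin v = ((L.twoJ : ℂ) / 2) • v ∧ ρ baryon v = (L.b : ℂ) • v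

/-- The subspace `M` of `V` is the direct sum of irreducible subrepresentations whose labels,
counted with multiplicity, are the given ones. -/
def DecomposesInto {V : Type} [AddCommGroup V] [Module ℂ V] (grading : ZMod 2 → Submodule ℂ V)
    (ρ : sl21 → V → V) (M : Submodule ℂ V) (labels : Multiset IrrepLabel) : Prop :=
  ∃ (κ : Type) (_ : Fintype κ) (label : κ → IrrepLabel) (U : κ → Submodule ℂ V),
    Finset.univ.val.map label = labels ∧ (∀ i, IsIrrep grading ρ (label i) (U i)) ∧
      iSupIndep U ∧ ⨆ i, U i = M

end SL21

section PrincipalEmbedding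

/-- The index set of `p + q` blocks of size `N + 1 + N`, where `N = 2j`. -/
abbrev BlockIndex (p q N : ℕ) : Type := (Fin p ⊕ Fin q) × Fin (2 * N + 1)

/-- The parity within each block alternates; it starts with even in the first `p` blocks, which
carry `sl(N+1|N)`, and with odd in the last `q` blocks, which carry `sl(N|N+1)`. -/
def blockParity (p q N : ℕ) : BlockIndex p q N → ZMod 2 := fun i =>
  altParity (2 * N + 1) i.2 + (match i.1 with
    | Sum.inl _ => 0
    | Sum.inr _ => 1)

/-- `p sl(N+1|N) ⊕ q sl(N|N+1)`: the block diagonal matrices each of whose diagonal blocks has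
supertrace zero. -/
def blockSL (p q N : ℕ) : Submodule ℂ (Matrix (BlockIndex p q N) (BlockIndex p q N) ℂ) where
  carrier := {A | (∀ i k, i.1 ≠ k.1 → A i k = 0) ∧
    ∀ a, ∑ k, (-1 : ℂ) ^ (blockParity p q N (a, k)).val * A (a, k) (a, k) = 0}
  add_mem' := by
    rintro A B ⟨hA, hA'⟩ ⟨hB, hB'⟩
    refine ⟨fun i k h => by simp [hA i k h, hB i k h], fun a => ?_⟩
    simp only [Matrix.add_apply, mul_add, Finset.sum_add_distrib, hA' a, hB' a, add_zero]
  zero_mem' := ⟨fun _ _ _ => rfl, fun a => by simp⟩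
  smul_mem' := by
    rintro c A ⟨hA, hA'⟩
    refine ⟨fun i k h => by simp [hA i k h], fun a => ?_⟩
    have := congrArg (fun z => c * z) (hA' a)
    simp only [Finset.mul_sum, mul_zero] at this
    rw [← this]
    exact Finset.sum_congr rfl fun k _ => by
      simp only [Matrix.smul_apply, smul_eq_mul]
      ring

theorem blockSL_le_sl (p q N : ℕ) : blockSL p q N ≤ sl (blockParity p q N) := by
  rintro A ⟨_, hA⟩
  simp only [sl, LinearMap.mem_ker, supertrace, LinearMap.coe_mk, AddHom.coe_mk]
  rw [Fintype.sum_prod_type]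
  exact Finset.sum_eq_zero fun a _ => hA a

/-- `φ` is a principal embedding of `sl(2|1)` in `p sl(N+1|N) ⊕ q sl(N|N+1)`: an injective
homomorphism of Lie superalgebras which sends the sum `e1 + e2` of the simple root vectors to a
linear combination with nonzero coefficients of all the simple root vectors `E_{k,k+1}` of all
blocks, and likewise for the negative simple root vectors.  The vectors `E_{k,k+1}` with `k` even
(counted from `0`) belong to the image of `e1`, the others to that of `e2`: with this normalisation
of the sign of the charge in each block, the fundamental representation restricts to
`p (j,j) ⊕ q (j,j)^π`, where `j = N / 2` and `π` is the exchange of parities. -/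
structure IsPrincipalEmbedding (p q N : ℕ)
    (φ : sl21 →ₗ[ℂ] Matrix (BlockIndex p q N) (BlockIndex p q N) ℂ) : Prop where
  injective : Function.Injective φ
  mem_blockSL : ∀ x, φ x ∈ blockSL p q N
  even : ∀ s, ∀ x : sl21, (x : Matrix (Fin 3) (Fin 3) ℂ) ∈ homSubspace (altParity 3) s →
    φ x ∈ homSubspace (blockParity p q N) s
  map_bracket : ∀ x y, φ (sl21Bracket x y) = sbracket (blockParity p q N) (φ x) (φ y)
  map_e1 : ∀ a k b l, φ e1 (a, k) (b, l) ≠ 0 ↔ a = b ∧ (l : ℕ) = k + 1 ∧ Even (k : ℕ)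
  map_e2 : ∀ a k b l, φ e2 (a, k) (b, l) ≠ 0 ↔ a = b ∧ (l : ℕ) = k + 1 ∧ Odd (k : ℕ)
  map_f1 : ∀ a k b l, φ f1 (a, k) (b, l) ≠ 0 ↔ a = b ∧ (k : ℕ) = l + 1 ∧ Even (l : ℕ)
  map_f2 : ∀ a k b l, φ f2 (a, k) (b, l) ≠ 0 ↔ a = b ∧ (k : ℕ) = l + 1 ∧ Odd (l : ℕ)

/-- The decomposition of a subspace `M` of `gl(m|n)` under the adjoint action of `φ (sl(2|1))`. -/
def AdjointDecomposesInto {p q N : ℕ}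
    (φ : sl21 →ₗ[ℂ] Matrix (BlockIndex p q N) (BlockIndex p q N) ℂ)
    (M : Submodule ℂ (Matrix (BlockIndex p q N) (BlockIndex p q N) ℂ))
    (labels : Multiset IrrepLabel) : Prop :=
  DecomposesInto (homSubspace (blockParity p q N))
    (fun x A => sbracket (blockParity p q N) (φ x) A) M labels

end PrincipalEmbedding

end SuperSL

/-! Complete reducibility fails for sl(2|1) in general, so the summands are exhibited explicitly;
highest weight vectors and the Casimir element replace general theory.

Reduction to one block. Write h_i = [e_i, f_i]. In each block the relations [h₁, e₂] = e₂ and [h₂,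
e₁] = -e₁ determine the product of the coefficients of E_{k,k+1} and E_{k+1,k}, so a diagonal
rescaling turns any principal embedding into the standard one (`IsPrincipalEmbedding.exists_gauge`).
Then gl(m|n) is the sum of (p+q)² stable copies of the matrices of size 2N+1, one for each ordered
pair of blocks. Right multiplication by the parity matrix, when the two blocks have opposite type,
identifies every copy, up to a shift of parity, with the super adjoint action on the matrices of one
standard block (`sbracket_blockEmb`).

One block. Let S be the sum of the E_{k,k+1}. The matrices killed by e₁ and e₂ are the combinations
of the S^{2r} with r ≤ N (`eq_sum_shiftMatrix`), and S^{2r} has h₁ = r, h₂ = -r, hence isospin r,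
charge 0 and Casimir value r². Let M_r be generated by S^{2r}. The Casimir commutes with the action,
so it is r² on M_r and the M_r are independent. A nonzero submodule of M_r contains a vector killed
by e₁ and e₂, which by its Casimir value is a multiple of S^{2r}; so M_r is irreducible. The M_r
fill the whole matrix space (`eq_top_of_shiftMatrix_mem`): descending from the longest diagonal,
lowering a diagonal yields all of the next one if that is odd, and all but at most one dimension if
it is even; S^{2r} supplies the rest by a positivity argument (`even_diagonal_vanish`).

Counting. In the block (a,a), M_0 is the line of scalars. Every other summand lies in sl(m|n),
because its generator has zero diagonal and the rest comes from superbrackets. What remains of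
sl(m|n) is the space of block scalars of supertrace zero. Each block has superdimension ±1, so this
space has dimension p+q-1 and meets the block subalgebra in 0; for p = q it contains the identity.
-/

namespace SuperSL

/-! ### The Chevalley relations and the super adjoint action in an associative ring. -/

section Relations

/-- The Chevalley relations of `sl(2|1)` in a ring, in terms of the four odd simple root vectors. -/
structure SL21Relations {R : Type*} [Ring R] (e₁ e₂ f₁ f₂ : R) : Prop where
  e₁_sq : e₁ * e₁ = 0
  e₂_sq : e₂ * e₂ = 0
  f₁_sq : f₁ * f₁ = 0
  f₂_sq : f₂ * f₂ = 0
  e₁_f₂ : e₁ * f₂ + f₂ * e₁ = 0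
  e₂_f₁ : e₂ * f₁ + f₁ * e₂ = 0
  h₁_e₂ : (e₁ * f₁ + f₁ * e₁) * e₂ - e₂ * (e₁ * f₁ + f₁ * e₁) = e₂
  h₁_f₂ : (e₁ * f₁ + f₁ * e₁) * f₂ - f₂ * (e₁ * f₁ + f₁ * e₁) = -f₂
  h₂_e₁ : (e₂ * f₂ + f₂ * e₂) * e₁ - e₁ * (e₂ * f₂ + f₂ * e₂) = -e₁
  h₂_f₁ : (e₂ * f₂ + f₂ * e₂) * f₁ - f₁ * (e₂ * f₂ + f₂ * e₂) = f₁

/-- The quadratic Casimir element of `sl(2|1)`. -/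
def casimir {R : Type*} [Ring R] (e₁ e₂ f₁ f₂ : R) : R :=
  (f₁ * f₂ + f₂ * f₁) * (e₁ * e₂ + e₂ * e₁) + f₁ * e₁ - f₂ * e₂
    - (e₁ * f₁ + f₁ * e₁) * (e₂ * f₂ + f₂ * e₂)

/-- The super adjoint action of an element `x` that anticommutes with the involution `ε`. -/
def oddAd {R : Type*} [Ring R] [Algebra ℂ R] (ε x : R) : Module.End ℂ R :=
  LinearMap.mulLeft ℂ x - LinearMap.mulRight ℂ x ∘ₗ LinearMap.mulRight ℂ ε ∘ₗ LinearMap.mulLeft ℂ ε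

variable {R : Type*} [Ring R] [Algebra ℂ R] {ε x y z : R}

@[simp]
theorem oddAd_apply (ε x A : R) : oddAd ε x A = x * A - ε * A * ε * x := rfl

/-- Conjugation by ε is the parity automorphism, so the sign (-1)^{|A|} needs no case distinction on
A. This is the super Jacobi identity for two odd elements. -/
theorem oddAd_anticomm (hε : ε * ε = 1) (hx : ε * x = -(x * ε)) (hy : ε * y = -(y * ε)) :
    oddAd ε x * oddAd ε y + oddAd ε y * oddAd ε x =
      LinearMap.mulLeft ℂ (x * y + y * x) - LinearMap.mulRight ℂ (x * y + y * x) := by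
  have hx' : ∀ A, ε * (x * A) = -(x * (ε * A)) := fun A => by
    rw [← mul_assoc, hx]; noncomm_ring
  have hy' : ∀ A, ε * (y * A) = -(y * (ε * A)) := fun A => by
    rw [← mul_assoc, hy]; noncomm_ring
  have hε' : ∀ A, ε * (ε * A) = A := fun A => by rw [← mul_assoc, hε, one_mul]
  ext A
  simp only [Module.End.mul_apply, LinearMap.add_apply, LinearMap.sub_apply, oddAd_apply,
    LinearMap.mulLeft_apply, LinearMap.mulRight_apply]
  simp only [mul_sub, sub_mul, mul_add, add_mul, mul_assoc, hx', hy', hε', mul_neg, neg_mul, neg_neg,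
    hx, hy, hε, mul_one]
  abel

theorem evenAd_comm_oddAd (hz : ε * z = z * ε) :
    (LinearMap.mulLeft ℂ z - LinearMap.mulRight ℂ z) * oddAd ε x
      - oddAd ε x * (LinearMap.mulLeft ℂ z - LinearMap.mulRight ℂ z) =
      oddAd ε (z * x - x * z) := by
  have hz' : ∀ A, ε * (z * A) = z * (ε * A) := fun A => by
    rw [← mul_assoc, hz]; noncomm_ring
  ext A
  simp only [Module.End.mul_apply, LinearMap.sub_apply, oddAd_apply,
    LinearMap.mulLeft_apply, LinearMap.mulRight_apply]
  simp only [mul_sub, sub_mul, mul_assoc, hz']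
  abel

/-- The adjoint operators satisfy the relations in the ordinary ring of endomorphisms, so every
identity derived from the relations, in particular centrality of the Casimir, applies to the adjoint
action. -/
theorem SL21Relations.oddAd {e₁ e₂ f₁ f₂ : R} (h : SL21Relations e₁ e₂ f₁ f₂) (hε : ε * ε = 1)
    (h1 : ε * e₁ = -(e₁ * ε)) (h2 : ε * e₂ = -(e₂ * ε))
    (h3 : ε * f₁ = -(f₁ * ε)) (h4 : ε * f₂ = -(f₂ * ε)) :
    SL21Relations (oddAd ε e₁) (oddAd ε e₂) (oddAd ε f₁) (oddAd ε f₂) := by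
  have sq : ∀ x : R, ε * x = -(x * ε) → x * x = 0 → SuperSL.oddAd ε x * SuperSL.oddAd ε x = 0 := by
    intro x hx hxx
    have := oddAd_anticomm hε hx hx
    rw [hxx, ← two_smul ℂ (SuperSL.oddAd ε x * SuperSL.oddAd ε x)] at this
    simpa using this
  have even : ∀ x y : R, ε * x = -(x * ε) → ε * y = -(y * ε) →
      ε * (x * y + y * x) = (x * y + y * x) * ε := by
    intro x y hx hy
    rw [mul_add, ← mul_assoc, ← mul_assoc, hx, hy, neg_mul, neg_mul, mul_assoc, mul_assoc, hx, hy]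
    noncomm_ring
  have neg : ∀ x : R, SuperSL.oddAd ε (-x) = -SuperSL.oddAd ε x := by
    intro x; ext A; simp only [oddAd_apply, LinearMap.neg_apply]; noncomm_ring
  refine ⟨sq _ h1 h.e₁_sq, sq _ h2 h.e₂_sq, sq _ h3 h.f₁_sq, sq _ h4 h.f₂_sq, ?_, ?_, ?_, ?_, ?_, ?_⟩
  · rw [oddAd_anticomm hε h1 h4, h.e₁_f₂]; simp
  · rw [oddAd_anticomm hε h2 h3, h.e₂_f₁]; simp
  · rw [oddAd_anticomm hε h1 h3, evenAd_comm_oddAd (even _ _ h1 h3), h.h₁_e₂]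
  · rw [oddAd_anticomm hε h1 h3, evenAd_comm_oddAd (even _ _ h1 h3), h.h₁_f₂, neg]
  · rw [oddAd_anticomm hε h2 h4, evenAd_comm_oddAd (even _ _ h2 h4), h.h₂_e₁, neg]
  · rw [oddAd_anticomm hε h2 h4, evenAd_comm_oddAd (even _ _ h2 h4), h.h₂_f₁]

end Relations

/-! ### The Casimir element commutes with the generators. -/

section Casimir

variable {R : Type*} [Ring R] {e₁ e₂ f₁ f₂ : R}

/-- The relations are symmetric under exchanging raising and lowering operators together with the
indices. -/
theorem SL21Relations.swap (h : SL21Relations e₁ e₂ f₁ f₂) : SL21Relations f₂ f₁ e₂ e₁ where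
  e₁_sq := h.f₂_sq
  e₂_sq := h.f₁_sq
  f₁_sq := h.e₂_sq
  f₂_sq := h.e₁_sq
  e₁_f₂ := by rw [add_comm]; exact h.e₁_f₂
  e₂_f₁ := by rw [add_comm]; exact h.e₂_f₁
  h₁_e₂ := by rw [add_comm (f₂ * e₂)]; exact h.h₂_f₁
  h₁_f₂ := by rw [add_comm (f₂ * e₂)]; exact h.h₂_e₁
  h₂_e₁ := by rw [add_comm (f₁ * e₁)]; exact h.h₁_f₂
  h₂_f₁ := by rw [add_comm (f₁ * e₁)]; exact h.h₁_e₂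

theorem SL21Relations.map {S : Type*} [Ring S] (h : SL21Relations e₁ e₂ f₁ f₂) (g : R →+* S) :
    SL21Relations (g e₁) (g e₂) (g f₁) (g f₂) where
  e₁_sq := by rw [← map_mul, h.e₁_sq, map_zero]
  e₂_sq := by rw [← map_mul, h.e₂_sq, map_zero]
  f₁_sq := by rw [← map_mul, h.f₁_sq, map_zero]
  f₂_sq := by rw [← map_mul, h.f₂_sq, map_zero]
  e₁_f₂ := by rw [← map_mul, ← map_mul, ← map_add, h.e₁_f₂, map_zero]
  e₂_f₁ := by rw [← map_mul, ← map_mul, ← map_add, h.e₂_f₁, map_zero]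
  h₁_e₂ := by simp only [← map_mul, ← map_add, ← map_sub, h.h₁_e₂]
  h₁_f₂ := by simp only [← map_mul, ← map_add, ← map_sub, h.h₁_f₂, map_neg]
  h₂_e₁ := by simp only [← map_mul, ← map_add, ← map_sub, h.h₂_e₁, map_neg]
  h₂_f₁ := by simp only [← map_mul, ← map_add, ← map_sub, h.h₂_f₁]

theorem SL21Relations.lower_comm_e₁ (h : SL21Relations e₁ e₂ f₁ f₂) :
    (f₁ * f₂ + f₂ * f₁) * e₁ - e₁ * (f₁ * f₂ + f₂ * f₁) = f₂ := by
  linear_combination (norm := noncomm_ring) -h.h₁_f₂ + f₁ * h.e₁_f₂ - h.e₁_f₂ * f₁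

theorem SL21Relations.lower_comm_e₂ (h : SL21Relations e₁ e₂ f₁ f₂) :
    (f₁ * f₂ + f₂ * f₁) * e₂ - e₂ * (f₁ * f₂ + f₂ * f₁) = -f₁ := by
  linear_combination (norm := noncomm_ring) -h.h₂_f₁ + f₂ * h.e₂_f₁ - h.e₂_f₁ * f₂

theorem SL21Relations.h₁_comm_h₂ (h : SL21Relations e₁ e₂ f₁ f₂) :
    (e₁ * f₁ + f₁ * e₁) * (e₂ * f₂ + f₂ * e₂) = (e₂ * f₂ + f₂ * e₂) * (e₁ * f₁ + f₁ * e₁) := by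
  linear_combination (norm := noncomm_ring) h.h₁_e₂ * f₂ + e₂ * h.h₁_f₂ + h.h₁_f₂ * e₂
    + f₂ * h.h₁_e₂

theorem SL21Relations.raise_comm_lower (h : SL21Relations e₁ e₂ f₁ f₂) :
    (e₁ * e₂ + e₂ * e₁) * (f₁ * f₂ + f₂ * f₁) - (f₁ * f₂ + f₂ * f₁) * (e₁ * e₂ + e₂ * e₁) =
      (e₁ * f₁ + f₁ * e₁) - (e₂ * f₂ + f₂ * e₂) := by
  linear_combination (norm := noncomm_ring) -h.lower_comm_e₁ * e₂ - e₁ * h.lower_comm_e₂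
    - h.lower_comm_e₂ * e₁ - e₂ * h.lower_comm_e₁

/-- The two forms differ by the order of the raising and lowering anticommutators and of h₁ and h₂.
Hence commutation with f₂ and f₁ follows from commutation with e₁ and e₂. -/
theorem SL21Relations.casimir_swap (h : SL21Relations e₁ e₂ f₁ f₂) :
    casimir f₂ f₁ e₂ e₁ = casimir e₁ e₂ f₁ f₂ := by
  unfold casimir
  linear_combination (norm := noncomm_ring) h.raise_comm_lower + h.h₁_comm_h₂

/-- Moving e₁ through the first term leaves -f₂(e₁e₂ + e₂e₁), which cancels the contribution of
f₂e₂; the contribution h₁e₁ of f₁e₁ cancels h₁[h₂, e₁] = -h₁e₁. The remaining terms contain e₁². -/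
theorem SL21Relations.commute_casimir_e₁ (h : SL21Relations e₁ e₂ f₁ f₂) :
    e₁ * casimir e₁ e₂ f₁ f₂ = casimir e₁ e₂ f₁ f₂ * e₁ := by
  unfold casimir
  linear_combination (norm := noncomm_ring) -h.lower_comm_e₁ * (e₁ * e₂ + e₂ * e₁)
    + (e₁ * f₁ + f₁ * e₁) * h.h₂_e₁ - h.e₁_f₂ * e₂
    - (f₁ * f₂ + f₂ * f₁) * e₂ * h.e₁_sq + (f₁ * f₂ + f₂ * f₁) * h.e₁_sq * e₂
    + f₁ * h.e₁_sq * (e₂ * f₂ + f₂ * e₂) - h.e₁_sq * f₁ * (e₂ * f₂ + f₂ * e₂) - 2 * f₁ * h.e₁_sq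

theorem SL21Relations.commute_casimir_e₂ (h : SL21Relations e₁ e₂ f₁ f₂) :
    e₂ * casimir e₁ e₂ f₁ f₂ = casimir e₁ e₂ f₁ f₂ * e₂ := by
  unfold casimir
  linear_combination (norm := noncomm_ring) -h.lower_comm_e₂ * (e₁ * e₂ + e₂ * e₁)
    + h.h₁_e₂ * (e₂ * f₂ + f₂ * e₂) + h.e₂_f₁ * e₁
    + (f₁ * f₂ + f₂ * f₁) * h.e₂_sq * e₁ + h.e₂_sq * f₂ - (f₁ * f₂ + f₂ * f₁) * e₁ * h.e₂_sq
    + f₂ * h.e₂_sq + (e₁ * f₁ + f₁ * e₁) * f₂ * h.e₂_sq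
    - (e₁ * f₁ + f₁ * e₁) * h.e₂_sq * f₂

theorem SL21Relations.commute_casimir_f₁ (h : SL21Relations e₁ e₂ f₁ f₂) :
    f₁ * casimir e₁ e₂ f₁ f₂ = casimir e₁ e₂ f₁ f₂ * f₁ := by
  rw [← h.casimir_swap]
  exact h.swap.commute_casimir_e₂

theorem SL21Relations.commute_casimir_f₂ (h : SL21Relations e₁ e₂ f₁ f₂) :
    f₂ * casimir e₁ e₂ f₁ f₂ = casimir e₁ e₂ f₁ f₂ * f₂ := by
  rw [← h.casimir_swap]
  exact h.swap.commute_casimir_e₁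

end Casimir
end SuperSL

namespace SuperSL

/-! ### Cyclic submodules. -/

section CyclicSpan

variable {V J : Type*} [AddCommGroup V] [Module ℂ V]

/-- The smallest subspace containing `v` and stable under the operators `T j`. -/
def cyclicSpan (T : J → Module.End ℂ V) (v : V) : Submodule ℂ V :=
  sInf {W | v ∈ W ∧ ∀ j, ∀ w ∈ W, T j w ∈ W}

theorem mem_cyclicSpan_self (T : J → Module.End ℂ V) (v : V) : v ∈ cyclicSpan T v :=
  (Submodule.mem_sInf).2 fun _ h => h.1

theorem cyclicSpan_stable (T : J → Module.End ℂ V) (v : V) (j : J) {w : V}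
    (hw : w ∈ cyclicSpan T v) : T j w ∈ cyclicSpan T v :=
  (Submodule.mem_sInf).2 fun W h => h.2 j w ((Submodule.mem_sInf).1 hw W h)

theorem cyclicSpan_le {T : J → Module.End ℂ V} {v : V} {W : Submodule ℂ V} (hv : v ∈ W)
    (hW : ∀ j, ∀ w ∈ W, T j w ∈ W) : cyclicSpan T v ≤ W :=
  sInf_le ⟨hv, hW⟩

end CyclicSpan

/-! ### Matrices supported on the main diagonal or on a neighbouring one. -/

section BandMatrices

variable {n : ℕ}

/-- The entries of a matrix, extended by zero to all pairs of natural numbers. -/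
def entry (A : Matrix (Fin n) (Fin n) ℂ) (i l : ℕ) : ℂ :=
  if h : i < n ∧ l < n then A ⟨i, h.1⟩ ⟨l, h.2⟩ else 0

theorem entry_eq {A : Matrix (Fin n) (Fin n) ℂ} {i l : ℕ} (hi : i < n) (hl : l < n) :
    entry A i l = A ⟨i, hi⟩ ⟨l, hl⟩ := by
  simp [entry, hi, hl]

theorem entry_of_le_left {A : Matrix (Fin n) (Fin n) ℂ} {i l : ℕ} (h : n ≤ i) : entry A i l = 0 := by
  simp [entry, not_lt.2 h]

theorem entry_of_le_right {A : Matrix (Fin n) (Fin n) ℂ} {i l : ℕ} (h : n ≤ l) :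
    entry A i l = 0 := by
  simp [entry, not_lt.2 h]

/-- The matrix `∑ c k E_{k,k+1}`. -/
def upMatrix (n : ℕ) (c : ℕ → ℂ) : Matrix (Fin n) (Fin n) ℂ :=
  fun i l => if (l : ℕ) = i + 1 then c i else 0

/-- The matrix `∑ d k E_{k+1,k}`. -/
def downMatrix (n : ℕ) (d : ℕ → ℂ) : Matrix (Fin n) (Fin n) ℂ :=
  fun i l => if (i : ℕ) = l + 1 then d l else 0

/-- The diagonal matrix `∑ g k E_{k,k}`. -/
def diagMatrix (n : ℕ) (g : ℕ → ℂ) : Matrix (Fin n) (Fin n) ℂ := Matrix.diagonal fun k => g k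

theorem up_mul_apply (c : ℕ → ℂ) (A : Matrix (Fin n) (Fin n) ℂ) (i l : Fin n) :
    (upMatrix n c * A) i l = c i * entry A (i + 1) l := by
  rw [Matrix.mul_apply]
  by_cases h : (i : ℕ) + 1 < n
  · rw [Finset.sum_eq_single (⟨i + 1, h⟩ : Fin n)]
    · simp [upMatrix, entry, h]
    · intro b _ hb
      have : (b : ℕ) ≠ i + 1 := fun h' => hb (Fin.ext h')
      simp [upMatrix, this]
    · simp
  · rw [entry_of_le_left (not_lt.1 h), mul_zero]
    refine Finset.sum_eq_zero fun b _ => ?_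
    have : (b : ℕ) ≠ i + 1 := by omega
    simp [upMatrix, this]

theorem mul_down_apply (d : ℕ → ℂ) (A : Matrix (Fin n) (Fin n) ℂ) (i l : Fin n) :
    (A * downMatrix n d) i l = entry A i (l + 1) * d l := by
  rw [Matrix.mul_apply]
  by_cases h : (l : ℕ) + 1 < n
  · rw [Finset.sum_eq_single (⟨l + 1, h⟩ : Fin n)]
    · simp [downMatrix, entry, h]
    · intro b _ hb
      have : (b : ℕ) ≠ l + 1 := fun h' => hb (Fin.ext h')
      simp [downMatrix, this]
    · simp
  · rw [entry_of_le_right (not_lt.1 h), zero_mul]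
    refine Finset.sum_eq_zero fun b _ => ?_
    have : (b : ℕ) ≠ l + 1 := by omega
    simp [downMatrix, this]

theorem down_mul_apply (d : ℕ → ℂ) (A : Matrix (Fin n) (Fin n) ℂ) (i l : Fin n) :
    (downMatrix n d * A) i l = if (i : ℕ) = 0 then 0 else d (i - 1) * entry A (i - 1) l := by
  rw [Matrix.mul_apply]
  split_ifs with h
  · refine Finset.sum_eq_zero fun b _ => ?_
    have : (i : ℕ) ≠ b + 1 := by omega
    simp [downMatrix, this]
  · have hi : (i : ℕ) - 1 < n := by omega
    rw [Finset.sum_eq_single (⟨i - 1, hi⟩ : Fin n)]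
    · have : (i : ℕ) = i - 1 + 1 := by omega
      simp [downMatrix, entry, hi, ← this]
    · intro b _ hb
      have : (i : ℕ) ≠ b + 1 := fun h' => hb (Fin.ext (by simp; omega))
      simp [downMatrix, this]
    · simp

theorem mul_up_apply (c : ℕ → ℂ) (A : Matrix (Fin n) (Fin n) ℂ) (i l : Fin n) :
    (A * upMatrix n c) i l = if (l : ℕ) = 0 then 0 else entry A i (l - 1) * c (l - 1) := by
  rw [Matrix.mul_apply]
  split_ifs with h
  · refine Finset.sum_eq_zero fun b _ => ?_
    have : (l : ℕ) ≠ b + 1 := by omega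
    simp [upMatrix, this]
  · have hl : (l : ℕ) - 1 < n := by omega
    rw [Finset.sum_eq_single (⟨l - 1, hl⟩ : Fin n)]
    · have : (l : ℕ) = l - 1 + 1 := by omega
      simp [upMatrix, entry, hl, ← this]
    · intro b _ hb
      have : (l : ℕ) ≠ b + 1 := fun h' => hb (Fin.ext (by simp; omega))
      simp [upMatrix, this]
    · simp

theorem up_mul_up_eq_zero {c c' : ℕ → ℂ} (h : ∀ k, k + 2 < n → c k * c' (k + 1) = 0) :
    upMatrix n c * upMatrix n c' = 0 := by
  ext i l
  rw [up_mul_apply]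
  by_cases hi : (i : ℕ) + 1 < n
  · rw [entry_eq hi l.2]
    simp only [upMatrix, mul_ite, mul_zero, Matrix.zero_apply]
    split_ifs with h'
    · exact h _ (by omega)
    · rfl
  · simp [entry_of_le_left (not_lt.1 hi)]

theorem down_mul_down_eq_zero {d d' : ℕ → ℂ} (h : ∀ k, k + 2 < n → d (k + 1) * d' k = 0) :
    downMatrix n d * downMatrix n d' = 0 := by
  ext i l
  rw [mul_down_apply]
  by_cases hi : (l : ℕ) + 1 < n
  · rw [entry_eq i.2 hi]
    simp only [downMatrix, ite_mul, zero_mul, Matrix.zero_apply]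
    split_ifs with h'
    · exact h _ (by omega)
    · rfl
  · simp [entry_of_le_right (not_lt.1 hi)]

theorem up_mul_down (c d : ℕ → ℂ) :
    upMatrix n c * downMatrix n d = diagMatrix n fun k => if k + 1 < n then c k * d k else 0 := by
  ext i l
  rw [up_mul_apply, diagMatrix, Matrix.diagonal_apply]
  by_cases hi : (i : ℕ) + 1 < n
  · rw [entry_eq hi l.2]
    by_cases h : i = l
    · subst h; simp [downMatrix, hi]
    · have : (i : ℕ) ≠ l := fun h' => h (Fin.ext h')
      simp [downMatrix, h, this]
  · simp [entry_of_le_left (not_lt.1 hi), hi]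

theorem down_mul_up (c d : ℕ → ℂ) :
    downMatrix n d * upMatrix n c =
      diagMatrix n fun k => if k = 0 then 0 else d (k - 1) * c (k - 1) := by
  ext i l
  rw [down_mul_apply, diagMatrix, Matrix.diagonal_apply]
  by_cases hi : (i : ℕ) = 0
  · simp [hi]
  · have hi' : (i : ℕ) - 1 < n := by omega
    rw [if_neg hi, entry_eq hi' l.2]
    by_cases h : i = l
    · subst h
      have : (i : ℕ) = i - 1 + 1 := by omega
      simp [upMatrix, hi, ← this]
    · have : (l : ℕ) ≠ i - 1 + 1 := fun h' => h (Fin.ext (by omega))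
      simp [upMatrix, h, this]

theorem diag_comm_up (g c : ℕ → ℂ) :
    diagMatrix n g * upMatrix n c - upMatrix n c * diagMatrix n g =
      upMatrix n fun k => (g k - g (k + 1)) * c k := by
  ext i l
  simp only [diagMatrix, Matrix.sub_apply, Matrix.diagonal_mul, Matrix.mul_diagonal, upMatrix]
  split_ifs with h
  · rw [h]; ring
  · ring

theorem diag_comm_down (g d : ℕ → ℂ) :
    diagMatrix n g * downMatrix n d - downMatrix n d * diagMatrix n g =
      downMatrix n fun k => (g (k + 1) - g k) * d k := by
  ext i l
  simp only [diagMatrix, Matrix.sub_apply, Matrix.diagonal_mul, Matrix.mul_diagonal, downMatrix]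
  split_ifs with h
  · rw [h]; ring
  · ring

theorem diag_add (g g' : ℕ → ℂ) :
    diagMatrix n g + diagMatrix n g' = diagMatrix n fun k => g k + g' k := by
  simp [diagMatrix, Matrix.diagonal_add]

theorem up_congr {c c' : ℕ → ℂ} (h : ∀ k, k + 1 < n → c k = c' k) :
    upMatrix n c = upMatrix n c' := by
  ext i l
  simp only [upMatrix]
  split_ifs with h'
  · exact h _ (by omega)
  · rfl

theorem down_congr {c c' : ℕ → ℂ} (h : ∀ k, k + 1 < n → c k = c' k) :
    downMatrix n c = downMatrix n c' := by
  ext i l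
  simp only [downMatrix]
  split_ifs with h'
  · exact h _ (by omega)
  · rfl

theorem diag_congr {c c' : ℕ → ℂ} (h : ∀ k, k < n → c k = c' k) :
    diagMatrix n c = diagMatrix n c' := by
  simp only [diagMatrix]
  congr 1
  funext k
  exact h k k.2

end BandMatrices

/-! ### The standard representation of dimension 2N+1 on one block. -/

section Model

variable (N : ℕ)

/-- The coefficients of the lowering operators of the spin `(N/2, N/2)` representation. -/
def lowerCoeff (k : ℕ) : ℂ := if Even k then (N : ℂ) - (k / 2 : ℕ) else ((k + 1) / 2 : ℕ)

/-- The parity matrix on alternating positions. -/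
def altSign (n : ℕ) : Matrix (Fin n) (Fin n) ℂ := diagMatrix n fun k => (-1) ^ k

def modelE₁ : Matrix (Fin (2 * N + 1)) (Fin (2 * N + 1)) ℂ :=
  upMatrix _ fun k => if Even k then 1 else 0

def modelE₂ : Matrix (Fin (2 * N + 1)) (Fin (2 * N + 1)) ℂ :=
  upMatrix _ fun k => if Even k then 0 else 1

def modelF₁ : Matrix (Fin (2 * N + 1)) (Fin (2 * N + 1)) ℂ :=
  downMatrix _ fun k => if Even k then lowerCoeff N k else 0

def modelF₂ : Matrix (Fin (2 * N + 1)) (Fin (2 * N + 1)) ℂ :=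
  downMatrix _ fun k => if Even k then 0 else lowerCoeff N k

theorem lowerCoeff_even (a : ℕ) : lowerCoeff N (2 * a) = N - a := by
  simp [lowerCoeff]

theorem lowerCoeff_odd (a : ℕ) : lowerCoeff N (2 * a + 1) = a + 1 := by
  have : (2 * a + 1 + 1) / 2 = a + 1 := by omega
  simp [lowerCoeff, this]

theorem modelH₁_eq : modelE₁ N * modelF₁ N + modelF₁ N * modelE₁ N =
    diagMatrix _ fun k => (N : ℂ) - (k / 2 : ℕ) := by
  rw [modelE₁, modelF₁, up_mul_down, down_mul_up, diag_add]
  refine diag_congr fun k hk => ?_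
  rcases Nat.even_or_odd' k with ⟨a, rfl | rfl⟩
  · rcases a with _ | a
    · by_cases h : 1 < 2 * N + 1
      · simp [h, lowerCoeff]
      · have : N = 0 := by omega
        simp [this]
    · have e : 2 * (a + 1) - 1 = 2 * a + 1 := by omega
      have h1 : (2 * (a + 1)) / 2 = a + 1 := by omega
      simp only [lowerCoeff_even, e]
      by_cases h : 2 * (a + 1) + 1 < 2 * N + 1
      · simp [h]
      -- The last position 2N has no upper neighbour, so its entry is 0, in agreement with N - N.
      · have : N = a + 1 := by omega
        simp [this]
  · have h1 : (2 * a + 1) / 2 = a := by omega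
    simp [h1, lowerCoeff_even]

theorem modelH₂_eq : modelE₂ N * modelF₂ N + modelF₂ N * modelE₂ N =
    diagMatrix _ fun k => (((k + 1) / 2 : ℕ) : ℂ) := by
  rw [modelE₂, modelF₂, up_mul_down, down_mul_up, diag_add]
  refine diag_congr fun k hk => ?_
  rcases Nat.even_or_odd' k with ⟨a, rfl | rfl⟩
  · rcases a with _ | a
    · simp
    · have e : 2 * (a + 1) - 1 = 2 * a + 1 := by omega
      have h1 : (2 * (a + 1) + 1) / 2 = a + 1 := by omega
      simp only [e, h1]
      simp [lowerCoeff_odd]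
  · have h1 : (2 * a + 1 + 1) / 2 = a + 1 := by omega
    have h2 : 2 * a + 1 + 1 < 2 * N + 1 := by omega
    simp [h1, lowerCoeff_odd, h2]

theorem model_relations : SL21Relations (modelE₁ N) (modelE₂ N) (modelF₁ N) (modelF₂ N) where
  e₁_sq := up_mul_up_eq_zero fun k _ => by by_cases h : Even k <;> simp [h, Nat.even_add_one]
  e₂_sq := up_mul_up_eq_zero fun k _ => by by_cases h : Even k <;> simp [h, Nat.even_add_one]
  f₁_sq := down_mul_down_eq_zero fun k _ => by by_cases h : Even k <;> simp [h, Nat.even_add_one]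
  f₂_sq := down_mul_down_eq_zero fun k _ => by by_cases h : Even k <;> simp [h, Nat.even_add_one]
  e₁_f₂ := by
    rw [modelE₁, modelF₂, up_mul_down, down_mul_up, diag_add]
    rw [diag_congr (c' := 0), diagMatrix]
    · simp
    · intro k _
      by_cases h : Even k <;> by_cases h' : Even (k - 1) <;> simp [h, h']
  e₂_f₁ := by
    rw [modelE₂, modelF₁, up_mul_down, down_mul_up, diag_add]
    rw [diag_congr (c' := 0), diagMatrix]
    · simp
    · intro k _
      by_cases h : Even k <;> by_cases h' : Even (k - 1) <;> simp [h, h']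
  h₁_e₂ := by
    rw [modelH₁_eq, modelE₂, diag_comm_up]
    refine up_congr fun k _ => ?_
    rcases Nat.even_or_odd' k with ⟨a, rfl | rfl⟩
    · simp
    · have h1 : (2 * a + 1) / 2 = a := by omega
      have h2 : (2 * a + 1 + 1) / 2 = a + 1 := by omega
      simp [h1, h2]
  h₁_f₂ := by
    rw [modelH₁_eq, modelF₂, diag_comm_down]
    have : ∀ d, -downMatrix (2 * N + 1) d = downMatrix _ fun k => - d k := by
      intro d; ext i l; simp only [downMatrix, Matrix.neg_apply]; split_ifs <;> simp
    rw [this]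
    refine down_congr fun k _ => ?_
    rcases Nat.even_or_odd' k with ⟨a, rfl | rfl⟩
    · simp
    · have h1 : (2 * a + 1) / 2 = a := by omega
      have h2 : (2 * a + 1 + 1) / 2 = a + 1 := by omega
      simp [h1, h2]
  h₂_e₁ := by
    rw [modelH₂_eq, modelE₁, diag_comm_up]
    have : ∀ d, -upMatrix (2 * N + 1) d = upMatrix _ fun k => - d k := by
      intro d; ext i l; simp only [upMatrix, Matrix.neg_apply]; split_ifs <;> simp
    rw [this]
    refine up_congr fun k _ => ?_
    rcases Nat.even_or_odd' k with ⟨a, rfl | rfl⟩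
    · have h1 : (2 * a + 1) / 2 = a := by omega
      have h2 : (2 * a + 1 + 1) / 2 = a + 1 := by omega
      simp [h1, h2]
    · simp
  h₂_f₁ := by
    rw [modelH₂_eq, modelF₁, diag_comm_down]
    refine down_congr fun k _ => ?_
    rcases Nat.even_or_odd' k with ⟨a, rfl | rfl⟩
    · have h1 : (2 * a + 1) / 2 = a := by omega
      have h2 : (2 * a + 1 + 1) / 2 = a + 1 := by omega
      simp [h1, h2]
    · simp

theorem altSign_mul_self (n : ℕ) : altSign n * altSign n = 1 := by
  rw [altSign, diagMatrix, Matrix.diagonal_mul_diagonal, ← Matrix.diagonal_one]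
  congr 1
  funext k
  rw [← mul_pow]; simp

theorem altSign_up (n : ℕ) (c : ℕ → ℂ) :
    altSign n * upMatrix n c = -(upMatrix n c * altSign n) := by
  ext i l
  simp only [altSign, diagMatrix, Matrix.neg_apply, Matrix.diagonal_mul, Matrix.mul_diagonal,
    upMatrix]
  split_ifs with h
  · rw [h, pow_succ]; ring
  · ring

theorem altSign_down (n : ℕ) (c : ℕ → ℂ) :
    altSign n * downMatrix n c = -(downMatrix n c * altSign n) := by
  ext i l
  simp only [altSign, diagMatrix, Matrix.neg_apply, Matrix.diagonal_mul, Matrix.mul_diagonal,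
    downMatrix]
  split_ifs with h
  · rw [h, pow_succ]; ring
  · ring

/-- The super adjoint action of the four simple root vectors on the matrices of one block. -/
def modelAd : Fin 4 → Module.End ℂ (Matrix (Fin (2 * N + 1)) (Fin (2 * N + 1)) ℂ) :=
  ![oddAd (altSign _) (modelE₁ N), oddAd (altSign _) (modelE₂ N),
    oddAd (altSign _) (modelF₁ N), oddAd (altSign _) (modelF₂ N)]

theorem modelAd_relations : SL21Relations (modelAd N 0) (modelAd N 1) (modelAd N 2) (modelAd N 3) :=
  (model_relations N).oddAd (altSign_mul_self _) (altSign_up _ _) (altSign_up _ _)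
    (altSign_down _ _) (altSign_down _ _)

/-- The Casimir operator of the adjoint action on one block. -/
def modelCasimir : Module.End ℂ (Matrix (Fin (2 * N + 1)) (Fin (2 * N + 1)) ℂ) :=
  casimir (modelAd N 0) (modelAd N 1) (modelAd N 2) (modelAd N 3)

theorem modelAd_comm_casimir (j : Fin 4) :
    modelAd N j * modelCasimir N = modelCasimir N * modelAd N j := by
  have h := modelAd_relations N
  fin_cases j
  · exact h.commute_casimir_e₁
  · exact h.commute_casimir_e₂
  · exact h.commute_casimir_f₁
  · exact h.commute_casimir_f₂

end Model
end SuperSL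

namespace SuperSL

/-! ### The lowering action on matrix units. -/

section MatrixUnits

variable {n : ℕ}

/-- The matrix unit `E_{i,l}`, equal to zero if `i` or `l` is out of range. -/
def matUnit (n i l : ℕ) : Matrix (Fin n) (Fin n) ℂ :=
  fun a b => if (a : ℕ) = i ∧ (b : ℕ) = l then 1 else 0

theorem matUnit_of_le_left {i l : ℕ} (h : n ≤ i) : matUnit n i l = 0 := by
  ext a b
  have : (a : ℕ) ≠ i := by omega
  simp [matUnit, this]

theorem matUnit_of_le_right {i l : ℕ} (h : n ≤ l) : matUnit n i l = 0 := by
  ext a b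
  have : (b : ℕ) ≠ l := by omega
  simp [matUnit, this]

theorem down_mul_matUnit (d : ℕ → ℂ) (i l : ℕ) :
    downMatrix n d * matUnit n i l = d i • matUnit n (i + 1) l := by
  ext a b
  rw [down_mul_apply]
  simp only [Matrix.smul_apply, smul_eq_mul, matUnit]
  split_ifs with h1 h2 h2
  · omega
  · simp
  · have : (a : ℕ) - 1 < n := by omega
    have h3 : (a : ℕ) - 1 = i := by omega
    rw [entry_eq this b.2, matUnit]
    simp [h3, h2.2]
  · have : (a : ℕ) - 1 < n := by omega
    rw [entry_eq this b.2, matUnit, if_neg (by simp; omega)]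
    simp

theorem matUnit_zero_mul_down (d : ℕ → ℂ) (i : ℕ) : matUnit n i 0 * downMatrix n d = 0 := by
  ext a b
  rw [mul_down_apply]
  by_cases h : (b : ℕ) + 1 < n
  · rw [entry_eq a.2 h, matUnit]; simp
  · rw [entry_of_le_right (not_lt.1 h)]; simp

/-- For l = n - 1 the left side is zero by the out-of-range convention, while the right side is d (n
- 1) times a genuine matrix unit; hence the condition on d. The lowering coefficients of the model
satisfy it since N - N = 0. -/
theorem matUnit_succ_mul_down {d : ℕ → ℂ} (hd : d (n - 1) = 0) (i l : ℕ) :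
    matUnit n i (l + 1) * downMatrix n d = d l • matUnit n i l := by
  ext a b
  rw [mul_down_apply]
  simp only [Matrix.smul_apply, smul_eq_mul]
  by_cases h : (b : ℕ) + 1 < n
  · rw [entry_eq a.2 h, matUnit, matUnit]
    by_cases hb : (b : ℕ) = l
    · simp [hb]
    · simp [hb]
  · rw [entry_of_le_right (not_lt.1 h), matUnit]
    by_cases hb : (b : ℕ) = l
    · have : l = n - 1 := by omega
      rw [this, hd]; simp
    · simp [hb]

theorem altSign_conj_apply (A : Matrix (Fin n) (Fin n) ℂ) (i l : Fin n) :
    (altSign n * A * altSign n) i l = (-1) ^ ((i : ℕ) + l) * A i l := by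
  simp only [altSign, diagMatrix, Matrix.diagonal_mul, Matrix.mul_diagonal, pow_add]
  ring

theorem altSign_conj_matUnit (i l : ℕ) :
    altSign n * matUnit n i l * altSign n = (-1 : ℂ) ^ (i + l) • matUnit n i l := by
  ext a b
  rw [altSign_conj_apply, Matrix.smul_apply, matUnit, smul_eq_mul]
  split_ifs with h
  · rw [h.1, h.2]
  · simp

theorem oddAd_down_matUnit_succ {d : ℕ → ℂ} (hd : d (n - 1) = 0) (i l : ℕ) :
    oddAd (altSign n) (downMatrix n d) (matUnit n i (l + 1)) =
      d i • matUnit n (i + 1) (l + 1) + ((-1) ^ (i + l) * d l) • matUnit n i l := by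
  rw [oddAd_apply, down_mul_matUnit, altSign_conj_matUnit, smul_mul_assoc,
    matUnit_succ_mul_down hd, smul_smul, ← add_assoc, pow_succ]
  module

theorem oddAd_down_matUnit_zero (d : ℕ → ℂ) (i : ℕ) :
    oddAd (altSign n) (downMatrix n d) (matUnit n i 0) = d i • matUnit n (i + 1) 0 := by
  rw [oddAd_apply, down_mul_matUnit, altSign_conj_matUnit, smul_mul_assoc,
    matUnit_zero_mul_down, smul_zero, sub_zero]

/-- The sum of all matrix units `E_{i,i+k}`. -/
def shiftMatrix (n k : ℕ) : Matrix (Fin n) (Fin n) ℂ :=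
  fun a b => if (b : ℕ) = a + k then 1 else 0

theorem shiftMatrix_eq_sum (n k : ℕ) :
    shiftMatrix n k = ∑ i ∈ Finset.range n, matUnit n i (i + k) := by
  ext a b
  rw [Matrix.sum_apply, Finset.sum_eq_single (a : ℕ)]
  · simp [shiftMatrix, matUnit]
  · intro c _ hc
    simp [matUnit, hc.symm]
  · simp

end MatrixUnits

/-! ### The even powers of the shift generate the full matrix space. -/

section Generation

variable {N : ℕ} {S : Submodule ℂ (Matrix (Fin (2 * N + 1)) (Fin (2 * N + 1)) ℂ)}

theorem lowerCoeff_ne_zero {k : ℕ} (hk : k < 2 * N) : lowerCoeff N k ≠ 0 := by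
  rcases Nat.even_or_odd' k with ⟨a, rfl | rfl⟩
  · rw [lowerCoeff_even, sub_ne_zero]
    exact_mod_cast (by omega : N ≠ a)
  · rw [lowerCoeff_odd]
    exact_mod_cast Nat.succ_ne_zero a

theorem modelAd_two_matUnit (i l : ℕ) :
    modelAd N 2 (matUnit _ i (l + 1)) =
      (if Even i then lowerCoeff N i else 0) • matUnit _ (i + 1) (l + 1)
        + ((-1) ^ (i + l) * if Even l then lowerCoeff N l else 0) • matUnit _ i l :=
  oddAd_down_matUnit_succ (by simp [lowerCoeff_even]) i l

theorem modelAd_three_matUnit (i l : ℕ) :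
    modelAd N 3 (matUnit _ i (l + 1)) =
      (if Even i then 0 else lowerCoeff N i) • matUnit _ (i + 1) (l + 1)
        + ((-1) ^ (i + l) * if Even l then 0 else lowerCoeff N l) • matUnit _ i l :=
  oddAd_down_matUnit_succ (by simp) i l

theorem modelAd_lower_matUnit (i l : ℕ) :
    modelAd N 2 (matUnit _ i (l + 1)) + modelAd N 3 (matUnit _ i (l + 1)) =
      lowerCoeff N i • matUnit _ (i + 1) (l + 1)
        + ((-1) ^ (i + l) * lowerCoeff N l) • matUnit _ i l := by
  rw [modelAd_two_matUnit, modelAd_three_matUnit]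
  by_cases hi : Even i <;> by_cases hl : Even l <;> simp only [hi, hl, if_true, if_false] <;> module

theorem modelAd_lower_matUnit_zero (i : ℕ) :
    modelAd N 2 (matUnit _ i 0) + modelAd N 3 (matUnit _ i 0) =
      lowerCoeff N i • matUnit _ (i + 1) 0 := by
  have h2 : modelAd N 2 (matUnit _ i 0) = _ := oddAd_down_matUnit_zero _ _
  have h3 : modelAd N 3 (matUnit _ i 0) = _ := oddAd_down_matUnit_zero _ _
  rw [h2, h3]
  by_cases hi : Even i <;> simp only [hi, if_true, if_false] <;> module

theorem sum_range_two_mul_add_one {M : Type*} [AddCommMonoid M] (g : ℕ → M) (N : ℕ) :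
    ∑ i ∈ Finset.range (2 * N + 1), g i =
      ∑ a ∈ Finset.range (N + 1), g (2 * a) + ∑ a ∈ Finset.range N, g (2 * a + 1) := by
  induction N with
  | zero => simp
  | succ N ih =>
    have : 2 * (N + 1) + 1 = 2 * N + 1 + 1 + 1 := by ring
    rw [this, Finset.sum_range_succ, Finset.sum_range_succ, ih, Finset.sum_range_succ _ (N + 1),
      Finset.sum_range_succ (fun a => g (2 * a + 1)) N]
    have : 2 * N + 1 + 1 = 2 * (N + 1) := by ring
    rw [this]
    abel

/-- The vectors `v i` stand for the matrix units on one even diagonal, modulo the subspace generated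
by the longer diagonals. -/
theorem even_diagonal_vanish {M : Type*} [AddCommGroup M] [Module ℂ M] (v : ℕ → M) (r : ℕ)
    (hv : ∀ i, 2 * N + 1 ≤ i + 2 * r → v i = 0)
    (hrel : ∀ i, lowerCoeff N i • v (i + 1) + lowerCoeff N (i + 2 * r) • v i = 0)
    (hsum : ∑ i ∈ Finset.range (2 * N + 1), v i = 0) (i : ℕ) : v i = 0 := by
  -- In the sum of all relations `hrel` each v (2a) has coefficient a + (N - a - r) = N - r and each
  -- v (2a+1) has (N - a) + (a + r + 1) = N + r + 1. Subtracting from (N + r + 1) times `hsum`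
  -- leaves 2r + 1 times the even part.
  have hw : ∑ a ∈ Finset.range (N + 1), v (2 * a) = 0 := by
    have e1 : ∑ i ∈ Finset.range (2 * N + 1),
        (lowerCoeff N i • v (i + 1) + lowerCoeff N (i + 2 * r) • v i) = 0 :=
      Finset.sum_eq_zero fun i _ => hrel i
    have e2 : ∀ a, lowerCoeff N (2 * a + 2 * r) = N - (a + r) := fun a => by
      rw [← mul_add, lowerCoeff_even]; push_cast; ring
    have e3 : ∀ a, lowerCoeff N (2 * a + 1 + 2 * r) = a + r + 1 := fun a => by
      rw [show 2 * a + 1 + 2 * r = 2 * (a + r) + 1 by ring, lowerCoeff_odd]; push_cast; ring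
    rw [sum_range_two_mul_add_one] at e1 hsum
    simp only [e2, e3, lowerCoeff_even, lowerCoeff_odd, Finset.sum_add_distrib] at e1
    have e4 : ∑ a ∈ Finset.range (N + 1), ((N : ℂ) - a) • v (2 * a + 1) =
        ∑ a ∈ Finset.range N, ((N : ℂ) - a) • v (2 * a + 1) := by
      rw [Finset.sum_range_succ]; simp
    have e5 : ∑ a ∈ Finset.range N, ((a : ℂ) + 1) • v (2 * a + 1 + 1) =
        ∑ a ∈ Finset.range (N + 1), (a : ℂ) • v (2 * a) := by
      rw [Finset.sum_range_succ' (fun a : ℕ => (a : ℂ) • v (2 * a))]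
      simp [mul_add]
    rw [e4, e5] at e1
    have e6 : (2 * r + 1 : ℂ) • ∑ a ∈ Finset.range (N + 1), v (2 * a) = 0 := by
      calc _ = (N + r + 1 : ℂ) • (∑ a ∈ Finset.range (N + 1), v (2 * a)
              + ∑ a ∈ Finset.range N, v (2 * a + 1)) - 0 := ?_
        _ = 0 := by rw [hsum]; simp
      rw [← e1]
      simp only [smul_add, Finset.smul_sum]
      have f1 : ∑ a ∈ Finset.range N, ((N : ℂ) - a) • v (2 * a + 1)
          + ∑ a ∈ Finset.range N, ((a : ℂ) + r + 1) • v (2 * a + 1) =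
          ∑ a ∈ Finset.range N, (N + r + 1 : ℂ) • v (2 * a + 1) := by
        rw [← Finset.sum_add_distrib]
        exact Finset.sum_congr rfl fun a _ => by module
      have f2 : ∑ a ∈ Finset.range (N + 1), (a : ℂ) • v (2 * a)
          + ∑ a ∈ Finset.range (N + 1), ((N : ℂ) - (a + r)) • v (2 * a)
          + ∑ a ∈ Finset.range (N + 1), (2 * r + 1 : ℂ) • v (2 * a) =
          ∑ a ∈ Finset.range (N + 1), (N + r + 1 : ℂ) • v (2 * a) := by
        rw [← Finset.sum_add_distrib, ← Finset.sum_add_distrib]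
        exact Finset.sum_congr rfl fun a _ => by module
      rw [← f1, ← f2]
      abel
    have e7 : (2 * r + 1 : ℂ) ≠ 0 := by exact_mod_cast Nat.succ_ne_zero (2 * r)
    exact (smul_eq_zero.1 e6).resolve_left e7
  -- Each relation changes the sign from one vector to the next, so two of them relate even
  -- neighbours with a positive factor; beyond the end of the diagonal the factor is 0.
  have hpos : ∀ a, ∃ c : ℝ, 0 ≤ c ∧ v (2 * a) = (c : ℂ) • v 0 := by
    intro a
    induction a with
    | zero => exact ⟨1, zero_le_one, by simp⟩
    | succ a ih =>
      obtain ⟨c, hc, ha⟩ := ih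
      by_cases h : 2 * N + 1 ≤ 2 * (a + 1) + 2 * r
      · exact ⟨0, le_rfl, by rw [hv _ h]; simp⟩
      -- With this parametrisation no coefficient contains a subtraction, so the positivity of the
      -- ratio is visible.
      · obtain ⟨t, rfl⟩ : ∃ t, N = a + r + 1 + t := ⟨N - (a + r + 1), by omega⟩
        have h1 := hrel (2 * a)
        have h2 := hrel (2 * a + 1)
        rw [show 2 * a + 2 * r = 2 * (a + r) by ring, lowerCoeff_even, lowerCoeff_even] at h1
        rw [show 2 * a + 1 + 2 * r = 2 * (a + r) + 1 by ring, lowerCoeff_odd, lowerCoeff_odd,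
          show 2 * a + 1 + 1 = 2 * (a + 1) by ring] at h2
        push_cast at h1 h2
        have h3 : ((r + 1 + t : ℂ) * (a + 1)) • v (2 * (a + 1)) =
            ((a + r + 1 : ℂ) * (1 + t)) • v (2 * a) := by
          linear_combination (norm := module) (r + 1 + t : ℂ) • h2 - (a + r + 1 : ℂ) • h1
        refine ⟨(a + r + 1) * (1 + t) / ((r + 1 + t) * (a + 1)) * c, by positivity, ?_⟩
        have h4 : ((r + 1 + t : ℂ) * (a + 1)) ≠ 0 := by
          exact_mod_cast (by positivity : (r + 1 + t) * (a + 1) ≠ 0)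
        apply smul_right_injective M h4
        simp only
        rw [h3, ha, smul_smul, smul_smul]
        congr 1
        have h5 := left_ne_zero_of_mul h4
        have h6 := right_ne_zero_of_mul h4
        push_cast
        field_simp
  -- If v 0 were nonzero, `hw` would make a sum of nonnegative reals vanish whose term at a = 0 is
  -- 1.
  have h0 : v 0 = 0 := by
    by_contra h0
    choose c hc hv' using hpos
    have h1 : c 0 = 1 := by
      have := hv' 0
      rw [mul_zero] at this
      have h2 : ((c 0 : ℂ)) • v 0 = (1 : ℂ) • v 0 := by rw [← this, one_smul]
      exact_mod_cast smul_left_injective ℂ h0 h2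
    rw [Finset.sum_congr rfl fun a _ => hv' a, ← Finset.sum_smul] at hw
    have h2 := (smul_eq_zero.1 hw).resolve_right h0
    have h3 : ∑ a ∈ Finset.range (N + 1), c a = 0 := by exact_mod_cast h2
    have h4 := (Finset.sum_eq_zero_iff_of_nonneg fun a _ => hc a).1 h3 0 (by simp)
    rw [h1] at h4
    exact one_ne_zero h4
  induction i with
  | zero => exact h0
  | succ i ih =>
    by_cases h : i < 2 * N
    · have := hrel i
      rw [ih, smul_zero, add_zero] at this
      exact (smul_eq_zero.1 this).resolve_left (lowerCoeff_ne_zero h)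
    · exact hv _ (by omega)

/-- The two terms of the lowering bracket act on the row i and on the column i + k. On an odd
diagonal these have opposite parities, so f₁ produces one term and f₂ the other, each a multiple of
a single matrix unit. -/
theorem matUnit_mem_of_longer_odd (hS : ∀ j, ∀ A ∈ S, modelAd N j A ∈ S) {k : ℕ} (hk : Odd k)
    (h : ∀ i, matUnit _ i (i + k + 1) ∈ S) (i : ℕ) : matUnit _ i (i + k) ∈ S := by
  obtain ⟨b, rfl⟩ := hk
  rcases Nat.even_or_odd' i with ⟨a, rfl | rfl⟩
  · have h1 := hS 3 _ (h (2 * a))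
    rw [modelAd_three_matUnit] at h1
    have o : ¬ Even (2 * a + (2 * b + 1)) := by
      rw [Nat.not_even_iff_odd]; exact ⟨a + b, by ring⟩
    simp only [even_two_mul, if_true, zero_smul, zero_add, o, if_false] at h1
    have h2 : lowerCoeff N (2 * a + (2 * b + 1)) ≠ 0 := by
      rw [show 2 * a + (2 * b + 1) = 2 * (a + b) + 1 by ring, lowerCoeff_odd]
      exact_mod_cast Nat.succ_ne_zero (a + b)
    exact (S.smul_mem_iff (mul_ne_zero (pow_ne_zero _ (by norm_num)) h2)).1 h1
  · by_cases ha : a < N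
    · have h1 := hS 2 _ (h (2 * a))
      rw [modelAd_two_matUnit] at h1
      have o : ¬ Even (2 * a + (2 * b + 1)) := by
        rw [Nat.not_even_iff_odd]; exact ⟨a + b, by ring⟩
      simp only [even_two_mul, if_true, o, if_false, mul_zero, zero_smul, add_zero] at h1
      have := (S.smul_mem_iff (lowerCoeff_ne_zero (by omega))).1 h1
      rwa [show 2 * a + (2 * b + 1) + 1 = 2 * a + 1 + (2 * b + 1) by ring] at this
    · rw [matUnit_of_le_left (by omega)]
      exact S.zero_mem

/-- On an even diagonal f₁ and f₂ each give only relations between neighbours. Modulo S these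
relations, together with the vanishing of the class of S^{2r}, are the hypotheses of
`even_diagonal_vanish`. -/
theorem matUnit_mem_of_longer_even (hS : ∀ j, ∀ A ∈ S, modelAd N j A ∈ S) {r : ℕ}
    (hr : shiftMatrix _ (2 * r) ∈ S)
    (h : ∀ i, matUnit _ i (i + 2 * r + 1) ∈ S) (i : ℕ) : matUnit _ i (i + 2 * r) ∈ S := by
  rw [← Submodule.Quotient.mk_eq_zero]
  refine even_diagonal_vanish (N := N)
    (fun i => (Submodule.Quotient.mk (matUnit _ i (i + 2 * r)) : _ ⧸ S)) r ?_ ?_ ?_ i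
  · intro i hi
    rw [matUnit_of_le_right hi, Submodule.Quotient.mk_zero]
  · intro i
    have h1 := S.add_mem (hS 2 _ (h i)) (hS 3 _ (h i))
    rw [modelAd_lower_matUnit, ← Submodule.Quotient.mk_eq_zero, Submodule.Quotient.mk_add,
      Submodule.Quotient.mk_smul, Submodule.Quotient.mk_smul,
      Even.neg_one_pow ⟨i + r, by ring⟩, one_mul] at h1
    rwa [show i + 1 + 2 * r = i + 2 * r + 1 by ring]
  · rw [shiftMatrix_eq_sum, ← Submodule.Quotient.mk_eq_zero] at hr
    rw [← hr]
    exact (map_sum S.mkQ _ _).symm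

theorem eq_top_of_shiftMatrix_mem (hS : ∀ j, ∀ A ∈ S, modelAd N j A ∈ S)
    (hr : ∀ r ≤ N, shiftMatrix _ (2 * r) ∈ S) : S = ⊤ := by
  have upper : ∀ m k, k + m = 2 * N + 1 → ∀ i, matUnit _ i (i + k) ∈ S := by
    intro m
    induction m with
    | zero => intro k hk i; rw [matUnit_of_le_right (by omega)]; exact S.zero_mem
    | succ m ih =>
      intro k hk i
      have h := ih (k + 1) (by omega)
      rcases Nat.even_or_odd' k with ⟨a, rfl | rfl⟩
      · exact matUnit_mem_of_longer_even hS (hr a (by omega)) h i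
      · exact matUnit_mem_of_longer_odd hS ⟨a, rfl⟩ h i
  -- Below the main diagonal f₁ + f₂ sends E_{l+d,l} to a multiple of E_{l+d+1,l} plus a multiple of
  -- E_{l+d,l-1}. The second lies on the diagonal being built, one column to the left, whence the
  -- inner induction on the column.
  have lower : ∀ d l, matUnit _ (l + d) l ∈ S := by
    intro d
    induction d with
    | zero => intro l; exact upper (2 * N + 1) 0 (by omega) l
    | succ d ih =>
      intro l
      by_cases hl : l + d < 2 * N
      · induction l with
        | zero =>
          have h1 := S.add_mem (hS 2 _ (ih 0)) (hS 3 _ (ih 0))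
          rw [modelAd_lower_matUnit_zero] at h1
          exact (S.smul_mem_iff (lowerCoeff_ne_zero hl)).1 h1
        | succ l ihl =>
          have h1 := S.add_mem (hS 2 _ (ih (l + 1))) (hS 3 _ (ih (l + 1)))
          have h2 := ihl (by omega)
          rw [modelAd_lower_matUnit] at h1
          rw [show l + (d + 1) = l + 1 + d by ring] at h2
          rw [S.add_mem_iff_left (S.smul_mem _ h2)] at h1
          exact (S.smul_mem_iff (lowerCoeff_ne_zero hl)).1 h1
      · rw [matUnit_of_le_left (by omega)]; exact S.zero_mem
  have all : ∀ i l, i < 2 * N + 1 → l < 2 * N + 1 → matUnit _ i l ∈ S := by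
    intro i l hi hl
    rcases le_total l i with h | h
    · obtain ⟨d, rfl⟩ := Nat.exists_eq_add_of_le h
      exact lower d l
    · obtain ⟨d, rfl⟩ := Nat.exists_eq_add_of_le h
      exact upper (2 * N + 1 - d) d (by omega) i
  rw [eq_top_iff]
  intro A _
  rw [Matrix.matrix_eq_sum_single A]
  refine S.sum_mem fun i _ => S.sum_mem fun l _ => ?_
  have : Matrix.single i l (A i l) = A i l • matUnit _ i l := by
    ext a b
    simp only [Matrix.single_apply, Matrix.smul_apply, matUnit, smul_eq_mul, Fin.ext_iff]
    simp only [eq_comm (b := (i : ℕ)), eq_comm (b := (l : ℕ))]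
    split_ifs <;> simp_all
  rw [this]
  exact S.smul_mem _ (all i l i.2 l.2)

end Generation
end SuperSL

namespace SuperSL

/-! ### Highest weight vectors, irreducibility and independence in one block. -/

section HighestWeight

variable {n : ℕ}

theorem oddAd_up_apply (c : ℕ → ℂ) (A : Matrix (Fin n) (Fin n) ℂ) (i l : Fin n) :
    oddAd (altSign n) (upMatrix n c) A i l = c i * entry A (i + 1) l
      - if (l : ℕ) = 0 then 0 else (-1) ^ ((i : ℕ) + (l - 1)) * entry A i (l - 1) * c (l - 1) := by
  rw [oddAd_apply, Matrix.sub_apply, up_mul_apply, mul_up_apply]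
  congr 1
  split_ifs with h
  · rfl
  · have hl : (l : ℕ) - 1 < n := by omega
    rw [entry_eq i.2 hl, entry_eq i.2 hl, altSign_conj_apply]

/-- A nonzero subspace stable under two operators of the form `oddAd (upMatrix c)` contains a
nonzero vector annihilated by both. -/
theorem exists_annihilated {c c' : ℕ → ℂ} {W : Submodule ℂ (Matrix (Fin n) (Fin n) ℂ)}
    (h : ∀ A ∈ W, oddAd (altSign n) (upMatrix n c) A ∈ W)
    (h' : ∀ A ∈ W, oddAd (altSign n) (upMatrix n c') A ∈ W) (hW : W ≠ ⊥) :
    ∃ A ∈ W, A ≠ 0 ∧ oddAd (altSign n) (upMatrix n c) A = 0 ∧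
      oddAd (altSign n) (upMatrix n c') A = 0 := by
  -- Raising shifts the support up by one diagonal. The condition at k says that all diagonals with
  -- l - i < k - n vanish: it is empty for k = 0 and forces A = 0 for k = 2n.
  have step : ∀ (c : ℕ → ℂ) (k : ℕ) (A : Matrix (Fin n) (Fin n) ℂ),
      (∀ i l : Fin n, (l : ℕ) + n < i + k → A i l = 0) →
      ∀ i l : Fin n, (l : ℕ) + n < i + (k + 1) →
        oddAd (altSign n) (upMatrix n c) A i l = 0 := by
    intro c k A hA i l hil
    rw [oddAd_up_apply]
    have h1 : entry A (i + 1) l = 0 := by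
      by_cases hi : (i : ℕ) + 1 < n
      · rw [entry_eq hi l.2]
        exact hA _ _ (by simp; omega)
      · exact entry_of_le_left (not_lt.1 hi)
    rw [h1]
    split_ifs with hl
    · simp
    · have hl' : (l : ℕ) - 1 < n := by omega
      rw [entry_eq i.2 hl', hA _ _ (by simp; omega)]
      simp
  have main : ∀ m k, k + m = 2 * n → ∀ A ∈ W, A ≠ 0 →
      (∀ i l : Fin n, (l : ℕ) + n < i + k → A i l = 0) →
      ∃ A ∈ W, A ≠ 0 ∧ oddAd (altSign n) (upMatrix n c) A = 0 ∧
        oddAd (altSign n) (upMatrix n c') A = 0 := by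
    intro m
    induction m with
    | zero =>
      intro k hk A _ hA0 hA
      exact absurd (Matrix.ext fun i l => hA i l (by omega)) hA0
    | succ m ih =>
      intro k hk A hAW hA0 hA
      by_cases h1 : oddAd (altSign n) (upMatrix n c) A = 0
      · by_cases h2 : oddAd (altSign n) (upMatrix n c') A = 0
        · exact ⟨A, hAW, hA0, h1, h2⟩
        · exact ih (k + 1) (by omega) _ (h' A hAW) h2 (step _ _ _ hA)
      · exact ih (k + 1) (by omega) _ (h A hAW) h1 (step _ _ _ hA)
  obtain ⟨A, hA, hA0⟩ := W.exists_mem_ne_zero_of_ne_bot hW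
  exact main (2 * n) 0 (by omega) A hA hA0 fun i l hil => by omega

variable {N : ℕ}

theorem altSign_conj_shiftMatrix (n r : ℕ) :
    altSign n * shiftMatrix n (2 * r) * altSign n = shiftMatrix n (2 * r) := by
  ext i l
  rw [altSign_conj_apply, shiftMatrix]
  split_ifs with h
  · rw [h, Even.neg_one_pow ⟨i + r, by ring⟩, one_mul]
  · simp

theorem oddAd_up_shiftMatrix {c : ℕ → ℂ} (hc : ∀ k r, c (k + 2 * r) = c k) (r : ℕ) :
    oddAd (altSign n) (upMatrix n c) (shiftMatrix n (2 * r)) = 0 := by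
  rw [oddAd_apply, altSign_conj_shiftMatrix, sub_eq_zero]
  ext i l
  rw [up_mul_apply, mul_up_apply]
  by_cases hl : (l : ℕ) = i + 1 + 2 * r
  · have h1 : (i : ℕ) + 1 < n := by omega
    have h2 : (l : ℕ) - 1 < n := by omega
    have h3 : (l : ℕ) - 1 = i + 2 * r := by omega
    rw [entry_eq h1 l.2, entry_eq i.2 h2, if_neg (by omega)]
    simp only [shiftMatrix, h3, hc]
    rw [if_pos hl, if_pos trivial, one_mul, mul_one]
  · have h1 : entry (shiftMatrix n (2 * r)) (i + 1) l = 0 := by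
      rw [entry]; split_ifs <;> simp [shiftMatrix, hl]
    rw [h1]
    split_ifs with h0
    · simp
    · have : (l : ℕ) - 1 ≠ i + 2 * r := by omega
      have h2 : entry (shiftMatrix n (2 * r)) i (l - 1) = 0 := by
        rw [entry]; split_ifs <;> simp [shiftMatrix, this]
      rw [h2]; simp

theorem modelAd_zero_shiftMatrix (r : ℕ) : modelAd N 0 (shiftMatrix _ (2 * r)) = 0 :=
  oddAd_up_shiftMatrix (fun k r => by simp [Nat.even_add]) r

theorem modelAd_one_shiftMatrix (r : ℕ) : modelAd N 1 (shiftMatrix _ (2 * r)) = 0 :=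
  oddAd_up_shiftMatrix (fun k r => by simp [Nat.even_add]) r

theorem modelAd_h₁_shiftMatrix (r : ℕ) :
    (modelAd N 0 * modelAd N 2 + modelAd N 2 * modelAd N 0) (shiftMatrix _ (2 * r)) =
      (r : ℂ) • shiftMatrix _ (2 * r) := by
  have h : modelAd N 0 * modelAd N 2 + modelAd N 2 * modelAd N 0 = _ :=
    oddAd_anticomm (altSign_mul_self _) (altSign_up _ _) (altSign_down _ _)
  rw [h]
  change (LinearMap.mulLeft ℂ (modelE₁ N * modelF₁ N + modelF₁ N * modelE₁ N)
    - LinearMap.mulRight ℂ (modelE₁ N * modelF₁ N + modelF₁ N * modelE₁ N)) _ = _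
  rw [modelH₁_eq]
  ext i l
  simp only [LinearMap.sub_apply, LinearMap.mulLeft_apply, LinearMap.mulRight_apply, diagMatrix,
    Matrix.sub_apply, Matrix.diagonal_mul, Matrix.mul_diagonal, Matrix.smul_apply, shiftMatrix,
    smul_eq_mul]
  split_ifs with hl
  · have : (l : ℕ) / 2 = i / 2 + r := by omega
    rw [this]; push_cast; ring
  · ring

theorem modelAd_h₂_shiftMatrix (r : ℕ) :
    (modelAd N 1 * modelAd N 3 + modelAd N 3 * modelAd N 1) (shiftMatrix _ (2 * r)) =
      -(r : ℂ) • shiftMatrix _ (2 * r) := by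
  have h : modelAd N 1 * modelAd N 3 + modelAd N 3 * modelAd N 1 = _ :=
    oddAd_anticomm (altSign_mul_self _) (altSign_up _ _) (altSign_down _ _)
  rw [h]
  change (LinearMap.mulLeft ℂ (modelE₂ N * modelF₂ N + modelF₂ N * modelE₂ N)
    - LinearMap.mulRight ℂ (modelE₂ N * modelF₂ N + modelF₂ N * modelE₂ N)) _ = _
  rw [modelH₂_eq]
  ext i l
  simp only [LinearMap.sub_apply, LinearMap.mulLeft_apply, LinearMap.mulRight_apply, diagMatrix,
    Matrix.sub_apply, Matrix.diagonal_mul, Matrix.mul_diagonal, Matrix.smul_apply, shiftMatrix,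
    smul_eq_mul]
  split_ifs with hl
  · have : ((l : ℕ) + 1) / 2 = (i + 1) / 2 + r := by omega
    rw [this]; push_cast; ring
  · ring

/-- The Casimir is ordered with e₁ and e₂ on the right, so on a vector killed by both only -h₁h₂
survives, here -(r)(-r). -/
theorem modelCasimir_shiftMatrix (r : ℕ) :
    modelCasimir N (shiftMatrix _ (2 * r)) = ((r : ℂ) ^ 2) • shiftMatrix _ (2 * r) := by
  have h1 : (modelAd N 0 * modelAd N 2 + modelAd N 2 * modelAd N 0)
      ((modelAd N 1 * modelAd N 3 + modelAd N 3 * modelAd N 1) (shiftMatrix _ (2 * r))) =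
      -((r : ℂ) ^ 2) • shiftMatrix _ (2 * r) := by
    rw [modelAd_h₂_shiftMatrix, map_smul, modelAd_h₁_shiftMatrix, smul_smul]
    congr 1; ring
  rw [modelCasimir, casimir, LinearMap.sub_apply, Module.End.mul_apply (_ + _) (_ + _)]
  rw [LinearMap.sub_apply, LinearMap.add_apply, Module.End.mul_apply (_ + _) (_ + _), h1]
  simp [Module.End.mul_apply, modelAd_zero_shiftMatrix, modelAd_one_shiftMatrix]

/-- The matrices annihilated by both raising operators are the combinations of the even powers of
the shift. -/
theorem eq_sum_shiftMatrix {A : Matrix (Fin (2 * N + 1)) (Fin (2 * N + 1)) ℂ}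
    (h1 : modelAd N 0 A = 0) (h2 : modelAd N 1 A = 0) :
    A = ∑ r ∈ Finset.range (N + 1), entry A 0 (2 * r) • shiftMatrix _ (2 * r) := by
  have E1 : ∀ i l, i < 2 * N + 1 → l < 2 * N + 1 →
      (if Even i then 1 else 0) * entry A (i + 1) l - (if l = 0 then 0 else
        (-1) ^ (i + (l - 1)) * entry A i (l - 1) * if Even (l - 1) then 1 else 0) = 0 := by
    intro i l hi hl
    have h : modelAd N 0 A ⟨i, hi⟩ ⟨l, hl⟩ = _ := oddAd_up_apply _ _ _ _
    rw [h1] at h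
    exact h.symm
  have E2 : ∀ i l, i < 2 * N + 1 → l < 2 * N + 1 →
      (if Even i then 0 else 1) * entry A (i + 1) l - (if l = 0 then 0 else
        (-1) ^ (i + (l - 1)) * entry A i (l - 1) * if Even (l - 1) then 0 else 1) = 0 := by
    intro i l hi hl
    have h : modelAd N 1 A ⟨i, hi⟩ ⟨l, hl⟩ = _ := oddAd_up_apply _ _ _ _
    rw [h2] at h
    exact h.symm
  -- At an (even, even) position the equation for e₁ involves only the entry below, and the equation
  -- for e₂ only the entry to the left. So all entries with indices of opposite parity vanish.
  have P : ∀ a b, entry A (2 * a + 1) (2 * b) = 0 := by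
    intro a b
    by_cases ha : 2 * a + 1 < 2 * N + 1
    · by_cases hb : 2 * b < 2 * N + 1
      · have h := E1 (2 * a) (2 * b) (by omega) hb
        rcases b with _ | b
        · simpa using h
        · have : ¬ Even (2 * (b + 1) - 1) := by
            rw [show 2 * (b + 1) - 1 = 2 * b + 1 by omega]; simp
          simpa [this] using h
      · exact entry_of_le_right (not_lt.1 hb)
    · exact entry_of_le_left (not_lt.1 ha)
  have P' : ∀ a b, entry A (2 * a) (2 * b + 1) = 0 := by
    intro a b
    by_cases ha : 2 * a < 2 * N + 1
    · by_cases hb : 2 * b + 1 < 2 * N + 1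
      · have h := E2 (2 * a) (2 * b + 2) ha (by omega)
        simpa using h
      · exact entry_of_le_right (not_lt.1 hb)
    · exact entry_of_le_left (not_lt.1 ha)
  -- For indices of equal parity one of the two equations says that the entries are constant along
  -- the diagonal; together with `Z`, which treats the first column, this removes everything below
  -- the main diagonal.
  have Q : ∀ i l, i + 1 < 2 * N + 1 → l + 1 < 2 * N + 1 →
      entry A (i + 1) (l + 1) = entry A i l := by
    intro i l hi hl
    have h := E1 i (l + 1) (by omega) hl
    have h' := E2 i (l + 1) (by omega) hl
    rcases Nat.even_or_odd' i with ⟨a, rfl | rfl⟩ <;> rcases Nat.even_or_odd' l with ⟨b, rfl | rfl⟩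
    · simpa [pow_add, sub_eq_zero] using h
    · rw [show 2 * b + 1 + 1 = 2 * (b + 1) by ring, P, P']
    · rw [show 2 * a + 1 + 1 = 2 * (a + 1) by ring, P, P']
    · simpa [pow_add, sub_eq_zero] using h'
  have Z : ∀ i, i + 1 < 2 * N + 1 → entry A (i + 1) 0 = 0 := by
    intro i hi
    rcases Nat.even_or_odd' i with ⟨a, rfl | rfl⟩
    · exact P a 0
    · simpa using E2 (2 * a + 1) 0 (by omega) (by omega)
  have U : ∀ i d, i + d < 2 * N + 1 → entry A i (i + d) = entry A 0 d := by
    intro i d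
    induction i with
    | zero => simp
    | succ i ih =>
      intro h
      rw [show i + 1 + d = i + d + 1 by ring, Q _ _ (by omega) (by omega), ih (by omega)]
  have L : ∀ l d, l + d + 1 < 2 * N + 1 → entry A (l + d + 1) l = 0 := by
    intro l d
    induction l with
    | zero => intro h; rw [zero_add] at h ⊢; exact Z _ h
    | succ l ih =>
      intro h
      rw [show l + 1 + d + 1 = l + d + 1 + 1 by ring, Q _ _ (by omega) (by omega), ih (by omega)]
  ext i l
  rw [Matrix.sum_apply]
  simp only [Matrix.smul_apply, shiftMatrix, smul_eq_mul, mul_ite, mul_one, mul_zero]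
  have hA : A i l = entry A i l := (entry_eq i.2 l.2).symm
  rw [hA]
  rcases le_or_gt (i : ℕ) l with h | h
  · obtain ⟨d, hd⟩ := Nat.exists_eq_add_of_le h
    have hd' := l.2
    rw [hd] at hd' ⊢
    rw [U _ _ hd']
    rcases Nat.even_or_odd' d with ⟨a, rfl | rfl⟩
    · rw [Finset.sum_eq_single a]
      · simp
      · intro b _ hb
        rw [if_neg (by omega)]
      · intro ha
        simp at ha
        omega
    · rw [← mul_zero 2, P' 0 a]
      refine (Finset.sum_eq_zero fun b _ => ?_).symm
      rw [if_neg (by omega)]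
  · obtain ⟨d, hd⟩ := Nat.exists_eq_add_of_lt h
    have hd' := i.2
    rw [hd] at hd' ⊢
    rw [L _ _ hd']
    refine (Finset.sum_eq_zero fun b _ => ?_).symm
    rw [if_neg (by omega)]

/-- The submodule generated by the highest weight vector of weight `r`. -/
def modelIrrep (N r : ℕ) : Submodule ℂ (Matrix (Fin (2 * N + 1)) (Fin (2 * N + 1)) ℂ) :=
  cyclicSpan (modelAd N) (shiftMatrix _ (2 * r))

theorem modelIrrep_le_eigenspace (r : ℕ) :
    modelIrrep N r ≤ Module.End.eigenspace (modelCasimir N) ((r : ℂ) ^ 2) := by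
  refine cyclicSpan_le (Module.End.mem_eigenspace_iff.2 (modelCasimir_shiftMatrix r)) ?_
  intro j w hw
  rw [Module.End.mem_eigenspace_iff] at hw ⊢
  rw [← Module.End.mul_apply, ← modelAd_comm_casimir, Module.End.mul_apply, hw, map_smul]

theorem entry_zero_shiftMatrix {r s : ℕ} (hr : r ≤ N) :
    entry (shiftMatrix (2 * N + 1) (2 * s)) 0 (2 * r) = if r = s then 1 else 0 := by
  rw [entry_eq (by omega) (by omega), shiftMatrix]
  simp

theorem shiftMatrix_ne_zero {r : ℕ} (hr : r ≤ N) : shiftMatrix (2 * N + 1) (2 * r) ≠ 0 := by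
  intro h
  have := entry_zero_shiftMatrix (s := r) hr
  rw [h] at this
  simp [entry] at this

/-- A nonzero stable W contains a combination of the S^{2s}, with Casimir value r². Distinct s have
distinct s², so it is a multiple of the generator S^{2r}. -/
theorem modelIrrep_irreducible (r : ℕ) {W : Submodule ℂ _} (hW : W ≤ modelIrrep N r)
    (hst : ∀ j, ∀ A ∈ W, modelAd N j A ∈ W) : W = ⊥ ∨ W = modelIrrep N r := by
  by_cases hbot : W = ⊥
  · exact Or.inl hbot
  refine Or.inr (le_antisymm hW (cyclicSpan_le ?_ hst))
  obtain ⟨A, hA, hA0, h1, h2⟩ := exists_annihilated (hst 0) (hst 1) hbot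
  have hsum := eq_sum_shiftMatrix h1 h2
  have hC := Module.End.mem_eigenspace_iff.1 (modelIrrep_le_eigenspace r (hW hA))
  -- The first row of S^{2s} has its only entry in column 2s, so comparing the (0, 2s) entries of
  -- the Casimir equation gives s²c = r²c for the coefficient c of S^{2s}.
  have hcoef : ∀ s ≤ N, s ≠ r → entry A 0 (2 * s) = 0 := by
    intro s hs hsr
    have e : ∀ B : Matrix (Fin (2 * N + 1)) (Fin (2 * N + 1)) ℂ,
        entry B 0 (2 * s) = B ⟨0, by omega⟩ ⟨2 * s, by omega⟩ := fun B => entry_eq _ _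
    have h := congrArg (fun B => entry B 0 (2 * s)) hC
    rw [hsum, map_sum, e, e, Matrix.sum_apply, ← hsum, Matrix.smul_apply, ← e A] at h
    rw [Finset.sum_eq_single s] at h
    · rw [map_smul, modelCasimir_shiftMatrix, Matrix.smul_apply, Matrix.smul_apply, ← e (shiftMatrix _ _),
        entry_zero_shiftMatrix hs, if_pos rfl, smul_eq_mul, smul_eq_mul, smul_eq_mul, mul_one,
        mul_comm, ← sub_eq_zero, ← sub_mul, mul_eq_zero] at h
      refine h.resolve_left (sub_ne_zero.2 ?_)
      exact_mod_cast fun h' => hsr (Nat.pow_left_injective (n := 2) (by norm_num) h')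
    · intro t _ ht
      rw [map_smul, modelCasimir_shiftMatrix, Matrix.smul_apply, Matrix.smul_apply, ← e (shiftMatrix _ _),
        entry_zero_shiftMatrix hs, if_neg ht.symm]
      simp
    · intro h'
      simp at h'
      omega
  by_cases hr : r ≤ N
  · rw [Finset.sum_eq_single r] at hsum
    · have h0 : entry A 0 (2 * r) ≠ 0 := fun h0 => hA0 (by rw [hsum, h0, zero_smul])
      rw [hsum] at hA
      exact (W.smul_mem_iff h0).1 hA
    · intro s hs hsr
      rw [hcoef s (by simp at hs; omega) hsr, zero_smul]
    · intro h'
      simp at h'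
      omega
  · refine absurd ?_ hA0
    rw [hsum]
    refine Finset.sum_eq_zero fun s hs => ?_
    simp at hs
    rw [hcoef s (by omega) (by omega), zero_smul]

theorem modelIrrep_independent : iSupIndep fun r : Fin (N + 1) => modelIrrep N r := by
  have h := (Module.End.eigenspaces_iSupIndep (modelCasimir N)).comp
    (f := fun r : Fin (N + 1) => ((r : ℕ) : ℂ) ^ 2) (by
      intro r s hrs
      have hrs' : ((r : ℕ) : ℂ) ^ 2 = ((s : ℕ) : ℂ) ^ 2 := hrs
      have : (r : ℕ) ^ 2 = (s : ℕ) ^ 2 := by exact_mod_cast hrs'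
      exact Fin.ext (Nat.pow_left_injective (n := 2) (by norm_num) this))
  exact h.mono fun r => modelIrrep_le_eigenspace r

theorem modelIrrep_iSup : ⨆ r : Fin (N + 1), modelIrrep N r = ⊤ := by
  refine eq_top_of_shiftMatrix_mem ?_ ?_
  · intro j A hA
    refine Submodule.iSup_induction _ (motive := fun A => modelAd N j A ∈ _) hA ?_ ?_ ?_
    · intro r x hx
      exact Submodule.mem_iSup_of_mem r (cyclicSpan_stable _ _ j hx)
    · simp
    · intro x y hx hy
      rw [map_add]
      exact Submodule.add_mem _ hx hy
  · intro r hr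
    exact Submodule.mem_iSup_of_mem (⟨r, by omega⟩ : Fin (N + 1)) (mem_cyclicSpan_self _ _)

/-- The generator is fixed by the parity automorphism and each operator anticommutes with it. This
is what makes the summands graded. -/
theorem modelIrrep_altSign_conj (r : ℕ) {A : Matrix (Fin (2 * N + 1)) (Fin (2 * N + 1)) ℂ}
    (hA : A ∈ modelIrrep N r) : altSign _ * A * altSign _ ∈ modelIrrep N r := by
  have key : ∀ x A : Matrix (Fin (2 * N + 1)) (Fin (2 * N + 1)) ℂ,
      altSign _ * x = -(x * altSign _) →
      altSign _ * oddAd (altSign _) x A * altSign _ =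
        -oddAd (altSign _) x (altSign _ * A * altSign _) := by
    intro x A hx
    have h1 := altSign_mul_self (2 * N + 1)
    have h3 : ∀ B : Matrix (Fin (2 * N + 1)) (Fin (2 * N + 1)) ℂ,
        altSign _ * (altSign _ * B) = B := fun B => by rw [← mul_assoc, h1, one_mul]
    have hx' : ∀ B, altSign _ * (x * B) = -(x * (altSign _ * B)) := fun B => by
      rw [← mul_assoc, hx, neg_mul, mul_assoc]
    simp only [oddAd_apply, mul_sub, sub_mul, mul_assoc, hx', hx, h1, h3, mul_neg, neg_mul, mul_one]
    abel
  let W : Submodule ℂ (Matrix (Fin (2 * N + 1)) (Fin (2 * N + 1)) ℂ) :=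
    (modelIrrep N r).comap (LinearMap.mulRight ℂ (altSign _) ∘ₗ LinearMap.mulLeft ℂ (altSign _))
  have hW : modelIrrep N r ≤ modelIrrep N r ⊓ W := by
    refine cyclicSpan_le ⟨mem_cyclicSpan_self _ _, ?_⟩ ?_
    · change altSign _ * shiftMatrix _ (2 * r) * altSign _ ∈ modelIrrep N r
      rw [altSign_conj_shiftMatrix]
      exact mem_cyclicSpan_self _ _
    · rintro j A ⟨hA1, hA2⟩
      refine ⟨cyclicSpan_stable _ _ j hA1, ?_⟩
      change altSign _ * modelAd N j A * altSign _ ∈ modelIrrep N r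
      have : altSign _ * modelAd N j A * altSign _ =
          -modelAd N j (altSign _ * A * altSign _) := by
        fin_cases j
        · exact key _ _ (altSign_up _ _)
        · exact key _ _ (altSign_up _ _)
        · exact key _ _ (altSign_down _ _)
        · exact key _ _ (altSign_down _ _)
      rw [this]
      exact Submodule.neg_mem _ (cyclicSpan_stable _ _ j hA2)
  exact (hW hA).2

end HighestWeight
end SuperSL

namespace SuperSL

/-! ### The superbracket of matrices in terms of the parity matrix. -/

section Superbracket

variable {ι : Type} {π : ι → ZMod 2}

theorem homPart_of_mem {s : ZMod 2} {A : Matrix ι ι ℂ} (h : A ∈ homSubspace π s) :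
    homPart π s A = A := by
  ext i k
  rw [homPart]
  split_ifs with h'
  · rfl
  · exact (h i k h').symm

theorem homPart_of_mem_ne {s t : ZMod 2} {A : Matrix ι ι ℂ} (h : A ∈ homSubspace π s) (hst : s ≠ t) :
    homPart π t A = 0 := by
  ext i k
  rw [homPart, Matrix.zero_apply]
  split_ifs with h'
  · exact h i k fun h'' => hst (h''.symm.trans h')
  · rfl

theorem homPart_zero_add_one (A : Matrix ι ι ℂ) : homPart π 0 A + homPart π 1 A = A := by
  ext i k
  rw [Matrix.add_apply, homPart, homPart]
  rcases (by decide : ∀ x : ZMod 2, x = 0 ∨ x = 1) (π i + π k) with h | h <;> rw [h] <;> simp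

variable [Fintype ι]

theorem sbracket_expand (A B : Matrix ι ι ℂ) : sbracket π A B =
    homPart π 0 A * homPart π 0 B - homPart π 0 B * homPart π 0 A
      + (homPart π 0 A * homPart π 1 B - homPart π 1 B * homPart π 0 A)
      + (homPart π 1 A * homPart π 0 B - homPart π 0 B * homPart π 1 A)
      + (homPart π 1 A * homPart π 1 B + homPart π 1 B * homPart π 1 A) := by
  have e : ∀ g : ZMod 2 → Matrix ι ι ℂ, ∑ s, g s = g 0 + g 1 := fun g => Fin.sum_univ_two g
  have h1 : (1 : ZMod 2).val = 1 := rfl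
  rw [sbracket, e, e, e]
  simp only [h1, ZMod.val_zero, mul_zero, pow_zero, one_smul, mul_one, pow_one, neg_smul,
    sub_neg_eq_add]
  abel

theorem mul_mem_homSubspace {s t : ZMod 2} {X Y : Matrix ι ι ℂ} (hX : X ∈ homSubspace π s)
    (hY : Y ∈ homSubspace π t) : X * Y ∈ homSubspace π (s + t) := by
  intro i k hik
  rw [Matrix.mul_apply]
  refine Finset.sum_eq_zero fun l _ => ?_
  by_cases h1 : π i + π l = s
  · by_cases h2 : π l + π k = t
    · refine absurd ?_ hik
      rw [← h1, ← h2]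
      generalize π i = x; generalize π k = y; generalize π l = z
      revert x y z; decide
    · rw [hY _ _ h2, mul_zero]
  · rw [hX _ _ h1, zero_mul]

theorem anticomm_mem_homSubspace {X Y : Matrix ι ι ℂ} (hX : X ∈ homSubspace π 1)
    (hY : Y ∈ homSubspace π 1) : X * Y + Y * X ∈ homSubspace π 0 :=
  Submodule.add_mem _ (mul_mem_homSubspace hX hY) (mul_mem_homSubspace hY hX)

variable [DecidableEq ι] (π)

/-- The parity matrix, with diagonal entries `±1`. -/
def signMatrix : Matrix ι ι ℂ := Matrix.diagonal fun i => (-1) ^ (π i).val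

theorem neg_one_pow_val_add (x y : ZMod 2) :
    (-1 : ℂ) ^ (x + y).val = (-1) ^ x.val * (-1) ^ y.val := by
  rw [← pow_add]
  refine neg_one_pow_congr ?_
  revert x y
  decide

theorem signMatrix_mul_self : signMatrix π * signMatrix π = 1 := by
  rw [signMatrix, Matrix.diagonal_mul_diagonal, ← Matrix.diagonal_one]
  congr 1
  funext k
  rw [← mul_pow]; simp

theorem signMatrix_conj_apply (A : Matrix ι ι ℂ) (i k : ι) :
    (signMatrix π * A * signMatrix π) i k = (-1) ^ (π i + π k).val * A i k := by
  simp only [signMatrix, Matrix.diagonal_mul, Matrix.mul_diagonal, neg_one_pow_val_add]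
  ring

variable {π}

theorem homPart_zero_sub_one (A : Matrix ι ι ℂ) :
    homPart π 0 A - homPart π 1 A = signMatrix π * A * signMatrix π := by
  ext i k
  rw [signMatrix_conj_apply, Matrix.sub_apply, homPart, homPart]
  have h1 : (1 : ZMod 2).val = 1 := rfl
  rcases (by decide : ∀ x : ZMod 2, x = 0 ∨ x = 1) (π i + π k) with h | h <;> rw [h] <;> simp [h1]

/-- Conjugation by the parity matrix is the difference of the even and the odd part, so the
superbracket with an odd matrix becomes the ring-theoretic `oddAd`. -/
theorem sbracket_odd {X : Matrix ι ι ℂ} (hX : X ∈ homSubspace π 1) (A : Matrix ι ι ℂ) :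
    sbracket π X A = oddAd (signMatrix π) X A := by
  rw [sbracket_expand, homPart_of_mem hX, homPart_of_mem_ne hX (by decide), oddAd_apply,
    ← homPart_zero_sub_one]
  have h : X * A = X * homPart π 0 A + X * homPart π 1 A := by
    rw [← mul_add, homPart_zero_add_one]
  rw [h]
  noncomm_ring

theorem sbracket_even {X : Matrix ι ι ℂ} (hX : X ∈ homSubspace π 0) (A : Matrix ι ι ℂ) :
    sbracket π X A = X * A - A * X := by
  rw [sbracket_expand, homPart_of_mem hX, homPart_of_mem_ne hX (by decide)]
  conv_rhs => rw [← homPart_zero_add_one (π := π) A]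
  noncomm_ring

theorem signMatrix_odd {X : Matrix ι ι ℂ} (hX : X ∈ homSubspace π 1) :
    signMatrix π * X = -(X * signMatrix π) := by
  have h : signMatrix π * X * signMatrix π = -X := by
    rw [← homPart_zero_sub_one, homPart_of_mem hX, homPart_of_mem_ne hX (by decide), zero_sub]
  calc signMatrix π * X = signMatrix π * X * (signMatrix π * signMatrix π) := by
        rw [signMatrix_mul_self, mul_one]
    _ = -(X * signMatrix π) := by rw [← mul_assoc, h, neg_mul]

theorem sbracket_odd_odd {X Y : Matrix ι ι ℂ} (hX : X ∈ homSubspace π 1)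
    (hY : Y ∈ homSubspace π 1) : sbracket π X Y = X * Y + Y * X := by
  rw [sbracket_expand, homPart_of_mem hX, homPart_of_mem_ne hX (by decide), homPart_of_mem hY,
    homPart_of_mem_ne hY (by decide)]
  noncomm_ring

theorem sbracket_anticomm {X Y : Matrix ι ι ℂ} (hX : X ∈ homSubspace π 1)
    (hY : Y ∈ homSubspace π 1) (A : Matrix ι ι ℂ) :
    sbracket π (X * Y + Y * X) A = (oddAd (signMatrix π) X * oddAd (signMatrix π) Y
      + oddAd (signMatrix π) Y * oddAd (signMatrix π) X) A := by
  rw [sbracket_even (anticomm_mem_homSubspace hX hY), oddAd_anticomm (signMatrix_mul_self π)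
    (signMatrix_odd hX) (signMatrix_odd hY)]
  simp

theorem sbracket_add_left (X Y A : Matrix ι ι ℂ) :
    sbracket π (X + Y) A = sbracket π X A + sbracket π Y A := by
  have h : ∀ s, homPart π s (X + Y) = homPart π s X + homPart π s Y := by
    intro s; ext i k; simp only [homPart, Matrix.add_apply]; split_ifs <;> simp
  simp only [sbracket_expand, h]
  noncomm_ring

theorem sbracket_smul_left (c : ℂ) (X A : Matrix ι ι ℂ) :
    sbracket π (c • X) A = c • sbracket π X A := by
  have h : ∀ s, homPart π s (c • X) = c • homPart π s X := by
    intro s; ext i k; simp only [homPart, Matrix.smul_apply]; split_ifs <;> simp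
  simp only [sbracket_expand, h, smul_mul_assoc, mul_smul_comm]
  module

/-- The homogeneous parts of A are half the sum and half the difference of A and its conjugate. -/
theorem iSup_inf_homSubspace {U : Submodule ℂ (Matrix ι ι ℂ)}
    (h : ∀ A ∈ U, signMatrix π * A * signMatrix π ∈ U) : ⨆ s, U ⊓ homSubspace π s = U := by
  refine le_antisymm (iSup_le fun s => inf_le_left) fun A hA => ?_
  have hmem : ∀ s, homPart π s A ∈ homSubspace π s := by
    intro s i k hik; simp [homPart, hik]
  have h0 : homPart π 0 A = (1 / 2 : ℂ) • (A + signMatrix π * A * signMatrix π) := by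
    rw [← homPart_zero_sub_one]
    nth_rw 2 [← homPart_zero_add_one (π := π) A]
    module
  have h1 : homPart π 1 A = (1 / 2 : ℂ) • (A - signMatrix π * A * signMatrix π) := by
    rw [← homPart_zero_sub_one]
    nth_rw 2 [← homPart_zero_add_one (π := π) A]
    module
  rw [← homPart_zero_add_one (π := π) A]
  refine Submodule.add_mem _ ?_ ?_
  · refine Submodule.mem_iSup_of_mem 0 ⟨?_, hmem 0⟩
    rw [h0]
    exact U.smul_mem _ (U.add_mem hA (h A hA))
  · refine Submodule.mem_iSup_of_mem 1 ⟨?_, hmem 1⟩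
    rw [h1]
    exact U.smul_mem _ (U.sub_mem hA (h A hA))

end Superbracket

/-! ### Generation of sl(2|1) by its four odd simple root vectors. -/

section SL21Structure

theorem e1_odd : (e1 : Matrix (Fin 3) (Fin 3) ℂ) ∈ homSubspace (altParity 3) 1 := by
  intro i k h
  fin_cases i <;> fin_cases k <;> simp_all [e1, altParity]

theorem e2_odd : (e2 : Matrix (Fin 3) (Fin 3) ℂ) ∈ homSubspace (altParity 3) 1 := by
  intro i k h
  fin_cases i <;> fin_cases k <;> simp_all [e2, altParity]
  exact h (by decide)

theorem f1_odd : (f1 : Matrix (Fin 3) (Fin 3) ℂ) ∈ homSubspace (altParity 3) 1 := by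
  intro i k h
  fin_cases i <;> fin_cases k <;> simp_all [f1, altParity]

theorem f2_odd : (f2 : Matrix (Fin 3) (Fin 3) ℂ) ∈ homSubspace (altParity 3) 1 := by
  intro i k h
  fin_cases i <;> fin_cases k <;> simp_all [f2, altParity]
  exact h (by decide)

theorem coe_sl21Bracket_odd {x y : sl21} (hx : (x : Matrix (Fin 3) (Fin 3) ℂ) ∈ homSubspace (altParity 3) 1)
    (hy : (y : Matrix (Fin 3) (Fin 3) ℂ) ∈ homSubspace (altParity 3) 1) :
    ((sl21Bracket x y : sl21) : Matrix (Fin 3) (Fin 3) ℂ) = (x : Matrix (Fin 3) (Fin 3) ℂ) * y + y * x :=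
  sbracket_odd_odd hx hy

theorem sl21_h₁_e₂ : sl21Bracket (sl21Bracket e1 f1) e2 = e2 := by
  refine Subtype.ext ?_
  change sbracket _ _ _ = _
  rw [coe_sl21Bracket_odd e1_odd f1_odd, sbracket_even (anticomm_mem_homSubspace e1_odd f1_odd)]
  ext i k
  fin_cases i <;> fin_cases k <;> simp [e1, f1, e2]

theorem sl21_h₂_e₁ : sl21Bracket (sl21Bracket e2 f2) e1 = -e1 := by
  refine Subtype.ext ?_
  change sbracket _ _ _ = _
  rw [coe_sl21Bracket_odd e2_odd f2_odd, sbracket_even (anticomm_mem_homSubspace e2_odd f2_odd)]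
  ext i k
  fin_cases i <;> fin_cases k <;> simp [e1, f2, e2]

theorem sl21_isospin_eq :
    isospin = (1 / 2 : ℂ) • sl21Bracket e1 f1 - (1 / 2 : ℂ) • sl21Bracket e2 f2 := by
  refine Subtype.ext ?_
  change _ = (1 / 2 : ℂ) • ((sl21Bracket e1 f1 : sl21) : Matrix (Fin 3) (Fin 3) ℂ)
    - (1 / 2 : ℂ) • ((sl21Bracket e2 f2 : sl21) : Matrix (Fin 3) (Fin 3) ℂ)
  rw [coe_sl21Bracket_odd e2_odd f2_odd, coe_sl21Bracket_odd e1_odd f1_odd]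
  ext i k
  fin_cases i <;> fin_cases k <;> simp [isospin, e1, f2, e2, f1]
  norm_num

theorem sl21_baryon_eq :
    baryon = (1 / 2 : ℂ) • sl21Bracket e1 f1 + (1 / 2 : ℂ) • sl21Bracket e2 f2 := by
  refine Subtype.ext ?_
  change _ = (1 / 2 : ℂ) • ((sl21Bracket e1 f1 : sl21) : Matrix (Fin 3) (Fin 3) ℂ)
    + (1 / 2 : ℂ) • ((sl21Bracket e2 f2 : sl21) : Matrix (Fin 3) (Fin 3) ℂ)
  rw [coe_sl21Bracket_odd e2_odd f2_odd, coe_sl21Bracket_odd e1_odd f1_odd]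
  ext i k
  fin_cases i <;> fin_cases k <;> simp [baryon, e1, f2, e2, f1]
  norm_num

theorem sl21_supertrace (x : sl21) : (x : Matrix (Fin 3) (Fin 3) ℂ) 1 1 =
    (x : Matrix (Fin 3) (Fin 3) ℂ) 0 0 + (x : Matrix (Fin 3) (Fin 3) ℂ) 2 2 := by
  have h := x.2
  have h0 : (altParity 3 0).val = 0 := by decide
  have h1 : (altParity 3 1).val = 1 := by decide
  have h2 : (altParity 3 2).val = 0 := by decide
  simp only [sl, LinearMap.mem_ker, supertrace, LinearMap.coe_mk, AddHom.coe_mk,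
    Fin.sum_univ_three, h0, h1, h2] at h
  linear_combination -h

/-- Vanishing supertrace makes the middle diagonal entry the sum of the outer two, so the remaining
eight entries are coordinates in simple root vectors and their brackets. -/
theorem sl21_decomposition (x : sl21) : x =
    (x : Matrix (Fin 3) (Fin 3) ℂ) 0 1 • e1 + (x : Matrix (Fin 3) (Fin 3) ℂ) 1 2 • e2
      + (x : Matrix (Fin 3) (Fin 3) ℂ) 1 0 • f1 + (x : Matrix (Fin 3) (Fin 3) ℂ) 2 1 • f2
      + (x : Matrix (Fin 3) (Fin 3) ℂ) 0 2 • sl21Bracket e1 e2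
      + (x : Matrix (Fin 3) (Fin 3) ℂ) 2 0 • sl21Bracket f1 f2
      + (x : Matrix (Fin 3) (Fin 3) ℂ) 0 0 • sl21Bracket e1 f1
      + (x : Matrix (Fin 3) (Fin 3) ℂ) 2 2 • sl21Bracket e2 f2 := by
  refine Subtype.ext ?_
  simp only [Submodule.coe_add, Submodule.coe_smul]
  rw [coe_sl21Bracket_odd e2_odd f2_odd, coe_sl21Bracket_odd e1_odd f1_odd,
    coe_sl21Bracket_odd e1_odd e2_odd, coe_sl21Bracket_odd f1_odd f2_odd]
  have h := sl21_supertrace x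
  generalize (x : Matrix (Fin 3) (Fin 3) ℂ) = X at h ⊢
  ext i k
  fin_cases i <;> fin_cases k <;> simp [e1, f2, e2, f1, h]

end SL21Structure
end SuperSL

namespace SuperSL

/-! ### Normal form of a principal embedding within one block. -/

section Gauge

theorem up_apply_eq {n : ℕ} {c c' : ℕ → ℂ} (h : upMatrix n c = upMatrix n c') {k : ℕ}
    (hk : k + 1 < n) : c k = c' k := by
  have := congrFun (congrFun h ⟨k, by omega⟩) ⟨k + 1, hk⟩
  simpa [upMatrix] using this

theorem neg_up (n : ℕ) (c : ℕ → ℂ) : -upMatrix n c = upMatrix n fun k => -c k := by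
  ext i l; simp only [upMatrix, Matrix.neg_apply]; split_ifs <;> simp

variable {N : ℕ} {c₁ c₂ d₁ d₂ : ℕ → ℂ}

/-- With x_a = c₁(2a)d₁(2a), the entry of [h₁, e₂] = e₂ at position (2a+1, 2a+2) reads x_a - x_{a+1}
= 1, where x_N = 0 for lack of a further neighbour. Descending induction gives N - a. -/
theorem even_coeff_mul_coeff (hc₁ : ∀ k, k < 2 * N → (c₁ k ≠ 0 ↔ Even k))
    (hc₂ : ∀ k, k < 2 * N → (c₂ k ≠ 0 ↔ Odd k))
    (h : (upMatrix (2 * N + 1) c₁ * downMatrix _ d₁ + downMatrix _ d₁ * upMatrix _ c₁)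
        * upMatrix _ c₂ - upMatrix _ c₂ *
        (upMatrix (2 * N + 1) c₁ * downMatrix _ d₁ + downMatrix _ d₁ * upMatrix _ c₁) =
      upMatrix _ c₂) (a : ℕ) (ha : a < N) : c₁ (2 * a) * d₁ (2 * a) = N - a := by
  rw [up_mul_down, down_mul_up, diag_add, diag_comm_up] at h
  have hz : ∀ a, a < N → c₁ (2 * a + 1) = 0 := fun a ha => by
    by_contra h0
    exact absurd ((hc₁ _ (by omega)).1 h0) (by simp)
  have step : ∀ a, a < N → c₁ (2 * a) * d₁ (2 * a)
      - (if a + 1 < N then c₁ (2 * (a + 1)) * d₁ (2 * (a + 1)) else 0) = 1 := by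
    intro a ha
    have h1 := up_apply_eq h (k := 2 * a + 1) (by omega)
    have h2 := (hc₂ (2 * a + 1) (by omega)).2 ⟨a, rfl⟩
    have h3 := mul_right_cancel₀ h2 (h1.trans (one_mul _).symm)
    have e1 : 2 * a + 1 + 1 = 2 * (a + 1) := by ring
    have e2 : 2 * a + 1 + 1 - 1 = 2 * a + 1 := by omega
    have e3 : 2 * a + 1 - 1 = 2 * a := by omega
    rw [← h3]
    simp only [e2, e3, hz a ha]
    simp only [e1]
    by_cases h4 : a + 1 < N
    · rw [if_pos h4, if_pos (by omega : 2 * (a + 1) + 1 < 2 * N + 1)]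
      simp
      ring
    · rw [if_neg h4, if_neg (by omega : ¬ 2 * (a + 1) + 1 < 2 * N + 1)]
      simp
      ring
  obtain ⟨t, ht⟩ := Nat.exists_eq_add_of_lt ha
  induction t generalizing a with
  | zero =>
    have := step a ha
    rw [if_neg (by omega), sub_zero] at this
    rw [this, ht]; push_cast; ring
  | succ t ih =>
    have := step a ha
    rw [if_pos (by omega), ih (a + 1) (by omega) (by omega)] at this
    push_cast at this
    linear_combination this

/-- With y_a = c₂(2a+1)d₂(2a+1), the entry of [h₂, e₁] = -e₁ at position (2a, 2a+1) reads y_{a-1} -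
y_a = -1, where the term before y_0 is 0. -/
theorem odd_coeff_mul_coeff (hc₁ : ∀ k, k < 2 * N → (c₁ k ≠ 0 ↔ Even k))
    (hc₂ : ∀ k, k < 2 * N → (c₂ k ≠ 0 ↔ Odd k))
    (h : (upMatrix (2 * N + 1) c₂ * downMatrix _ d₂ + downMatrix _ d₂ * upMatrix _ c₂)
        * upMatrix _ c₁ - upMatrix _ c₁ *
        (upMatrix (2 * N + 1) c₂ * downMatrix _ d₂ + downMatrix _ d₂ * upMatrix _ c₂) =
      -upMatrix _ c₁) (a : ℕ) (ha : a < N) : c₂ (2 * a + 1) * d₂ (2 * a + 1) = a + 1 := by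
  rw [up_mul_down, down_mul_up, diag_add, diag_comm_up, neg_up] at h
  have hz : ∀ a, a < N → c₂ (2 * a) = 0 := fun a ha => by
    by_contra h0
    exact absurd ((hc₂ _ (by omega)).1 h0) (by simp)
  have step : ∀ a, a < N → (if a = 0 then 0 else d₂ (2 * a - 1) * c₂ (2 * a - 1))
      - c₂ (2 * a + 1) * d₂ (2 * a + 1) = -1 := by
    intro a ha
    have h1 := up_apply_eq h (k := 2 * a) (by omega)
    have h2 := (hc₁ (2 * a) (by omega)).2 (even_two_mul a)
    have h3 := mul_right_cancel₀ h2 (h1.trans (neg_one_mul _).symm)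
    have e3 : 2 * a + 1 - 1 = 2 * a := by omega
    rw [← h3]
    simp only [e3, hz a ha]
    rw [if_pos (by omega : 2 * a + 1 + 1 < 2 * N + 1)]
    simp
  induction a with
  | zero =>
    have := step 0 ha
    simp only [if_true, mul_zero, zero_add] at this ⊢
    push_cast
    linear_combination -this
  | succ a ih =>
    have := step (a + 1) ha
    rw [if_neg (by omega), show 2 * (a + 1) - 1 = 2 * a + 1 by omega] at this
    have ih := ih (by omega)
    push_cast
    linear_combination -this + ih

/-- A diagonal change of basis brings the image of the simple root vectors into normal form. -/
theorem exists_block_gauge (hc₁ : ∀ k, k < 2 * N → (c₁ k ≠ 0 ↔ Even k))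
    (hc₂ : ∀ k, k < 2 * N → (c₂ k ≠ 0 ↔ Odd k)) (hd₁ : ∀ k, k < 2 * N → (d₁ k ≠ 0 ↔ Even k))
    (hd₂ : ∀ k, k < 2 * N → (d₂ k ≠ 0 ↔ Odd k))
    (h₁ : (upMatrix (2 * N + 1) c₁ * downMatrix _ d₁ + downMatrix _ d₁ * upMatrix _ c₁)
        * upMatrix _ c₂ - upMatrix _ c₂ *
        (upMatrix (2 * N + 1) c₁ * downMatrix _ d₁ + downMatrix _ d₁ * upMatrix _ c₁) =
      upMatrix _ c₂)
    (h₂ : (upMatrix (2 * N + 1) c₂ * downMatrix _ d₂ + downMatrix _ d₂ * upMatrix _ c₂)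
        * upMatrix _ c₁ - upMatrix _ c₁ *
        (upMatrix (2 * N + 1) c₂ * downMatrix _ d₂ + downMatrix _ d₂ * upMatrix _ c₂) =
      -upMatrix _ c₁) :
    ∃ D : Fin (2 * N + 1) → ℂ, (∀ k, D k ≠ 0) ∧
      upMatrix _ c₁ * Matrix.diagonal D = Matrix.diagonal D * modelE₁ N ∧
      upMatrix _ c₂ * Matrix.diagonal D = Matrix.diagonal D * modelE₂ N ∧
      downMatrix _ d₁ * Matrix.diagonal D = Matrix.diagonal D * modelF₁ N ∧
      downMatrix _ d₂ * Matrix.diagonal D = Matrix.diagonal D * modelF₂ N := by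
  have z₁ : ∀ k, k < 2 * N → ¬ Even k → c₁ k = 0 := fun k hk h => by
    by_contra h0; exact h ((hc₁ k hk).1 h0)
  have z₂ : ∀ k, k < 2 * N → Even k → c₂ k = 0 := fun k hk h => by
    by_contra h0; exact Nat.not_odd_iff_even.2 h ((hc₂ k hk).1 h0)
  have w₁ : ∀ k, k < 2 * N → ¬ Even k → d₁ k = 0 := fun k hk h => by
    by_contra h0; exact h ((hd₁ k hk).1 h0)
  have w₂ : ∀ k, k < 2 * N → Even k → d₂ k = 0 := fun k hk h => by
    by_contra h0; exact Nat.not_odd_iff_even.2 h ((hd₂ k hk).1 h0)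
  have hne : ∀ k, k < 2 * N → c₁ k + c₂ k ≠ 0 := fun k hk => by
    by_cases h : Even k
    · rw [z₂ k hk h, add_zero]; exact (hc₁ k hk).2 h
    · rw [z₁ k hk h, zero_add]; exact (hc₂ k hk).2 (Nat.not_even_iff_odd.1 h)
  have hx : ∀ k, k < 2 * N → (c₁ k + c₂ k) * (d₁ k + d₂ k) = lowerCoeff N k := fun k hk => by
    rcases Nat.even_or_odd' k with ⟨a, rfl | rfl⟩
    · rw [z₂ _ hk (even_two_mul a), w₂ _ hk (even_two_mul a), lowerCoeff_even, add_zero, add_zero]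
      exact even_coeff_mul_coeff hc₁ hc₂ h₁ a (by omega)
    · rw [z₁ _ hk (by simp), w₁ _ hk (by simp), lowerCoeff_odd, zero_add, zero_add]
      exact odd_coeff_mul_coeff hc₁ hc₂ h₂ a (by omega)
  -- Exactly one of c₁ l, c₂ l is nonzero. This D normalises all raising coefficients to 1; diagonal
  -- conjugation preserves the products in `hx`, so the lowering coefficients become `lowerCoeff`.
  let D : ℕ → ℂ := fun k => ∏ l ∈ Finset.range k, (c₁ l + c₂ l)⁻¹
  have hD : ∀ k, k < 2 * N + 1 → D k ≠ 0 := fun k hk =>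
    Finset.prod_ne_zero_iff.2 fun l hl => inv_ne_zero (hne l (by simp at hl; omega))
  have hDs : ∀ k, D (k + 1) = D k * (c₁ k + c₂ k)⁻¹ := fun k => Finset.prod_range_succ _ k
  refine ⟨fun k => D k, fun k => hD k k.2, ?_, ?_, ?_, ?_⟩
  · ext i l
    simp only [Matrix.mul_diagonal, Matrix.diagonal_mul, upMatrix, modelE₁]
    split_ifs with h h'
    · have hi : (i : ℕ) < 2 * N := by omega
      have := hne i hi
      rw [h, hDs]
      rw [z₂ i hi h'] at this ⊢
      field_simp
      simp [mul_comm]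
    · rw [z₁ i (by omega) h']; simp
    · simp
  · ext i l
    simp only [Matrix.mul_diagonal, Matrix.diagonal_mul, upMatrix, modelE₂]
    split_ifs with h h'
    · rw [z₂ i (by omega) h']; simp
    · have hi : (i : ℕ) < 2 * N := by omega
      have := hne i hi
      rw [h, hDs]
      rw [z₁ i hi h'] at this ⊢
      field_simp
      simp [mul_comm]
    · simp
  · ext i l
    simp only [Matrix.mul_diagonal, Matrix.diagonal_mul, downMatrix, modelF₁]
    split_ifs with h h'
    · have hi : (l : ℕ) < 2 * N := by omega
      have := hne l hi
      rw [h, hDs, ← hx l hi, w₂ l hi h']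
      field_simp
      simp [mul_comm]
    · rw [w₁ l (by omega) h']; simp
    · simp
  · ext i l
    simp only [Matrix.mul_diagonal, Matrix.diagonal_mul, downMatrix, modelF₂]
    split_ifs with h h'
    · rw [w₂ l (by omega) h']; simp
    · have hi : (l : ℕ) < 2 * N := by omega
      have := hne l hi
      rw [h, hDs, ← hx l hi, w₁ l hi h']
      field_simp
      simp [mul_comm]
    · simp

end Gauge

/-! ### Assembling the changes of basis of the blocks. -/

section BlockDiagonal

variable {p q N : ℕ}

open scoped Kronecker

/-- The diagonal block with index `a`. -/
def diagBlock (a : Fin p ⊕ Fin q) (X : Matrix (BlockIndex p q N) (BlockIndex p q N) ℂ) :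
    Matrix (Fin (2 * N + 1)) (Fin (2 * N + 1)) ℂ := X.submatrix (Prod.mk a) (Prod.mk a)

theorem diagBlock_mul (a : Fin p ⊕ Fin q) {X Y : Matrix (BlockIndex p q N) (BlockIndex p q N) ℂ}
    (hX : ∀ i k, i.1 ≠ k.1 → X i k = 0) :
    diagBlock a (X * Y) = diagBlock a X * diagBlock a Y := by
  ext k l
  simp only [diagBlock, Matrix.submatrix_apply, Matrix.mul_apply]
  rw [Fintype.sum_prod_type, Finset.sum_eq_single a]
  · intro b _ hb
    exact Finset.sum_eq_zero fun m _ => by rw [hX _ _ (by simpa using hb.symm), zero_mul]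
  · simp

theorem blockDiagonal_mul {X Y : Matrix (BlockIndex p q N) (BlockIndex p q N) ℂ}
    (hX : ∀ i k, i.1 ≠ k.1 → X i k = 0) (hY : ∀ i k, i.1 ≠ k.1 → Y i k = 0)
    (i k : BlockIndex p q N) (hik : i.1 ≠ k.1) : (X * Y) i k = 0 := by
  rw [Matrix.mul_apply]
  refine Finset.sum_eq_zero fun m _ => ?_
  by_cases h : i.1 = m.1
  · rw [hY _ _ (h ▸ hik), mul_zero]
  · rw [hX _ _ h, zero_mul]

theorem diagBlock_eq_up {X : Matrix (BlockIndex p q N) (BlockIndex p q N) ℂ} {P : ℕ → Prop}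
    (h : ∀ a k b l, X (a, k) (b, l) ≠ 0 ↔ a = b ∧ (l : ℕ) = k + 1 ∧ P k) (a : Fin p ⊕ Fin q) :
    diagBlock a X = upMatrix _ (fun k => entry (diagBlock a X) k (k + 1)) ∧
      ∀ k, k < 2 * N → (entry (diagBlock a X) k (k + 1) ≠ 0 ↔ P k) := by
  refine ⟨?_, fun k hk => ?_⟩
  · ext i l
    rw [upMatrix]
    split_ifs with h1
    · rw [entry_eq i.2 (by omega)]
      congr 1
      exact Fin.ext h1
    · by_contra h0
      exact h1 ((h a i a l).1 h0).2.1
  · rw [entry_eq (by omega) (by omega)]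
    exact (h a _ a _).trans (by simp)

theorem diagBlock_eq_down {X : Matrix (BlockIndex p q N) (BlockIndex p q N) ℂ} {P : ℕ → Prop}
    (h : ∀ a k b l, X (a, k) (b, l) ≠ 0 ↔ a = b ∧ (k : ℕ) = l + 1 ∧ P l) (a : Fin p ⊕ Fin q) :
    diagBlock a X = downMatrix _ (fun k => entry (diagBlock a X) (k + 1) k) ∧
      ∀ k, k < 2 * N → (entry (diagBlock a X) (k + 1) k ≠ 0 ↔ P k) := by
  refine ⟨?_, fun k hk => ?_⟩
  · ext i l
    rw [downMatrix]
    split_ifs with h1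
    · rw [entry_eq (by omega) l.2]
      congr 1
      exact Fin.ext h1
    · by_contra h0
      exact h1 ((h a i a l).1 h0).2.1
  · rw [entry_eq (by omega) (by omega)]
    exact (h a _ a _).trans (by simp)

theorem mul_diagonal_eq_of_blocks {X : Matrix (BlockIndex p q N) (BlockIndex p q N) ℂ}
    (hX : ∀ i k, i.1 ≠ k.1 → X i k = 0) {Y : Matrix (Fin (2 * N + 1)) (Fin (2 * N + 1)) ℂ}
    {D : Fin p ⊕ Fin q → Fin (2 * N + 1) → ℂ}
    (h : ∀ a, diagBlock a X * Matrix.diagonal (D a) = Matrix.diagonal (D a) * Y) :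
    X * Matrix.diagonal (fun i : BlockIndex p q N => D i.1 i.2) =
      Matrix.diagonal (fun i : BlockIndex p q N => D i.1 i.2)
        * ((1 : Matrix (Fin p ⊕ Fin q) (Fin p ⊕ Fin q) ℂ) ⊗ₖ Y) := by
  ext ⟨a, k⟩ ⟨b, l⟩
  simp only [Matrix.mul_diagonal, Matrix.diagonal_mul, Matrix.kroneckerMap_apply]
  by_cases hab : a = b
  · subst hab
    have := congrFun (congrFun (h a) k) l
    simpa only [Matrix.mul_diagonal, Matrix.diagonal_mul, diagBlock, Matrix.submatrix_apply,
      Matrix.one_apply_eq, one_mul] using this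
  · rw [hX _ _ hab, Matrix.one_apply_ne hab]
    simp

variable {φ : sl21 →ₗ[ℂ] Matrix (BlockIndex p q N) (BlockIndex p q N) ℂ}

theorem IsPrincipalEmbedding.map_odd (hφ : IsPrincipalEmbedding p q N φ) {x y : sl21}
    (hx : (x : Matrix (Fin 3) (Fin 3) ℂ) ∈ homSubspace (altParity 3) 1)
    (hy : (y : Matrix (Fin 3) (Fin 3) ℂ) ∈ homSubspace (altParity 3) 1) :
    φ (sl21Bracket x y) = φ x * φ y + φ y * φ x := by
  rw [hφ.map_bracket, sbracket_odd_odd (hφ.even _ _ hx) (hφ.even _ _ hy)]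

theorem IsPrincipalEmbedding.h₁_e₂ (hφ : IsPrincipalEmbedding p q N φ) :
    (φ e1 * φ f1 + φ f1 * φ e1) * φ e2 - φ e2 * (φ e1 * φ f1 + φ f1 * φ e1) = φ e2 := by
  conv_rhs => rw [← sl21_h₁_e₂, hφ.map_bracket, hφ.map_odd e1_odd f1_odd, sbracket_even
    (anticomm_mem_homSubspace (hφ.even _ _ e1_odd) (hφ.even _ _ f1_odd))]

theorem IsPrincipalEmbedding.h₂_e₁ (hφ : IsPrincipalEmbedding p q N φ) :
    (φ e2 * φ f2 + φ f2 * φ e2) * φ e1 - φ e1 * (φ e2 * φ f2 + φ f2 * φ e2) = -φ e1 := by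
  conv_rhs => rw [← map_neg, ← sl21_h₂_e₁, hφ.map_bracket, hφ.map_odd e2_odd f2_odd, sbracket_even
    (anticomm_mem_homSubspace (hφ.even _ _ e2_odd) (hφ.even _ _ f2_odd))]

/-- Every principal embedding is conjugate to the standard one by a diagonal matrix. -/
theorem IsPrincipalEmbedding.exists_gauge (hφ : IsPrincipalEmbedding p q N φ) :
    ∃ D : BlockIndex p q N → ℂ, (∀ i, D i ≠ 0) ∧
      φ e1 * Matrix.diagonal D =
        Matrix.diagonal D * ((1 : Matrix (Fin p ⊕ Fin q) (Fin p ⊕ Fin q) ℂ) ⊗ₖ modelE₁ N) ∧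
      φ e2 * Matrix.diagonal D =
        Matrix.diagonal D * ((1 : Matrix (Fin p ⊕ Fin q) (Fin p ⊕ Fin q) ℂ) ⊗ₖ modelE₂ N) ∧
      φ f1 * Matrix.diagonal D =
        Matrix.diagonal D * ((1 : Matrix (Fin p ⊕ Fin q) (Fin p ⊕ Fin q) ℂ) ⊗ₖ modelF₁ N) ∧
      φ f2 * Matrix.diagonal D =
        Matrix.diagonal D * ((1 : Matrix (Fin p ⊕ Fin q) (Fin p ⊕ Fin q) ℂ) ⊗ₖ modelF₂ N) := by
  have bd : ∀ x, ∀ i k : BlockIndex p q N, i.1 ≠ k.1 → φ x i k = 0 := fun x =>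
    (hφ.mem_blockSL x).1
  have gauge : ∀ a : Fin p ⊕ Fin q, ∃ D : Fin (2 * N + 1) → ℂ, (∀ k, D k ≠ 0) ∧
      diagBlock a (φ e1) * Matrix.diagonal D = Matrix.diagonal D * modelE₁ N ∧
      diagBlock a (φ e2) * Matrix.diagonal D = Matrix.diagonal D * modelE₂ N ∧
      diagBlock a (φ f1) * Matrix.diagonal D = Matrix.diagonal D * modelF₁ N ∧
      diagBlock a (φ f2) * Matrix.diagonal D = Matrix.diagonal D * modelF₂ N := by
    intro a
    obtain ⟨u1, v1⟩ := diagBlock_eq_up hφ.map_e1 a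
    obtain ⟨u2, v2⟩ := diagBlock_eq_up hφ.map_e2 a
    obtain ⟨u3, v3⟩ := diagBlock_eq_down hφ.map_f1 a
    obtain ⟨u4, v4⟩ := diagBlock_eq_down hφ.map_f2 a
    have h1 := congrArg (diagBlock a) hφ.h₁_e₂
    have h2 := congrArg (diagBlock a) hφ.h₂_e₁
    have sub : ∀ X Y : Matrix (BlockIndex p q N) (BlockIndex p q N) ℂ,
      diagBlock a (X - Y) = diagBlock a X - diagBlock a Y := fun _ _ => rfl
    have add : ∀ X Y : Matrix (BlockIndex p q N) (BlockIndex p q N) ℂ,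
      diagBlock a (X + Y) = diagBlock a X + diagBlock a Y := fun _ _ => rfl
    have neg : ∀ X : Matrix (BlockIndex p q N) (BlockIndex p q N) ℂ,
      diagBlock a (-X) = -diagBlock a X := fun _ => rfl
    have bd2 : ∀ x y, ∀ i k : BlockIndex p q N, i.1 ≠ k.1 →
        (φ x * φ y + φ y * φ x) i k = 0 := fun x y i k hik => by
      rw [Matrix.add_apply, blockDiagonal_mul (bd x) (bd y) i k hik,
        blockDiagonal_mul (bd y) (bd x) i k hik, add_zero]
    rw [sub, diagBlock_mul a (bd2 _ _), diagBlock_mul a (bd _), add, diagBlock_mul a (bd _),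
      diagBlock_mul a (bd _)] at h1
    rw [sub, neg, diagBlock_mul a (bd2 _ _), diagBlock_mul a (bd _), add, diagBlock_mul a (bd _),
      diagBlock_mul a (bd _)] at h2
    rw [u1, u2, u3] at h1
    rw [u1, u2, u4] at h2
    rw [u1, u2, u3, u4]
    exact exists_block_gauge v1 v2 v3 v4 h1 h2
  choose D hD g1 g2 g3 g4 using gauge
  exact ⟨fun i => D i.1 i.2, fun i => hD _ _, mul_diagonal_eq_of_blocks (bd _) g1,
    mul_diagonal_eq_of_blocks (bd _) g2, mul_diagonal_eq_of_blocks (bd _) g3,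
    mul_diagonal_eq_of_blocks (bd _) g4⟩

end BlockDiagonal

end SuperSL

namespace SuperSL

open scoped Kronecker

/-! ### The (a, b) block as a copy of the adjoint action on one block. -/

section Transport

variable {p q N : ℕ}

/-- The parity of the first basis vector of a block. -/
def blockType {p q : ℕ} (a : Fin p ⊕ Fin q) : ZMod 2 := Sum.elim (fun _ => 0) (fun _ => 1) a

theorem blockParity_eq (a : Fin p ⊕ Fin q) (k : Fin (2 * N + 1)) :
    blockParity p q N (a, k) = ((k : ℕ) : ZMod 2) + blockType a := by
  cases a <;> rfl

theorem neg_one_pow_natCast_val (k : ℕ) : (-1 : ℂ) ^ (k : ZMod 2).val = (-1) ^ k := by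
  rw [ZMod.val_natCast, ← neg_one_pow_eq_pow_mod_two]

/-- Multiplication by this matrix intertwines blocks of the same or of opposite parity. -/
def twist (n : ℕ) (s : ZMod 2) : Matrix (Fin n) (Fin n) ℂ := if s = 0 then 1 else altSign n

theorem twist_mul_self (n : ℕ) (s : ZMod 2) : twist n s * twist n s = 1 := by
  rw [twist]; split_ifs
  · simp
  · exact altSign_mul_self n

theorem twist_comm_altSign (n : ℕ) (s : ZMod 2) : twist n s * altSign n = altSign n * twist n s := by
  rw [twist]; split_ifs <;> simp

theorem twist_mul_of_anticomm {n : ℕ} (s : ZMod 2) {x : Matrix (Fin n) (Fin n) ℂ}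
    (hx : altSign n * x = -(x * altSign n)) :
    twist n s * x = (-1 : ℂ) ^ s.val • (x * twist n s) := by
  have h1 : (1 : ZMod 2).val = 1 := rfl
  rcases (by decide : ∀ x : ZMod 2, x = 0 ∨ x = 1) s with rfl | rfl
  · simp [twist]
  · simp [twist, h1, hx]

/-- The embedding of the matrices of one block as the block with indices `a`, `b`, in the basis
rescaled by `D`. -/
noncomputable def blockEmb (D : BlockIndex p q N → ℂ) (a b : Fin p ⊕ Fin q) :
    Matrix (Fin (2 * N + 1)) (Fin (2 * N + 1)) ℂ →ₗ[ℂ]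
      Matrix (BlockIndex p q N) (BlockIndex p q N) ℂ where
  toFun A := Matrix.diagonal D *
    (Matrix.single a b (1 : ℂ) ⊗ₖ (A * twist _ (blockType a + blockType b)))
      * Matrix.diagonal (fun i => (D i)⁻¹)
  map_add' A B := by rw [add_mul, Matrix.kronecker_add, mul_add, add_mul]
  map_smul' c A := by simp [Matrix.kronecker_smul]

theorem blockEmb_apply (D : BlockIndex p q N → ℂ) (a b : Fin p ⊕ Fin q)
    (A : Matrix (Fin (2 * N + 1)) (Fin (2 * N + 1)) ℂ) :
    blockEmb D a b A = Matrix.diagonal D *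
      (Matrix.single a b (1 : ℂ) ⊗ₖ (A * twist _ (blockType a + blockType b)))
        * Matrix.diagonal (fun i => (D i)⁻¹) := rfl

theorem blockEmb_entry (D : BlockIndex p q N → ℂ) (a b : Fin p ⊕ Fin q)
    (A : Matrix (Fin (2 * N + 1)) (Fin (2 * N + 1)) ℂ) (i k : BlockIndex p q N) :
    blockEmb D a b A i k = if i.1 = a ∧ k.1 = b then
      D i * (A * twist (2 * N + 1) (blockType a + blockType b)) i.2 k.2 * (D k)⁻¹ else 0 := by
  rw [blockEmb_apply, Matrix.mul_diagonal, Matrix.diagonal_mul, Matrix.kroneckerMap_apply,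
    Matrix.single_apply]
  simp only [eq_comm (a := a), eq_comm (a := b)]
  split_ifs <;> simp

theorem signMatrix_conj_single_kronecker (a b : Fin p ⊕ Fin q)
    (B : Matrix (Fin (2 * N + 1)) (Fin (2 * N + 1)) ℂ) :
    signMatrix (blockParity p q N) * (Matrix.single a b (1 : ℂ) ⊗ₖ B)
        * signMatrix (blockParity p q N) =
      (-1 : ℂ) ^ (blockType a + blockType b).val •
        (Matrix.single a b (1 : ℂ) ⊗ₖ (altSign _ * B * altSign _)) := by
  ext ⟨i, k⟩ ⟨j, l⟩
  rw [signMatrix_conj_apply, Matrix.smul_apply, Matrix.kroneckerMap_apply,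
    Matrix.kroneckerMap_apply, altSign_conj_apply, Matrix.single_apply]
  split_ifs with h
  · obtain ⟨rfl, rfl⟩ : a = i ∧ b = j := h
    rw [blockParity_eq, blockParity_eq]
    simp only [neg_one_pow_val_add, neg_one_pow_natCast_val, pow_add, smul_eq_mul]
    ring
  · simp

theorem signMatrix_conj_diagonal (D : BlockIndex p q N → ℂ)
    (M : Matrix (BlockIndex p q N) (BlockIndex p q N) ℂ) :
    signMatrix (blockParity p q N) * (Matrix.diagonal D * M * Matrix.diagonal (fun i => (D i)⁻¹))
        * signMatrix (blockParity p q N) =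
      Matrix.diagonal D * (signMatrix (blockParity p q N) * M * signMatrix (blockParity p q N))
        * Matrix.diagonal (fun i => (D i)⁻¹) := by
  ext i k
  simp only [signMatrix_conj_apply, Matrix.mul_diagonal, Matrix.diagonal_mul]
  ring

theorem signMatrix_conj_blockEmb (D : BlockIndex p q N → ℂ) (a b : Fin p ⊕ Fin q)
    (A : Matrix (Fin (2 * N + 1)) (Fin (2 * N + 1)) ℂ) :
    signMatrix (blockParity p q N) * blockEmb D a b A * signMatrix (blockParity p q N) =
      (-1 : ℂ) ^ (blockType a + blockType b).val •
        blockEmb D a b (altSign _ * A * altSign _) := by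
  rw [blockEmb_apply, signMatrix_conj_diagonal, signMatrix_conj_single_kronecker, blockEmb_apply]
  have : altSign _ * (A * twist _ (blockType a + blockType b)) * altSign _ =
      altSign _ * A * altSign _ * twist (2 * N + 1) (blockType a + blockType b) := by
    simp only [mul_assoc, twist_comm_altSign]
  rw [this]
  simp

/-- The block embedding intertwines the super adjoint actions. -/
theorem sbracket_blockEmb {D : BlockIndex p q N → ℂ} (hD : ∀ i, D i ≠ 0)
    {X : Matrix (BlockIndex p q N) (BlockIndex p q N) ℂ}
    {x : Matrix (Fin (2 * N + 1)) (Fin (2 * N + 1)) ℂ}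
    (hX : X ∈ homSubspace (blockParity p q N) 1) (hx : altSign _ * x = -(x * altSign _))
    (hXx : X * Matrix.diagonal D = Matrix.diagonal D *
      ((1 : Matrix (Fin p ⊕ Fin q) (Fin p ⊕ Fin q) ℂ) ⊗ₖ x)) (a b : Fin p ⊕ Fin q)
    (A : Matrix (Fin (2 * N + 1)) (Fin (2 * N + 1)) ℂ) :
    sbracket (blockParity p q N) X (blockEmb D a b A) = blockEmb D a b (oddAd (altSign _) x A) := by
  have i1 : Matrix.diagonal D * Matrix.diagonal (fun i => (D i)⁻¹) = 1 := by
    rw [Matrix.diagonal_mul_diagonal, ← Matrix.diagonal_one]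
    congr 1; funext i; exact mul_inv_cancel₀ (hD i)
  have i2 : Matrix.diagonal (fun i => (D i)⁻¹) * Matrix.diagonal D = 1 := by
    rw [Matrix.diagonal_mul_diagonal, ← Matrix.diagonal_one]
    congr 1; funext i; exact inv_mul_cancel₀ (hD i)
  have hXx' : Matrix.diagonal (fun i => (D i)⁻¹) * X =
      ((1 : Matrix (Fin p ⊕ Fin q) (Fin p ⊕ Fin q) ℂ) ⊗ₖ x)
        * Matrix.diagonal (fun i => (D i)⁻¹) := by
    calc _ = Matrix.diagonal (fun i => (D i)⁻¹) * (X * Matrix.diagonal D)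
          * Matrix.diagonal (fun i => (D i)⁻¹) := by
          rw [mul_assoc, mul_assoc, i1, mul_one]
      _ = _ := by rw [hXx, ← mul_assoc, i2, one_mul]
  have m1 : ∀ B, ((1 : Matrix (Fin p ⊕ Fin q) (Fin p ⊕ Fin q) ℂ) ⊗ₖ x)
      * (Matrix.single a b (1 : ℂ) ⊗ₖ B) = Matrix.single a b (1 : ℂ) ⊗ₖ (x * B) := fun B => by
    rw [← Matrix.mul_kronecker_mul, one_mul]
  have m2 : ∀ B, (Matrix.single a b (1 : ℂ) ⊗ₖ B) *
      ((1 : Matrix (Fin p ⊕ Fin q) (Fin p ⊕ Fin q) ℂ) ⊗ₖ x) =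
      Matrix.single a b (1 : ℂ) ⊗ₖ (B * x) := fun B => by
    rw [← Matrix.mul_kronecker_mul, mul_one]
  have e1 : X * blockEmb D a b A = blockEmb D a b (x * A) := by
    rw [blockEmb_apply, blockEmb_apply, mul_assoc x, ← m1, ← mul_assoc, ← mul_assoc, hXx]
    simp only [mul_assoc]
  -- Moving x past the twist gives a sign when the two blocks have opposite type. Conjugation by the
  -- global parity matrix gives the same sign, and the two cancel.
  have e2 : ∀ A, blockEmb D a b A * X =
      (-1 : ℂ) ^ (blockType a + blockType b).val • blockEmb D a b (A * x) := by
    intro A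
    rw [blockEmb_apply, blockEmb_apply, mul_assoc, hXx', ← mul_assoc, mul_assoc (Matrix.diagonal D),
      m2, mul_assoc A, twist_mul_of_anticomm _ hx]
    simp [Matrix.kronecker_smul, mul_assoc]
  rw [sbracket_odd hX, oddAd_apply, signMatrix_conj_blockEmb, smul_mul_assoc, e2, smul_smul,
    ← mul_pow, e1, oddAd_apply, map_sub]
  simp

/-- The generators of the action on a block, as operators on the whole matrix algebra. -/
def simpleRootVector : Fin 4 → sl21 := ![e1, e2, f1, f2]

theorem simpleRootVector_odd (j : Fin 4) :
    (simpleRootVector j : Matrix (Fin 3) (Fin 3) ℂ) ∈ homSubspace (altParity 3) 1 := by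
  fin_cases j
  · exact e1_odd
  · exact e2_odd
  · exact f1_odd
  · exact f2_odd

variable {φ : sl21 →ₗ[ℂ] Matrix (BlockIndex p q N) (BlockIndex p q N) ℂ}

/-- The diagonal change of basis of a principal embedding. -/
structure IsGauge (φ : sl21 →ₗ[ℂ] Matrix (BlockIndex p q N) (BlockIndex p q N) ℂ)
    (D : BlockIndex p q N → ℂ) : Prop where
  ne_zero : ∀ i, D i ≠ 0
  intertwines : ∀ j a b A, sbracket (blockParity p q N) (φ (simpleRootVector j))
    (blockEmb D a b A) = blockEmb D a b (modelAd N j A)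

theorem IsPrincipalEmbedding.exists_isGauge (hφ : IsPrincipalEmbedding p q N φ) :
    ∃ D, IsGauge φ D := by
  obtain ⟨D, hD, h1, h2, h3, h4⟩ := hφ.exists_gauge
  refine ⟨D, hD, fun j a b A => ?_⟩
  have hodd := hφ.even _ _ (simpleRootVector_odd j)
  fin_cases j
  · exact sbracket_blockEmb hD hodd (altSign_up _ _) h1 a b A
  · exact sbracket_blockEmb hD hodd (altSign_up _ _) h2 a b A
  · exact sbracket_blockEmb hD hodd (altSign_down _ _) h3 a b A
  · exact sbracket_blockEmb hD hodd (altSign_down _ _) h4 a b A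

theorem IsPrincipalEmbedding.sbracket_map_odd (hφ : IsPrincipalEmbedding p q N φ) {x y : sl21}
    (hx : (x : Matrix (Fin 3) (Fin 3) ℂ) ∈ homSubspace (altParity 3) 1)
    (hy : (y : Matrix (Fin 3) (Fin 3) ℂ) ∈ homSubspace (altParity 3) 1)
    (A : Matrix (BlockIndex p q N) (BlockIndex p q N) ℂ) :
    sbracket (blockParity p q N) (φ (sl21Bracket x y)) A =
      sbracket (blockParity p q N) (φ x) (sbracket (blockParity p q N) (φ y) A)
        + sbracket (blockParity p q N) (φ y) (sbracket (blockParity p q N) (φ x) A) := by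
  rw [hφ.map_odd hx hy, sbracket_anticomm (hφ.even _ _ hx) (hφ.even _ _ hy),
    sbracket_odd (hφ.even _ _ hx), sbracket_odd (hφ.even _ _ hy), sbracket_odd (hφ.even _ _ hx),
    sbracket_odd (hφ.even _ _ hy)]
  rfl

/-- A subspace stable under the simple root vectors is stable under all of `sl(2|1)`. -/
theorem IsPrincipalEmbedding.stable_of_simple (hφ : IsPrincipalEmbedding p q N φ)
    {W : Submodule ℂ (Matrix (BlockIndex p q N) (BlockIndex p q N) ℂ)}
    (h : ∀ j, ∀ A ∈ W, sbracket (blockParity p q N) (φ (simpleRootVector j)) A ∈ W) (x : sl21)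
    (A : Matrix (BlockIndex p q N) (BlockIndex p q N) ℂ) (hA : A ∈ W) :
    sbracket (blockParity p q N) (φ x) A ∈ W := by
  have hb : ∀ i j, sbracket (blockParity p q N)
      (φ (sl21Bracket (simpleRootVector i) (simpleRootVector j))) A ∈ W := fun i j => by
    rw [hφ.sbracket_map_odd (simpleRootVector_odd i) (simpleRootVector_odd j)]
    exact W.add_mem (h i _ (h j _ hA)) (h j _ (h i _ hA))
  rw [sl21_decomposition x]
  simp only [map_add, map_smul, sbracket_add_left, sbracket_smul_left]
  exact W.add_mem (W.add_mem (W.add_mem (W.add_mem (W.add_mem (W.add_mem (W.add_mem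
    (W.smul_mem _ (h 0 _ hA)) (W.smul_mem _ (h 1 _ hA))) (W.smul_mem _ (h 2 _ hA)))
    (W.smul_mem _ (h 3 _ hA))) (W.smul_mem _ (hb 0 1))) (W.smul_mem _ (hb 2 3)))
    (W.smul_mem _ (hb 0 2))) (W.smul_mem _ (hb 1 3))

/-- The left inverse of the block embedding. -/
noncomputable def blockProj (D : BlockIndex p q N → ℂ) (a b : Fin p ⊕ Fin q) :
    Matrix (BlockIndex p q N) (BlockIndex p q N) ℂ →ₗ[ℂ]
      Matrix (Fin (2 * N + 1)) (Fin (2 * N + 1)) ℂ where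
  toFun M := (Matrix.of fun k l => (D (a, k))⁻¹ * M (a, k) (b, l) * D (b, l))
    * twist _ (blockType a + blockType b)
  map_add' M M' := by
    rw [← add_mul]; congr 1; ext k l; simp; ring
  map_smul' c M := by
    rw [RingHom.id_apply, ← smul_mul_assoc]; congr 1; ext k l; simp; ring

theorem blockProj_apply (D : BlockIndex p q N → ℂ) (a b : Fin p ⊕ Fin q)
    (M : Matrix (BlockIndex p q N) (BlockIndex p q N) ℂ) : blockProj D a b M =
      (Matrix.of fun k l => (D (a, k))⁻¹ * M (a, k) (b, l) * D (b, l))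
        * twist _ (blockType a + blockType b) := rfl

theorem blockProj_blockEmb {D : BlockIndex p q N → ℂ} (hD : ∀ i, D i ≠ 0) (a b : Fin p ⊕ Fin q)
    (A : Matrix (Fin (2 * N + 1)) (Fin (2 * N + 1)) ℂ) :
    blockProj D a b (blockEmb D a b A) = A := by
  rw [blockProj_apply]
  have : (Matrix.of fun k l => (D (a, k))⁻¹ * blockEmb D a b A (a, k) (b, l) * D (b, l)) =
      A * twist _ (blockType a + blockType b) := by
    ext k l
    have h1 := hD (a, k)
    have h2 := hD (b, l)
    simp only [Matrix.of_apply, blockEmb_entry, and_self, if_true]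
    field_simp
  rw [this, mul_assoc, twist_mul_self, mul_one]

theorem blockProj_blockEmb_ne (D : BlockIndex p q N → ℂ) {a b a' b' : Fin p ⊕ Fin q}
    (h : ¬(a = a' ∧ b = b')) (A : Matrix (Fin (2 * N + 1)) (Fin (2 * N + 1)) ℂ) :
    blockProj D a b (blockEmb D a' b' A) = 0 := by
  rw [blockProj_apply]
  have : (Matrix.of fun k l => (D (a, k))⁻¹ * blockEmb D a' b' A (a, k) (b, l) * D (b, l)) = 0 := by
    ext k l
    simp [blockEmb_entry, h]
  rw [this, zero_mul]

theorem sum_blockEmb_blockProj {D : BlockIndex p q N → ℂ} (hD : ∀ i, D i ≠ 0)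
    (M : Matrix (BlockIndex p q N) (BlockIndex p q N) ℂ) :
    ∑ a, ∑ b, blockEmb D a b (blockProj D a b M) = M := by
  ext ⟨a, k⟩ ⟨b, l⟩
  simp only [Matrix.sum_apply]
  rw [Finset.sum_eq_single a, Finset.sum_eq_single b]
  · have h1 := hD (a, k)
    have h2 := hD (b, l)
    have h3 : blockProj D a b M * twist _ (blockType a + blockType b) =
        Matrix.of fun k l => (D (a, k))⁻¹ * M (a, k) (b, l) * D (b, l) := by
      rw [blockProj_apply, mul_assoc, twist_mul_self, mul_one]
    rw [blockEmb_entry, if_pos ⟨rfl, rfl⟩, h3, Matrix.of_apply]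
    field_simp
  · intro b' _ hb'
    rw [blockEmb_entry, if_neg (fun h => hb' h.2.symm)]
  · simp
  · intro a' _ ha'
    exact Finset.sum_eq_zero fun b' _ => by rw [blockEmb_entry, if_neg (fun h => ha' h.1.symm)]
  · simp

theorem blockEmb_injective {D : BlockIndex p q N → ℂ} (hD : ∀ i, D i ≠ 0) (a b : Fin p ⊕ Fin q) :
    Function.Injective (blockEmb D a b) :=
  Function.LeftInverse.injective (blockProj_blockEmb hD a b)

end Transport
end SuperSL

namespace SuperSL

open scoped Kronecker

/-! ### Homomorphisms from sl(2|1) out of the Chevalley relations. -/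

section Existence

/-- The element of the algebra generated by `e₁, e₂, f₁, f₂` with the given coordinates. -/
def rootComb {R : Type*} [Ring R] [Algebra ℂ R] (e₁ e₂ f₁ f₂ : R) (a b c d s t u w : ℂ) : R :=
  a • e₁ + b • e₂ + c • f₁ + d • f₂ + s • (e₁ * e₂ + e₂ * e₁) + t • (f₁ * f₂ + f₂ * f₁)
    + u • (e₁ * f₁ + f₁ * e₁) + w • (e₂ * f₂ + f₂ * e₂)

variable {R : Type*} [Ring R] [Algebra ℂ R] {e₁ e₂ f₁ f₂ ε : R}

theorem rootComb_swap (a b c d s t u w : ℂ) :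
    rootComb f₂ f₁ e₂ e₁ d c b a t s w u = rootComb e₁ e₂ f₁ f₂ a b c d s t u w := by
  simp only [rootComb, add_comm (f₂ * f₁), add_comm (f₂ * e₂), add_comm (e₂ * e₁),
    add_comm (f₁ * e₁)]
  module

theorem rootComb_conj (hε : ε * ε = 1) (h1 : ε * e₁ = -(e₁ * ε)) (h2 : ε * e₂ = -(e₂ * ε))
    (h3 : ε * f₁ = -(f₁ * ε)) (h4 : ε * f₂ = -(f₂ * ε)) (a b c d s t u w : ℂ) :
    ε * rootComb e₁ e₂ f₁ f₂ a b c d s t u w * ε =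
      rootComb e₁ e₂ f₁ f₂ (-a) (-b) (-c) (-d) s t u w := by
  have odd : ∀ x : R, ε * x = -(x * ε) → ε * x * ε = -x := fun x hx => by
    rw [hx, neg_mul, mul_assoc, hε, mul_one]
  have even : ∀ x y : R, ε * x = -(x * ε) → ε * y = -(y * ε) → ε * (x * y) * ε = x * y := by
    intro x y hx hy
    rw [← mul_assoc, hx, neg_mul, neg_mul, mul_assoc x, hy, mul_neg, neg_mul, neg_neg, mul_assoc,
      mul_assoc, hε, mul_one]
  simp only [rootComb, mul_add, add_mul, mul_smul_comm, smul_mul_assoc, odd _ h1, odd _ h2,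
    odd _ h3, odd _ h4, even _ _ h1 h2, even _ _ h2 h1, even _ _ h3 h4, even _ _ h4 h3,
    even _ _ h1 h3, even _ _ h3 h1, even _ _ h2 h4, even _ _ h4 h2]
  module

/-- The second combination is the parity conjugate of the first, so the left side is the
superbracket with e₁. The resulting coordinates depend only on the relations, hence are the same in
sl(2|1) and in any target ring. -/
theorem SL21Relations.e₁_rootComb (h : SL21Relations e₁ e₂ f₁ f₂) (a b c d s t u w : ℂ) :
    e₁ * rootComb e₁ e₂ f₁ f₂ a b c d s t u w
        - rootComb e₁ e₂ f₁ f₂ (-a) (-b) (-c) (-d) s t u w * e₁ =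
      rootComb e₁ e₂ f₁ f₂ w 0 0 (-t) b 0 c 0 := by
  have k1 : e₁ * (e₁ * e₂ + e₂ * e₁) - (e₁ * e₂ + e₂ * e₁) * e₁ = 0 := by
    linear_combination (norm := noncomm_ring) h.e₁_sq * e₂ - e₂ * h.e₁_sq
  have k2 : e₁ * (e₁ * f₁ + f₁ * e₁) - (e₁ * f₁ + f₁ * e₁) * e₁ = 0 := by
    linear_combination (norm := noncomm_ring) h.e₁_sq * f₁ - f₁ * h.e₁_sq
  have k3 := h.lower_comm_e₁
  have k4 := h.h₂_e₁
  have k5 := h.e₁_f₂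
  have k6 := h.e₁_sq
  unfold rootComb
  simp only [mul_add e₁ (_ + _), mul_add e₁ (_ • _), add_mul (_ + _) (_ • _) e₁,
    add_mul (_ • _) (_ • _) e₁, mul_smul_comm, smul_mul_assoc]
  linear_combination (norm := module) s • k1 + u • k2 - t • k3 - w • k4 + d • k5 + (2 * a) • k6

theorem SL21Relations.e₂_rootComb (h : SL21Relations e₁ e₂ f₁ f₂) (a b c d s t u w : ℂ) :
    e₂ * rootComb e₁ e₂ f₁ f₂ a b c d s t u w
        - rootComb e₁ e₂ f₁ f₂ (-a) (-b) (-c) (-d) s t u w * e₂ =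
      rootComb e₁ e₂ f₁ f₂ 0 (-u) t 0 a 0 0 d := by
  have k1 : e₂ * (e₁ * e₂ + e₂ * e₁) - (e₁ * e₂ + e₂ * e₁) * e₂ = 0 := by
    linear_combination (norm := noncomm_ring) h.e₂_sq * e₁ - e₁ * h.e₂_sq
  have k2 : e₂ * (e₂ * f₂ + f₂ * e₂) - (e₂ * f₂ + f₂ * e₂) * e₂ = 0 := by
    linear_combination (norm := noncomm_ring) h.e₂_sq * f₂ - f₂ * h.e₂_sq
  have k3 := h.lower_comm_e₂
  have k4 := h.h₁_e₂
  have k5 := h.e₂_f₁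
  have k6 := h.e₂_sq
  unfold rootComb
  simp only [mul_add e₂ (_ + _), mul_add e₂ (_ • _), add_mul (_ + _) (_ • _) e₂,
    add_mul (_ • _) (_ • _) e₂, mul_smul_comm, smul_mul_assoc]
  linear_combination (norm := module) s • k1 + w • k2 - t • k3 - u • k4 + c • k5 + (2 * b) • k6

theorem SL21Relations.f₂_rootComb (h : SL21Relations e₁ e₂ f₁ f₂) (a b c d s t u w : ℂ) :
    f₂ * rootComb e₁ e₂ f₁ f₂ a b c d s t u w
        - rootComb e₁ e₂ f₁ f₂ (-a) (-b) (-c) (-d) s t u w * f₂ =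
      rootComb e₁ e₂ f₁ f₂ (-s) 0 0 u 0 c 0 b := by
  rw [← rootComb_swap, ← rootComb_swap (a := -a), h.swap.e₁_rootComb, rootComb_swap]

theorem SL21Relations.f₁_rootComb (h : SL21Relations e₁ e₂ f₁ f₂) (a b c d s t u w : ℂ) :
    f₁ * rootComb e₁ e₂ f₁ f₂ a b c d s t u w
        - rootComb e₁ e₂ f₁ f₂ (-a) (-b) (-c) (-d) s t u w * f₁ =
      rootComb e₁ e₂ f₁ f₂ 0 s (-w) 0 0 d a 0 := by
  rw [← rootComb_swap, ← rootComb_swap (a := -a), h.swap.e₂_rootComb, rootComb_swap]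

theorem sl21_relations : SL21Relations (e1 : Matrix (Fin 3) (Fin 3) ℂ) e2 f1 f2 := by
  constructor <;> ext i k <;> fin_cases i <;> fin_cases k <;> simp [e1, e2, f1, f2]

/-- The linear map out of `sl(2|1)` determined by the images of the simple root vectors. -/
def rootMap (e₁ e₂ f₁ f₂ : R) : sl21 →ₗ[ℂ] R where
  toFun x := rootComb e₁ e₂ f₁ f₂ ((x : Matrix (Fin 3) (Fin 3) ℂ) 0 1)
    ((x : Matrix (Fin 3) (Fin 3) ℂ) 1 2) ((x : Matrix (Fin 3) (Fin 3) ℂ) 1 0)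
    ((x : Matrix (Fin 3) (Fin 3) ℂ) 2 1) ((x : Matrix (Fin 3) (Fin 3) ℂ) 0 2)
    ((x : Matrix (Fin 3) (Fin 3) ℂ) 2 0) ((x : Matrix (Fin 3) (Fin 3) ℂ) 0 0)
    ((x : Matrix (Fin 3) (Fin 3) ℂ) 2 2)
  map_add' x y := by
    simp only [rootComb, Submodule.coe_add, Matrix.add_apply]; module
  map_smul' c x := by
    simp only [rootComb, Submodule.coe_smul, Matrix.smul_apply, RingHom.id_apply, smul_eq_mul]
    module

/-- The eight coordinates of a combination in sl(2|1) can be read off from its entries. -/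
theorem rootMap_of_coe {x : sl21} {a b c d s t u w : ℂ}
    (hx : (x : Matrix (Fin 3) (Fin 3) ℂ) = rootComb (e1 : Matrix (Fin 3) (Fin 3) ℂ) e2 f1 f2
      a b c d s t u w) :
    rootMap e₁ e₂ f₁ f₂ x = rootComb e₁ e₂ f₁ f₂ a b c d s t u w := by
  change rootComb e₁ e₂ f₁ f₂ _ _ _ _ _ _ _ _ = _
  rw [hx]
  simp [rootComb, e1, e2, f1, f2]

theorem coe_eq_rootComb (x : sl21) : ∃ a b c d s t u w : ℂ, (x : Matrix (Fin 3) (Fin 3) ℂ) =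
    rootComb (e1 : Matrix (Fin 3) (Fin 3) ℂ) e2 f1 f2 a b c d s t u w := by
  have h := congrArg Subtype.val (sl21_decomposition x)
  simp only [Submodule.coe_add, Submodule.coe_smul] at h
  rw [coe_sl21Bracket_odd e2_odd f2_odd, coe_sl21Bracket_odd e1_odd f1_odd,
    coe_sl21Bracket_odd e1_odd e2_odd, coe_sl21Bracket_odd f1_odd f2_odd] at h
  exact ⟨_, _, _, _, _, _, _, _, h⟩

variable {ι : Type} [Fintype ι] [DecidableEq ι] {π : ι → ZMod 2} {E₁ E₂ F₁ F₂ : Matrix ι ι ℂ}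

theorem rootMap_simple_bracket (h : SL21Relations E₁ E₂ F₁ F₂) (h1 : E₁ ∈ homSubspace π 1)
    (h2 : E₂ ∈ homSubspace π 1) (h3 : F₁ ∈ homSubspace π 1) (h4 : F₂ ∈ homSubspace π 1)
    (j : Fin 4) (y : sl21) :
    rootMap E₁ E₂ F₁ F₂ (sl21Bracket (simpleRootVector j) y) =
      oddAd (signMatrix π) (![E₁, E₂, F₁, F₂] j) (rootMap E₁ E₂ F₁ F₂ y) := by
  obtain ⟨a, b, c, d, s, t, u, w, hy⟩ := coe_eq_rootComb y
  have hconj := rootComb_conj (signMatrix_mul_self π) (signMatrix_odd h1) (signMatrix_odd h2)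
    (signMatrix_odd h3) (signMatrix_odd h4) a b c d s t u w
  have hconj' := rootComb_conj (signMatrix_mul_self (altParity 3)) (signMatrix_odd e1_odd)
    (signMatrix_odd e2_odd) (signMatrix_odd f1_odd) (signMatrix_odd f2_odd) a b c d s t u w
  have hb : ((sl21Bracket (simpleRootVector j) y : sl21) : Matrix (Fin 3) (Fin 3) ℂ) = _ :=
    sbracket_odd (simpleRootVector_odd j) _
  rw [hy, oddAd_apply, hconj'] at hb
  rw [rootMap_of_coe hy, oddAd_apply, hconj]
  fin_cases j
  · exact (rootMap_of_coe (hb.trans (sl21_relations.e₁_rootComb _ _ _ _ _ _ _ _))).trans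
      (h.e₁_rootComb _ _ _ _ _ _ _ _).symm
  · exact (rootMap_of_coe (hb.trans (sl21_relations.e₂_rootComb _ _ _ _ _ _ _ _))).trans
      (h.e₂_rootComb _ _ _ _ _ _ _ _).symm
  · exact (rootMap_of_coe (hb.trans (sl21_relations.f₁_rootComb _ _ _ _ _ _ _ _))).trans
      (h.f₁_rootComb _ _ _ _ _ _ _ _).symm
  · exact (rootMap_of_coe (hb.trans (sl21_relations.f₂_rootComb _ _ _ _ _ _ _ _))).trans
      (h.f₂_rootComb _ _ _ _ _ _ _ _).symm

theorem rootMap_simple (j : Fin 4) :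
    rootMap E₁ E₂ F₁ F₂ (simpleRootVector j) = ![E₁, E₂, F₁, F₂] j := by
  fin_cases j
  · refine (rootMap_of_coe (a := 1) (b := 0) (c := 0) (d := 0) (s := 0) (t := 0) (u := 0) (w := 0)
      ?_).trans ?_ <;> simp [rootComb, simpleRootVector]
  · refine (rootMap_of_coe (a := 0) (b := 1) (c := 0) (d := 0) (s := 0) (t := 0) (u := 0) (w := 0)
      ?_).trans ?_ <;> simp [rootComb, simpleRootVector]
  · refine (rootMap_of_coe (a := 0) (b := 0) (c := 1) (d := 0) (s := 0) (t := 0) (u := 0) (w := 0)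
      ?_).trans ?_ <;> simp [rootComb, simpleRootVector]
  · refine (rootMap_of_coe (a := 0) (b := 0) (c := 0) (d := 1) (s := 0) (t := 0) (u := 0) (w := 0)
      ?_).trans ?_ <;> simp [rootComb, simpleRootVector]

/-- For x a simple root vector the same multiplication table holds on both sides; for x a bracket of
two of them the Jacobi identity on both sides reduces to that case; `sl21_decomposition` covers all
x by linearity. -/
theorem rootMap_bracket (h : SL21Relations E₁ E₂ F₁ F₂) (h1 : E₁ ∈ homSubspace π 1)
    (h2 : E₂ ∈ homSubspace π 1) (h3 : F₁ ∈ homSubspace π 1) (h4 : F₂ ∈ homSubspace π 1)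
    (x y : sl21) :
    rootMap E₁ E₂ F₁ F₂ (sl21Bracket x y) =
      sbracket π (rootMap E₁ E₂ F₁ F₂ x) (rootMap E₁ E₂ F₁ F₂ y) := by
  have hodd : ∀ j, (![E₁, E₂, F₁, F₂] j) ∈ homSubspace π 1 := by
    intro j; fin_cases j
    exacts [h1, h2, h3, h4]
  have simple : ∀ j y, rootMap E₁ E₂ F₁ F₂ (sl21Bracket (simpleRootVector j) y) =
      sbracket π (rootMap E₁ E₂ F₁ F₂ (simpleRootVector j)) (rootMap E₁ E₂ F₁ F₂ y) := by
    intro j y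
    rw [rootMap_simple_bracket h h1 h2 h3 h4, rootMap_simple, sbracket_odd (hodd j)]
  have double : ∀ i j y,
      rootMap E₁ E₂ F₁ F₂ (sl21Bracket (sl21Bracket (simpleRootVector i) (simpleRootVector j)) y) =
      sbracket π (rootMap E₁ E₂ F₁ F₂ (sl21Bracket (simpleRootVector i) (simpleRootVector j)))
        (rootMap E₁ E₂ F₁ F₂ y) := by
    intro i j y
    have e : sl21Bracket (sl21Bracket (simpleRootVector i) (simpleRootVector j)) y =
        sl21Bracket (simpleRootVector i) (sl21Bracket (simpleRootVector j) y)
          + sl21Bracket (simpleRootVector j) (sl21Bracket (simpleRootVector i) y) := by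
      refine Subtype.ext ?_
      change sbracket (altParity 3) _ _ = sbracket (altParity 3) _ (sbracket (altParity 3) _ _)
        + sbracket (altParity 3) _ (sbracket (altParity 3) _ _)
      rw [coe_sl21Bracket_odd (simpleRootVector_odd i) (simpleRootVector_odd j),
        sbracket_anticomm (simpleRootVector_odd i) (simpleRootVector_odd j),
        sbracket_odd (simpleRootVector_odd i), sbracket_odd (simpleRootVector_odd j),
        sbracket_odd (simpleRootVector_odd i), sbracket_odd (simpleRootVector_odd j)]
      rfl
    rw [e, map_add, simple, simple, simple, simple, simple i (simpleRootVector j), rootMap_simple,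
      rootMap_simple, sbracket_odd_odd (hodd i) (hodd j), sbracket_anticomm (hodd i) (hodd j),
      sbracket_odd (hodd i), sbracket_odd (hodd j), sbracket_odd (hodd i), sbracket_odd (hodd j)]
    rfl
  have addL : ∀ x x' y, sl21Bracket (x + x') y = sl21Bracket x y + sl21Bracket x' y := fun x x' y =>
    Subtype.ext (sbracket_add_left _ _ _)
  have smulL : ∀ (c : ℂ) x y, sl21Bracket (c • x) y = c • sl21Bracket x y := fun c x y =>
    Subtype.ext (sbracket_smul_left _ _ _)
  rw [sl21_decomposition x]
  simp only [addL, smulL, map_add, map_smul, sbracket_add_left, sbracket_smul_left]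
  have s0 := simple 0 y; have s1 := simple 1 y; have s2 := simple 2 y; have s3 := simple 3 y
  have d1 := double 0 1 y; have d2 := double 2 3 y; have d3 := double 0 2 y
  have d4 := double 1 3 y
  simp only [simpleRootVector, Matrix.cons_val] at s0 s1 s2 s3 d1 d2 d3 d4
  rw [s0, s1, s2, s3, d1, d2, d3, d4]

theorem rootMap_even (h1 : E₁ ∈ homSubspace π 1) (h2 : E₂ ∈ homSubspace π 1)
    (h3 : F₁ ∈ homSubspace π 1) (h4 : F₂ ∈ homSubspace π 1) (s : ZMod 2) (x : sl21)
    (hx : (x : Matrix (Fin 3) (Fin 3) ℂ) ∈ homSubspace (altParity 3) s) :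
    rootMap E₁ E₂ F₁ F₂ x ∈ homSubspace π s := by
  have h := hx
  change rootComb _ _ _ _ _ _ _ _ _ _ _ _ ∈ _
  rcases (by decide : ∀ x : ZMod 2, x = 0 ∨ x = 1) s with rfl | rfl
  · rw [h 0 1 (by decide), h 1 2 (by decide), h 1 0 (by decide), h 2 1 (by decide), rootComb]
    simp only [zero_smul, zero_add]
    exact Submodule.add_mem _ (Submodule.add_mem _ (Submodule.add_mem _
      (Submodule.smul_mem _ _ (anticomm_mem_homSubspace h1 h2))
      (Submodule.smul_mem _ _ (anticomm_mem_homSubspace h3 h4)))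
      (Submodule.smul_mem _ _ (anticomm_mem_homSubspace h1 h3)))
      (Submodule.smul_mem _ _ (anticomm_mem_homSubspace h2 h4))
  · rw [h 0 2 (by decide), h 2 0 (by decide), h 0 0 (by decide), h 2 2 (by decide), rootComb]
    simp only [zero_smul, add_zero]
    exact Submodule.add_mem _ (Submodule.add_mem _ (Submodule.add_mem _
      (Submodule.smul_mem _ _ h1) (Submodule.smul_mem _ _ h2)) (Submodule.smul_mem _ _ h3))
      (Submodule.smul_mem _ _ h4)

theorem rootMap_mem_sl (h1 : E₁ ∈ homSubspace π 1) (h2 : E₂ ∈ homSubspace π 1)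
    (h3 : F₁ ∈ homSubspace π 1) (h4 : F₂ ∈ homSubspace π 1) (x : sl21) :
    rootMap E₁ E₂ F₁ F₂ x ∈ sl π := by
  have hodd : ∀ X ∈ homSubspace π 1, X ∈ sl π := fun X hX => by
    rw [sl, LinearMap.mem_ker]
    refine Finset.sum_eq_zero fun i _ => ?_
    rw [hX i i, mul_zero]
    rw [CharTwo.add_self_eq_zero]
    decide
  have hev : ∀ X ∈ homSubspace π 1, ∀ Y ∈ homSubspace π 1, X * Y + Y * X ∈ sl π :=
    fun X hX Y hY => by rw [← sbracket_odd_odd hX hY]; exact sbracket_mem_sl _ _ _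
  change rootComb _ _ _ _ _ _ _ _ _ _ _ _ ∈ _
  rw [rootComb]
  exact Submodule.add_mem _ (Submodule.add_mem _ (Submodule.add_mem _ (Submodule.add_mem _
    (Submodule.add_mem _ (Submodule.add_mem _ (Submodule.add_mem _
    (Submodule.smul_mem _ _ (hodd _ h1)) (Submodule.smul_mem _ _ (hodd _ h2)))
    (Submodule.smul_mem _ _ (hodd _ h3))) (Submodule.smul_mem _ _ (hodd _ h4)))
    (Submodule.smul_mem _ _ (hev _ h1 _ h2))) (Submodule.smul_mem _ _ (hev _ h3 _ h4)))
    (Submodule.smul_mem _ _ (hev _ h1 _ h3))) (Submodule.smul_mem _ _ (hev _ h2 _ h4))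

end Existence
end SuperSL

namespace SuperSL

open scoped Kronecker

/-! ### The standard principal embedding. -/

section StandardEmbedding

variable {p q N : ℕ}

/-- The ring homomorphism placing a matrix in every diagonal block. -/
def repeatBlock (p q N : ℕ) : Matrix (Fin (2 * N + 1)) (Fin (2 * N + 1)) ℂ →+*
    Matrix (BlockIndex p q N) (BlockIndex p q N) ℂ where
  toFun X := (1 : Matrix (Fin p ⊕ Fin q) (Fin p ⊕ Fin q) ℂ) ⊗ₖ X
  map_one' := Matrix.one_kronecker_one
  map_mul' X Y := by rw [← Matrix.mul_kronecker_mul, one_mul]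
  map_zero' := Matrix.kronecker_zero _
  map_add' X Y := Matrix.kronecker_add _ _ _

theorem repeatBlock_apply (X : Matrix (Fin (2 * N + 1)) (Fin (2 * N + 1)) ℂ)
    (a b : Fin p ⊕ Fin q) (k l : Fin (2 * N + 1)) :
    repeatBlock p q N X (a, k) (b, l) = if a = b then X k l else 0 := by
  change (1 : Matrix (Fin p ⊕ Fin q) (Fin p ⊕ Fin q) ℂ) a b * X k l = _
  rw [Matrix.one_apply]
  split_ifs <;> simp

theorem repeatBlock_smul (c : ℂ) (X : Matrix (Fin (2 * N + 1)) (Fin (2 * N + 1)) ℂ) :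
    repeatBlock p q N (c • X) = c • repeatBlock p q N X := Matrix.kronecker_smul _ _ _

theorem up_odd {n : ℕ} (c : ℕ → ℂ) : upMatrix n c ∈ homSubspace (altParity n) 1 := by
  intro i l h
  rw [upMatrix, if_neg]
  intro h'
  apply h
  rw [altParity, altParity, h']
  push_cast
  rw [← add_assoc, CharTwo.add_self_eq_zero, zero_add]

theorem down_odd {n : ℕ} (c : ℕ → ℂ) : downMatrix n c ∈ homSubspace (altParity n) 1 := by
  intro i l h
  rw [downMatrix, if_neg]
  intro h'
  apply h
  rw [altParity, altParity, h']
  push_cast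
  rw [add_right_comm, CharTwo.add_self_eq_zero, zero_add]

theorem repeatBlock_mem_homSubspace {s : ZMod 2} {X : Matrix (Fin (2 * N + 1)) (Fin (2 * N + 1)) ℂ}
    (hX : X ∈ homSubspace (altParity (2 * N + 1)) s) :
    repeatBlock p q N X ∈ homSubspace (blockParity p q N) s := by
  rintro ⟨a, k⟩ ⟨b, l⟩ h
  rw [repeatBlock_apply]
  split_ifs with hab
  · subst hab
    refine hX k l fun h' => h ?_
    rw [← h', blockParity_eq, blockParity_eq, altParity, altParity, add_add_add_comm,
      CharTwo.add_self_eq_zero, add_zero]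
  · rfl

/-- The standard representation of `sl(2|1)` on one block. -/
def modelRep (N : ℕ) : sl21 →ₗ[ℂ] Matrix (Fin (2 * N + 1)) (Fin (2 * N + 1)) ℂ :=
  rootMap (modelE₁ N) (modelE₂ N) (modelF₁ N) (modelF₂ N)

/-- The standard principal embedding. -/
def standardEmbedding (p q N : ℕ) : sl21 →ₗ[ℂ] Matrix (BlockIndex p q N) (BlockIndex p q N) ℂ :=
  rootMap (repeatBlock p q N (modelE₁ N)) (repeatBlock p q N (modelE₂ N))
    (repeatBlock p q N (modelF₁ N)) (repeatBlock p q N (modelF₂ N))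

theorem standardEmbedding_apply (x : sl21) :
    standardEmbedding p q N x = repeatBlock p q N (modelRep N x) := by
  change rootComb _ _ _ _ _ _ _ _ _ _ _ _ = repeatBlock p q N (rootComb _ _ _ _ _ _ _ _ _ _ _ _)
  simp only [rootComb, map_add, map_mul, repeatBlock_smul]

/-- For N ≥ 1 the positions 0, 1, 2 exist, and this corner already determines x, which gives
injectivity. -/
theorem modelRep_entries (hN : 1 ≤ N) (x : sl21) :
    entry (modelRep N x) 0 1 = (x : Matrix (Fin 3) (Fin 3) ℂ) 0 1 ∧
    entry (modelRep N x) 1 2 = (x : Matrix (Fin 3) (Fin 3) ℂ) 1 2 ∧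
    entry (modelRep N x) 1 0 = (x : Matrix (Fin 3) (Fin 3) ℂ) 1 0 * N ∧
    entry (modelRep N x) 2 1 = (x : Matrix (Fin 3) (Fin 3) ℂ) 2 1 ∧
    entry (modelRep N x) 0 2 = (x : Matrix (Fin 3) (Fin 3) ℂ) 0 2 ∧
    entry (modelRep N x) 2 0 = (x : Matrix (Fin 3) (Fin 3) ℂ) 2 0 * N ∧
    entry (modelRep N x) 0 0 = (x : Matrix (Fin 3) (Fin 3) ℂ) 0 0 * N ∧
    entry (modelRep N x) 2 2 = (x : Matrix (Fin 3) (Fin 3) ℂ) 0 0 * (N - 1)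
      + (x : Matrix (Fin 3) (Fin 3) ℂ) 2 2 := by
  have b0 : 0 < 2 * N + 1 := by omega
  have b1 : 1 < 2 * N + 1 := by omega
  have b2 : 2 < 2 * N + 1 := by omega
  have h : modelRep N x = rootComb _ _ _ _ _ _ _ _ _ _ _ _ := rfl
  rw [rootComb, modelH₁_eq, modelH₂_eq] at h
  have l0 : lowerCoeff N 0 = N := by simpa using lowerCoeff_even N 0
  have l1 : lowerCoeff N 1 = 1 := by simpa using lowerCoeff_odd N 0
  rw [h]
  refine ⟨?_, ?_, ?_, ?_, ?_, ?_, ?_, ?_⟩ <;>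
  · rw [entry_eq (by omega) (by omega)]
    simp only [Matrix.add_apply, Matrix.smul_apply, modelE₁, modelE₂, modelF₁, modelF₂,
      up_mul_apply, mul_down_apply, diagMatrix, Matrix.diagonal_apply, Fin.mk.injEq]
    simp [upMatrix, downMatrix, entry, b0, b1, b2, l0, l1]

theorem modelRep_injective (hN : 1 ≤ N) : Function.Injective (modelRep N) := by
  rw [injective_iff_map_eq_zero]
  intro x hx
  obtain ⟨h1, h2, h3, h4, h5, h6, h7, h8⟩ := modelRep_entries hN x
  have hz : ∀ i l, entry (0 : Matrix (Fin (2 * N + 1)) (Fin (2 * N + 1)) ℂ) i l = 0 := fun i l => by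
    simp [entry]
  have hN0 : (N : ℂ) ≠ 0 := by exact_mod_cast (by omega : N ≠ 0)
  simp only [hx, hz] at h1 h2 h3 h4 h5 h6 h7 h8
  have h3' := (mul_eq_zero.1 h3.symm).resolve_right hN0
  have h6' := (mul_eq_zero.1 h6.symm).resolve_right hN0
  have h7' := (mul_eq_zero.1 h7.symm).resolve_right hN0
  rw [h7', zero_mul, zero_add] at h8
  have h9 := sl21_supertrace x
  rw [h7', ← h8, add_zero] at h9
  refine Subtype.ext (Matrix.ext fun i k => ?_)
  fin_cases i <;> fin_cases k
  exacts [h7', h1.symm, h5.symm, h3', h9, h2.symm, h6', h4.symm, h8.symm]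

theorem standardEmbedding_isPrincipal (hpq : 1 ≤ p + q) (hN : 1 ≤ N) :
    IsPrincipalEmbedding p q N (standardEmbedding p q N) := by
  have o1 := repeatBlock_mem_homSubspace (p := p) (q := q) (up_odd _ : modelE₁ N ∈ _)
  have o2 := repeatBlock_mem_homSubspace (p := p) (q := q) (up_odd _ : modelE₂ N ∈ _)
  have o3 := repeatBlock_mem_homSubspace (p := p) (q := q) (down_odd _ : modelF₁ N ∈ _)
  have o4 := repeatBlock_mem_homSubspace (p := p) (q := q) (down_odd _ : modelF₂ N ∈ _)
  have simple : ∀ j, standardEmbedding p q N (simpleRootVector j) = _ := fun j => rootMap_simple j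
  refine ⟨?_, ?_, ?_, ?_, ?_, ?_, ?_, ?_⟩
  · intro x y hxy
    rw [standardEmbedding_apply, standardEmbedding_apply] at hxy
    refine modelRep_injective hN (Matrix.ext fun k l => ?_)
    obtain ⟨a⟩ : Nonempty (Fin p ⊕ Fin q) := by
      rcases Nat.eq_zero_or_pos p with rfl | hp
      · exact ⟨Sum.inr ⟨0, by omega⟩⟩
      · exact ⟨Sum.inl ⟨0, hp⟩⟩
    have := congrFun (congrFun hxy (a, k)) (a, l)
    simpa [repeatBlock_apply] using this
  · intro x
    rw [standardEmbedding_apply]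
    refine ⟨fun ⟨a, k⟩ ⟨b, l⟩ hab => ?_, fun a => ?_⟩
    · rw [repeatBlock_apply, if_neg hab]
    · have h : modelRep N x ∈ sl (altParity (2 * N + 1)) :=
        rootMap_mem_sl (up_odd _) (up_odd _) (down_odd _) (down_odd _) x
      have h' : ∑ k, (-1 : ℂ) ^ (altParity (2 * N + 1) k).val * modelRep N x k k = 0 := h
      rw [← mul_zero ((-1 : ℂ) ^ (blockType a).val), ← h', Finset.mul_sum]
      refine Finset.sum_congr rfl fun k _ => ?_
      rw [repeatBlock_apply, if_pos rfl, blockParity_eq, neg_one_pow_val_add, altParity]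
      ring
  · exact fun s x hx => rootMap_even o1 o2 o3 o4 s x hx
  · exact fun x y => rootMap_bracket ((model_relations N).map (repeatBlock p q N)) o1 o2 o3 o4 x y
  · intro a k b l
    have := simple 0
    change standardEmbedding p q N e1 = repeatBlock p q N (modelE₁ N) at this
    rw [this, repeatBlock_apply, modelE₁, upMatrix]
    simp
  · intro a k b l
    have := simple 1
    change standardEmbedding p q N e2 = repeatBlock p q N (modelE₂ N) at this
    rw [this, repeatBlock_apply, modelE₂, upMatrix]
    simp
  · intro a k b l
    have := simple 2
    change standardEmbedding p q N f1 = repeatBlock p q N (modelF₁ N) at this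
    rw [this, repeatBlock_apply, modelF₁, downMatrix]
    simp only [ne_eq, ite_eq_right_iff, not_forall, exists_prop]
    refine and_congr_right fun _ => and_congr_right fun hk => ?_
    have := lowerCoeff_ne_zero (N := N) (k := l) (by omega)
    simp [this]
  · intro a k b l
    have := simple 3
    change standardEmbedding p q N f2 = repeatBlock p q N (modelF₂ N) at this
    rw [this, repeatBlock_apply, modelF₂, downMatrix]
    simp only [ne_eq, ite_eq_right_iff, not_forall, exists_prop]
    refine and_congr_right fun _ => and_congr_right fun hk => ?_
    have := lowerCoeff_ne_zero (N := N) (k := l) (by omega)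
    simp [this]

end StandardEmbedding
end SuperSL

namespace SuperSL

/-! ### Combining decompositions of subspaces. -/

section Decompositions

variable {V : Type} [AddCommGroup V] [Module ℂ V] {grading : ZMod 2 → Submodule ℂ V}
  {ρ : sl21 → V → V}

theorem iSupIndep_iff_sum_eq_zero {κ : Type} [Fintype κ] (U : κ → Submodule ℂ V) :
    iSupIndep U ↔ ∀ v : κ → V, (∀ i, v i ∈ U i) → ∑ i, v i = 0 → ∀ i, v i = 0 := by
  classical
  rw [iSupIndep_iff_finsetSum_eq_zero_imp_eq_zero]
  constructor
  · intro h v hv hs i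
    exact h Finset.univ v (fun i _ => hv i) hs i (Finset.mem_univ i)
  · intro h s v hv hs i hi
    have := h (fun i => if i ∈ s then v i else 0) (fun i => by
      split_ifs with h'
      · exact hv i h'
      · exact zero_mem _) (by simpa using hs) i
    simpa [hi] using this

theorem DecomposesInto.sup {M₁ M₂ : Submodule ℂ V} {L₁ L₂ : Multiset IrrepLabel}
    (h₁ : DecomposesInto grading ρ M₁ L₁) (h₂ : DecomposesInto grading ρ M₂ L₂)
    (h : Disjoint M₁ M₂) : DecomposesInto grading ρ (M₁ ⊔ M₂) (L₁ + L₂) := by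
  obtain ⟨κ₁, _, l₁, U₁, hl₁, hU₁, hi₁, hs₁⟩ := h₁
  obtain ⟨κ₂, _, l₂, U₂, hl₂, hU₂, hi₂, hs₂⟩ := h₂
  refine ⟨κ₁ ⊕ κ₂, inferInstance, Sum.elim l₁ l₂, Sum.elim U₁ U₂, ?_, ?_, ?_, ?_⟩
  · rw [← Finset.univ_disjSum_univ, Finset.val_disjSum, Multiset.map_disjSum]
    simp [hl₁, hl₂]
  · rintro (i | i)
    · exact hU₁ i
    · exact hU₂ i
  · rw [iSupIndep_iff_sum_eq_zero] at hi₁ hi₂ ⊢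
    intro v hv hsum
    rw [Fintype.sum_sum_type] at hsum
    have m₁ : ∑ i, v (Sum.inl i) ∈ M₁ := hs₁ ▸ Submodule.sum_mem _ fun i _ =>
      Submodule.mem_iSup_of_mem i (hv (Sum.inl i))
    have m₂ : ∑ i, v (Sum.inr i) ∈ M₂ := hs₂ ▸ Submodule.sum_mem _ fun i _ =>
      Submodule.mem_iSup_of_mem i (hv (Sum.inr i))
    have z₁ : ∑ i, v (Sum.inl i) = 0 := by
      refine Submodule.disjoint_def.1 h _ m₁ ?_
      rw [eq_neg_of_add_eq_zero_left hsum]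
      exact M₂.neg_mem m₂
    have z₂ : ∑ i, v (Sum.inr i) = 0 := by rwa [z₁, zero_add] at hsum
    rintro (i | i)
    · exact hi₁ (fun i => v (Sum.inl i)) (fun i => hv (Sum.inl i)) z₁ i
    · exact hi₂ (fun i => v (Sum.inr i)) (fun i => hv (Sum.inr i)) z₂ i
  · rw [iSup_sum, ← hs₁, ← hs₂]
    rfl

theorem decomposesInto_finset {κ : Type} {U : κ → Submodule ℂ V} {label : κ → IrrepLabel}
    (hU : ∀ i, IsIrrep grading ρ (label i) (U i)) (hi : iSupIndep U) (K : Finset κ) :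
    DecomposesInto grading ρ (⨆ i ∈ (K : Set κ), U i) (∑ i ∈ K, {label i}) := by
  refine ⟨K, inferInstance, fun i => label i, fun i => U i, ?_, fun i => hU i,
    hi.comp Subtype.val_injective, ?_⟩
  · rw [Finset.univ_eq_attach, ← Finset.sum_attach K, Finset.sum,
      ← Multiset.sum_map_singleton (Multiset.map _ K.attach.val), Multiset.map_map]
    rfl
  · exact iSup_subtype' (p := fun i => i ∈ (K : Set κ)) (f := fun i _ => U i) |>.symm

/-- The lines spanned by the vectors of any basis serve as summands. -/
theorem decomposesInto_trivial {Z : Submodule ℂ V} [FiniteDimensional ℂ Z]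
    (hZ : ∀ x, ∀ z ∈ Z, ρ x z = 0) (hg : Z ≤ grading 0) :
    DecomposesInto grading ρ Z (Module.finrank ℂ Z • {rep 0}) := by
  let b := Module.finBasis ℂ Z
  have hb : LinearIndependent ℂ fun i => (b i : V) :=
    b.linearIndependent.map' Z.subtype (Submodule.ker_subtype Z)
  refine ⟨Fin (Module.finrank ℂ Z), inferInstance, fun _ => rep 0,
    fun i => Submodule.span ℂ {(b i : V)}, ?_, fun i => ?_, hb.iSupIndep_span_singleton, ?_⟩
  · rw [Multiset.map_const', Multiset.nsmul_singleton]
    simp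
  · have hle : Submodule.span ℂ {(b i : V)} ≤ Z := by
      rw [Submodule.span_singleton_le_iff_mem]; exact (b i).2
    refine ⟨?_, fun x u hu => ?_, fun W hW _ => ?_, (b i : V), Submodule.mem_span_singleton_self _,
      hb.ne_zero i, ?_, hZ _ _ (b i).2, hZ _ _ (b i).2, ?_, ?_⟩
    · refine le_antisymm (iSup_le fun s => inf_le_left) ?_
      exact le_trans (le_inf le_rfl (hle.trans hg)) (le_iSup (fun s => _ ⊓ grading s) 0)
    · rw [hZ _ _ (hle hu)]; exact zero_mem _
    · by_cases h : W = ⊥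
      · exact Or.inl h
      · obtain ⟨w, hw, hw0⟩ := W.exists_mem_ne_zero_of_ne_bot h
        obtain ⟨c, rfl⟩ := Submodule.mem_span_singleton.1 (hW hw)
        refine Or.inr (le_antisymm hW ?_)
        rw [Submodule.span_singleton_le_iff_mem]
        exact (W.smul_mem_iff (left_ne_zero_of_smul hw0)).1 hw
    · have : (rep 0).parity = 0 := by simp [rep, IrrepLabel.parity]
      rw [this]
      exact hg (b i).2
    · rw [hZ _ _ (b i).2]; simp [rep]
    · rw [hZ _ _ (b i).2]; simp [rep]
  · rw [← Submodule.span_range_eq_iSup]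
    have : Set.range (fun i => (b i : V)) = Z.subtype '' Set.range b := by
      rw [← Set.range_comp]; rfl
    rw [this, ← Submodule.map_span, b.span_eq, Submodule.map_subtype_top]

end Decompositions

/-! ### The irreducible summands of gl(m|n). -/

section BlockIrreps

variable {p q N : ℕ} {φ : sl21 →ₗ[ℂ] Matrix (BlockIndex p q N) (BlockIndex p q N) ℂ}
  {D : BlockIndex p q N → ℂ}

/-- The irreducible summand of highest weight `r` in the block with indices `a`, `b`. -/
noncomputable def blockIrrep (D : BlockIndex p q N → ℂ)
    (x : ((Fin p ⊕ Fin q) × (Fin p ⊕ Fin q)) × Fin (N + 1)) :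
    Submodule ℂ (Matrix (BlockIndex p q N) (BlockIndex p q N) ℂ) :=
  (modelIrrep N x.2).map (blockEmb D x.1.1 x.1.2)

/-- The even power S^{2r} placed in a block has the parity of that block's corner, which is odd
exactly when the two types differ. -/
def blockLabel (x : ((Fin p ⊕ Fin q) × (Fin p ⊕ Fin q)) × Fin (N + 1)) : IrrepLabel :=
  if blockType x.1.1 = blockType x.1.2 then rep x.2 else rep' x.2

theorem blockLabel_parity (x : ((Fin p ⊕ Fin q) × (Fin p ⊕ Fin q)) × Fin (N + 1)) :
    (blockLabel x).parity = blockType x.1.1 + blockType x.1.2 := by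
  have h2 : ∀ r : ℕ, ((2 * r : ℕ) : ZMod 2) = 0 := fun r => by
    rw [Nat.cast_mul]; exact zero_mul _
  rw [blockLabel]
  split_ifs with h
  · rw [h, CharTwo.add_self_eq_zero]
    simp only [rep, IrrepLabel.parity, h2]
    simp
  · simp only [rep', IrrepLabel.parity, h2]
    generalize blockType x.1.1 = s at h
    generalize blockType x.1.2 = t at h
    revert s t
    decide

theorem blockLabel_b (x : ((Fin p ⊕ Fin q) × (Fin p ⊕ Fin q)) × Fin (N + 1)) :
    (blockLabel x).b = 0 := by
  rw [blockLabel]; split_ifs <;> rfl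

theorem blockLabel_twoJ (x : ((Fin p ⊕ Fin q) × (Fin p ⊕ Fin q)) × Fin (N + 1)) :
    (blockLabel x).twoJ = 2 * x.2 := by
  rw [blockLabel]; split_ifs <;> rfl

theorem sbracket_double_blockEmb (hφ : IsPrincipalEmbedding p q N φ) (hD : IsGauge φ D)
    (i j : Fin 4) (a b : Fin p ⊕ Fin q) (A : Matrix (Fin (2 * N + 1)) (Fin (2 * N + 1)) ℂ) :
    sbracket (blockParity p q N) (φ (sl21Bracket (simpleRootVector i) (simpleRootVector j)))
      (blockEmb D a b A) =
    blockEmb D a b ((modelAd N i * modelAd N j + modelAd N j * modelAd N i) A) := by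
  rw [hφ.sbracket_map_odd (simpleRootVector_odd i) (simpleRootVector_odd j), hD.intertwines,
    hD.intertwines, hD.intertwines, hD.intertwines, ← map_add]
  rfl

theorem blockEmb_shiftMatrix_mem (a b : Fin p ⊕ Fin q) (r : ℕ) :
    blockEmb D a b (shiftMatrix _ (2 * r)) ∈
      homSubspace (blockParity p q N) (blockType a + blockType b) := by
  rintro ⟨a', k⟩ ⟨b', l⟩ h
  rw [blockEmb_entry]
  split_ifs with h'
  · obtain ⟨rfl, rfl⟩ : a' = a ∧ b' = b := h'
    have hkl : (l : ℕ) ≠ k + 2 * r := by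
      intro hl
      apply h
      rw [blockParity_eq, blockParity_eq, hl]
      push_cast
      have h2 : (2 : ZMod 2) = 0 := rfl
      rw [h2, zero_mul, add_zero, add_add_add_comm, CharTwo.add_self_eq_zero, zero_add]
    have hs : (shiftMatrix (2 * N + 1) (2 * r)) k l = 0 := by simp [shiftMatrix, hkl]
    have ht : (shiftMatrix (2 * N + 1) (2 * r) *
        twist (2 * N + 1) (blockType a' + blockType b')) k l = 0 := by
      rw [twist]
      split_ifs
      · rw [mul_one, hs]
      · rw [altSign, diagMatrix, Matrix.mul_diagonal, hs, zero_mul]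
    rw [ht]; simp
  · rfl

/-- Everything is transported along the injective intertwiner `blockEmb`. On the image of S^{2r} one
has h₁ = r and h₂ = -r, so half their difference is r and half their sum is 0. -/
theorem isIrrep_blockIrrep (hφ : IsPrincipalEmbedding p q N φ) (hD : IsGauge φ D)
    (x : ((Fin p ⊕ Fin q) × (Fin p ⊕ Fin q)) × Fin (N + 1)) :
    IsIrrep (homSubspace (blockParity p q N)) (fun y A => sbracket (blockParity p q N) (φ y) A)
      (blockLabel x) (blockIrrep D x) := by
  obtain ⟨⟨a, b⟩, r⟩ := x
  have inj := blockEmb_injective hD.ne_zero a b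
  refine ⟨?_, ?_, ?_, blockEmb D a b (shiftMatrix _ (2 * r)),
    Submodule.mem_map_of_mem (mem_cyclicSpan_self _ _), ?_, ?_, ?_, ?_, ?_, ?_⟩
  · refine iSup_inf_homSubspace ?_
    rintro _ ⟨A, hA, rfl⟩
    rw [signMatrix_conj_blockEmb]
    exact Submodule.smul_mem _ _ (Submodule.mem_map_of_mem (modelIrrep_altSign_conj _ hA))
  · refine fun y A hA => hφ.stable_of_simple ?_ y A hA
    rintro j _ ⟨A, hA, rfl⟩
    rw [hD.intertwines]
    exact Submodule.mem_map_of_mem (cyclicSpan_stable _ _ j hA)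
  · intro W hW hst
    have hrange : W ≤ LinearMap.range (blockEmb D a b) := hW.trans (LinearMap.map_le_range)
    have hcomap : W.comap (blockEmb D a b) ≤ modelIrrep N r := by
      intro A hA
      obtain ⟨B, hB, hBA⟩ := hW hA
      rwa [← inj hBA]
    have hW' := modelIrrep_irreducible (r : ℕ) hcomap fun j A hA => by
      rw [Submodule.mem_comap, ← hD.intertwines]
      exact hst _ _ hA
    rw [← Submodule.map_comap_eq_self hrange]
    rcases hW' with h | h
    · left; rw [h, Submodule.map_bot]
    · right; rw [h]; rfl
  · rw [Ne, map_eq_zero_iff _ inj]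
    exact shiftMatrix_ne_zero (by omega)
  · rw [blockLabel_parity]
    exact blockEmb_shiftMatrix_mem a b r
  · exact (hD.intertwines 0 a b _).trans (by rw [modelAd_zero_shiftMatrix, map_zero])
  · exact (hD.intertwines 1 a b _).trans (by rw [modelAd_one_shiftMatrix, map_zero])
  · have h1 := sbracket_double_blockEmb hφ hD 0 2 a b (shiftMatrix _ (2 * r))
    have h2 := sbracket_double_blockEmb hφ hD 1 3 a b (shiftMatrix _ (2 * r))
    rw [modelAd_h₁_shiftMatrix] at h1
    rw [modelAd_h₂_shiftMatrix] at h2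
    simp only [simpleRootVector, Matrix.cons_val] at h1 h2
    have e : ∀ X Y : Matrix (BlockIndex p q N) (BlockIndex p q N) ℂ, X - Y = X + (-1 : ℂ) • Y :=
      fun X Y => by module
    simp only [sl21_isospin_eq, map_sub, map_smul, e, sbracket_add_left, sbracket_smul_left, h1, h2,
      blockLabel_twoJ]
    push_cast
    module
  · have h1 := sbracket_double_blockEmb hφ hD 0 2 a b (shiftMatrix _ (2 * r))
    have h2 := sbracket_double_blockEmb hφ hD 1 3 a b (shiftMatrix _ (2 * r))
    rw [modelAd_h₁_shiftMatrix] at h1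
    rw [modelAd_h₂_shiftMatrix] at h2
    simp only [simpleRootVector, Matrix.cons_val] at h1 h2
    simp only [sl21_baryon_eq, map_add, map_smul, sbracket_add_left, sbracket_smul_left, h1, h2,
      blockLabel_b]
    push_cast
    module

/-- Different blocks are separated by `blockProj`, summands of one block by the Casimir. -/
theorem blockIrrep_independent (hD : ∀ i, D i ≠ 0) : iSupIndep (blockIrrep D) := by
  rw [iSupIndep_iff_sum_eq_zero]
  intro v hv hsum
  choose w hw hwv using hv
  rintro ⟨⟨a, b⟩, r⟩
  have h1 := congrArg (blockProj D a b) hsum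
  rw [map_sum, map_zero, Fintype.sum_prod_type, Finset.sum_eq_single (a, b)] at h1
  · have h2 : ∀ s, blockProj D a b (v ((a, b), s)) = w ((a, b), s) := fun s => by
      rw [← hwv]; exact blockProj_blockEmb hD a b _
    simp only [h2] at h1
    have h3 := (iSupIndep_iff_sum_eq_zero _).1 (modelIrrep_independent (N := N))
      (fun s => w ((a, b), s)) (fun s => hw ((a, b), s)) h1 r
    rw [← hwv]
    rw [h3, map_zero]
  · rintro ⟨a', b'⟩ _ hne
    refine Finset.sum_eq_zero fun s _ => ?_
    rw [← hwv]
    exact blockProj_blockEmb_ne D (fun h => hne (by rw [h.1, h.2])) _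
  · simp

end BlockIrreps
end SuperSL

namespace SuperSL

/-! ### Block scalars, the source of the trivial summands. -/

section ScalarBlocks

variable {p q N : ℕ} {φ : sl21 →ₗ[ℂ] Matrix (BlockIndex p q N) (BlockIndex p q N) ℂ}
  {D : BlockIndex p q N → ℂ}

/-- An alternating sum of an odd number of signs equals its first term. That this superdimension is
nonzero is what lets the scalars of a block split off from its supertraceless matrices. -/
theorem sum_neg_one_pow_val_fin (N : ℕ) (a : Fin p ⊕ Fin q) :
    ∑ k : Fin (2 * N + 1), (-1 : ℂ) ^ (blockParity p q N (a, k)).val =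
      (-1) ^ (blockType a).val := by
  simp only [blockParity_eq, neg_one_pow_val_add, neg_one_pow_natCast_val]
  rw [← Finset.sum_mul, Fin.sum_univ_eq_sum_range (fun k => (-1 : ℂ) ^ k),
    sum_range_two_mul_add_one]
  simp [pow_succ, pow_mul]

/-- The block diagonal matrices each of whose diagonal blocks is scalar. -/
def scalarBlocks (p q N : ℕ) :
    ((Fin p ⊕ Fin q) → ℂ) →ₗ[ℂ] Matrix (BlockIndex p q N) (BlockIndex p q N) ℂ where
  toFun t := Matrix.diagonal fun i => t i.1
  map_add' s t := by rw [Matrix.diagonal_add]; rfl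
  map_smul' c t := by rw [RingHom.id_apply, ← Matrix.diagonal_smul]; rfl

theorem scalarBlocks_apply (t : (Fin p ⊕ Fin q) → ℂ) :
    scalarBlocks p q N t = Matrix.diagonal fun i => t i.1 := rfl

theorem scalarBlocks_one : scalarBlocks p q N 1 = 1 := Matrix.diagonal_one

theorem scalarBlocks_injective : Function.Injective (scalarBlocks p q N) := by
  intro s t h
  funext a
  have := congrFun (congrFun h (a, 0)) (a, 0)
  simpa [scalarBlocks_apply] using this

theorem scalarBlocks_even (t : (Fin p ⊕ Fin q) → ℂ) :
    scalarBlocks p q N t ∈ homSubspace (blockParity p q N) 0 := by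
  intro i k h
  rw [scalarBlocks_apply, Matrix.diagonal_apply_ne]
  rintro rfl
  exact h (CharTwo.add_self_eq_zero _)

theorem supertrace_scalarBlocks (t : (Fin p ⊕ Fin q) → ℂ) :
    supertrace (blockParity p q N) (scalarBlocks p q N t) =
      ∑ a, (-1 : ℂ) ^ (blockType a).val * t a := by
  simp only [supertrace, LinearMap.coe_mk, AddHom.coe_mk, scalarBlocks_apply,
    Matrix.diagonal_apply_eq]
  rw [Fintype.sum_prod_type]
  refine Finset.sum_congr rfl fun a _ => ?_
  rw [← sum_neg_one_pow_val_fin N a, Finset.sum_mul]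

theorem sbracket_scalarBlocks {X : Matrix (BlockIndex p q N) (BlockIndex p q N) ℂ}
    (hX : ∀ i k, i.1 ≠ k.1 → X i k = 0) (t : (Fin p ⊕ Fin q) → ℂ) :
    sbracket (blockParity p q N) X (scalarBlocks p q N t) = 0 := by
  have h : ∀ s, homPart (blockParity p q N) s X * scalarBlocks p q N t =
      scalarBlocks p q N t * homPart (blockParity p q N) s X := by
    intro s
    ext i k
    rw [scalarBlocks_apply, Matrix.mul_diagonal, Matrix.diagonal_mul, homPart]
    by_cases hik : i.1 = k.1
    · rw [hik, mul_comm]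
    · simp [hX i k hik]
  have h0 := homPart_of_mem (scalarBlocks_even (N := N) t)
  have h1 := homPart_of_mem_ne (t := 1) (scalarBlocks_even (N := N) t) (by decide)
  rw [sbracket_expand, h0, h1, h, h]
  simp

theorem shiftMatrix_zero (n : ℕ) : shiftMatrix n 0 = 1 := by
  ext a b
  simp [shiftMatrix, Matrix.one_apply, Fin.ext_iff, eq_comm]

theorem blockEmb_one (hD : ∀ i, D i ≠ 0) (a : Fin p ⊕ Fin q) :
    blockEmb D a a 1 = scalarBlocks p q N (Pi.single a 1) := by
  ext i k
  rw [blockEmb_entry, CharTwo.add_self_eq_zero, twist, if_pos rfl, mul_one, scalarBlocks_apply,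
    Matrix.diagonal_apply, Matrix.one_apply]
  by_cases h : i = k
  · subst h
    have := hD i
    by_cases ha : i.1 = a <;> simp [ha, this]
  · rw [if_neg h]
    split_ifs with h1 h2
    · exact absurd (Prod.ext (h1.1.trans h1.2.symm) h2) h
    · simp
    · rfl

theorem modelIrrep_zero_le : modelIrrep N 0 ≤ Submodule.span ℂ {1} := by
  refine cyclicSpan_le ?_ ?_
  · rw [mul_zero, shiftMatrix_zero]
    exact Submodule.mem_span_singleton_self _
  · intro j A hA
    obtain ⟨c, rfl⟩ := Submodule.mem_span_singleton.1 hA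
    have h : modelAd N j 1 = 0 := by
      fin_cases j <;> simp [modelAd, oddAd_apply, altSign_mul_self]
    rw [map_smul, h, smul_zero]
    exact zero_mem _

theorem blockIrrep_diag_zero_le (hD : ∀ i, D i ≠ 0) (a : Fin p ⊕ Fin q) :
    blockIrrep D ((a, a), 0) ≤ LinearMap.range (scalarBlocks p q N) := by
  rintro _ ⟨A, hA, rfl⟩
  obtain ⟨c, rfl⟩ := Submodule.mem_span_singleton.1 (modelIrrep_zero_le hA)
  rw [map_smul, blockEmb_one hD]
  exact Submodule.smul_mem _ _ ⟨_, rfl⟩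

theorem scalarBlocks_single_mem (hD : ∀ i, D i ≠ 0) (a : Fin p ⊕ Fin q) :
    scalarBlocks p q N (Pi.single a 1) ∈ blockIrrep D ((a, a), 0) := by
  rw [← blockEmb_one hD, ← shiftMatrix_zero]
  exact Submodule.mem_map_of_mem (mem_cyclicSpan_self _ _)

theorem range_scalarBlocks_le (hD : ∀ i, D i ≠ 0)
    {W : Submodule ℂ (Matrix (BlockIndex p q N) (BlockIndex p q N) ℂ)}
    (hW : ∀ a, blockIrrep D ((a, a), 0) ≤ W) : LinearMap.range (scalarBlocks p q N) ≤ W := by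
  rintro _ ⟨t, rfl⟩
  have h : t = ∑ a, t a • (Pi.single a 1 : (Fin p ⊕ Fin q) → ℂ) := by
    funext b
    simp [Finset.sum_apply, Pi.single_apply]
  rw [h, map_sum]
  refine W.sum_mem fun a _ => ?_
  rw [map_smul]
  exact W.smul_mem _ (hW a (scalarBlocks_single_mem hD a))

end ScalarBlocks

/-! ### The subspaces sl(m|n) and its block subalgebra as sums of summands. -/

section Subspaces

variable {p q N : ℕ} {φ : sl21 →ₗ[ℂ] Matrix (BlockIndex p q N) (BlockIndex p q N) ℂ}
  {D : BlockIndex p q N → ℂ}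

theorem blockEmb_mem_of_blockIrrep_le {a b : Fin p ⊕ Fin q}
    {W : Submodule ℂ (Matrix (BlockIndex p q N) (BlockIndex p q N) ℂ)}
    (hW : ∀ r, blockIrrep D ((a, b), r) ≤ W)
    (A : Matrix (Fin (2 * N + 1)) (Fin (2 * N + 1)) ℂ) : blockEmb D a b A ∈ W := by
  have h : (⨆ r : Fin (N + 1), modelIrrep N r).map (blockEmb D a b) ≤ W := by
    rw [Submodule.map_iSup]
    exact iSup_le hW
  rw [modelIrrep_iSup] at h
  exact h (Submodule.mem_map_of_mem Submodule.mem_top)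

/-- The generator has zero diagonal, either because its block is off-diagonal or because r > 0;
everything produced from it by the action is a superbracket and so has supertrace zero. -/
theorem blockIrrep_le_sl (hD : IsGauge φ D)
    {x : ((Fin p ⊕ Fin q) × (Fin p ⊕ Fin q)) × Fin (N + 1)} (hx : ¬(x.1.1 = x.1.2 ∧ x.2 = 0)) :
    blockIrrep D x ≤ sl (blockParity p q N) := by
  obtain ⟨⟨a, b⟩, r⟩ := x
  rw [blockIrrep, Submodule.map_le_iff_le_comap]
  refine cyclicSpan_le ?_ ?_
  · rw [Submodule.mem_comap, sl, LinearMap.mem_ker]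
    simp only [supertrace, LinearMap.coe_mk, AddHom.coe_mk]
    refine Finset.sum_eq_zero fun i _ => ?_
    rw [blockEmb_entry]
    split_ifs with h
    · have hab : a = b := h.1.symm.trans h.2
      have hr : (r : ℕ) ≠ 0 := fun h' => hx ⟨hab, Fin.ext h'⟩
      rw [hab, CharTwo.add_self_eq_zero, twist, if_pos rfl, mul_one]
      simp [shiftMatrix, hr]
    · rw [mul_zero]
  · intro j A _
    rw [Submodule.mem_comap, ← hD.intertwines]
    exact sbracket_mem_sl _ _ _

theorem blockIrrep_le_blockSL (hD : IsGauge φ D)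
    {x : ((Fin p ⊕ Fin q) × (Fin p ⊕ Fin q)) × Fin (N + 1)} (hx : x.1.1 = x.1.2) (hr : x.2 ≠ 0) :
    blockIrrep D x ≤ blockSL p q N := by
  intro M hM
  have hs := blockIrrep_le_sl hD (fun h => hr h.2) hM
  obtain ⟨⟨a, b⟩, r⟩ := x
  obtain rfl : a = b := hx
  obtain ⟨A, hA, rfl⟩ := hM
  refine ⟨fun i k hik => ?_, fun b => ?_⟩
  · rw [blockEmb_entry, if_neg]
    rintro ⟨h1, h2⟩
    exact hik (h1.trans h2.symm)
  · have h0 : ∀ c, c ≠ a → ∑ k, (-1 : ℂ) ^ (blockParity p q N (c, k)).val *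
        blockEmb D a a A (c, k) (c, k) = 0 := fun c hc =>
      Finset.sum_eq_zero fun k _ => by
        rw [blockEmb_entry, if_neg fun h => hc h.1, mul_zero]
    by_cases hb : b = a
    · subst hb
      rw [sl, LinearMap.mem_ker] at hs
      simp only [supertrace, LinearMap.coe_mk, AddHom.coe_mk] at hs
      rwa [Fintype.sum_prod_type, Finset.sum_eq_single b (fun c _ hc => h0 c hc) (by simp)] at hs
    · exact h0 b hb

/-- The indices of the irreducible summands other than the scalar matrices in the diagonal blocks. -/
def nonscalarIndices (p q N : ℕ) : Finset (((Fin p ⊕ Fin q) × (Fin p ⊕ Fin q)) × Fin (N + 1)) :=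
  Finset.univ.filter fun x => ¬(x.1.1 = x.1.2 ∧ x.2 = 0)

/-- The indices of the nontrivial irreducible summands of the diagonal blocks. -/
def diagonalIndices (p q N : ℕ) : Finset (((Fin p ⊕ Fin q) × (Fin p ⊕ Fin q)) × Fin (N + 1)) :=
  Finset.univ.filter fun x => x.1.1 = x.1.2 ∧ x.2 ≠ 0

theorem disjoint_scalarBlocks (hD : ∀ i, D i ≠ 0) :
    Disjoint (⨆ x ∈ (nonscalarIndices p q N : Set _), blockIrrep D x)
      (LinearMap.range (scalarBlocks p q N)) := by
  refine ((blockIrrep_independent hD).disjoint_biSup_biSup disjoint_compl_right).mono_right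
    (range_scalarBlocks_le hD fun a => ?_)
  refine le_biSup (blockIrrep D) ?_
  simp [nonscalarIndices]

theorem nonscalar_sup_scalarBlocks (hD : ∀ i, D i ≠ 0) :
    (⨆ x ∈ (nonscalarIndices p q N : Set _), blockIrrep D x) ⊔
      LinearMap.range (scalarBlocks p q N) = ⊤ := by
  refine eq_top_iff.2 fun M _ => ?_
  rw [← sum_blockEmb_blockProj hD M]
  refine Submodule.sum_mem _ fun a _ => Submodule.sum_mem _ fun b _ =>
    blockEmb_mem_of_blockIrrep_le (fun r => ?_) _
  by_cases h : a = b ∧ r = 0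
  · obtain ⟨rfl, rfl⟩ := h
    exact (blockIrrep_diag_zero_le hD a).trans le_sup_right
  · refine (le_biSup (blockIrrep D) ?_).trans le_sup_left
    simpa [nonscalarIndices] using h

theorem nonscalar_le_sl (hD : IsGauge φ D) :
    (⨆ x ∈ (nonscalarIndices p q N : Set _), blockIrrep D x) ≤ sl (blockParity p q N) :=
  iSup₂_le fun x hx => blockIrrep_le_sl hD (by simpa [nonscalarIndices] using hx)

/-- The supertrace on the matrices with scalar diagonal blocks. -/
noncomputable def scalarSupertrace (p q N : ℕ) : ((Fin p ⊕ Fin q) → ℂ) →ₗ[ℂ] ℂ :=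
  supertrace (blockParity p q N) ∘ₗ scalarBlocks p q N

theorem map_ker_scalarSupertrace :
    (LinearMap.ker (scalarSupertrace p q N)).map (scalarBlocks p q N) =
      LinearMap.range (scalarBlocks p q N) ⊓ sl (blockParity p q N) := by
  rw [scalarSupertrace, LinearMap.ker_comp, Submodule.map_comap_eq]
  rfl

/-- The nonscalar summands lie in sl(m|n) and span everything together with the block scalars, so
the modular law cuts the latter down to those of supertrace zero. -/
theorem nonscalar_sup_map_ker (hD : IsGauge φ D) :
    (⨆ x ∈ (nonscalarIndices p q N : Set _), blockIrrep D x) ⊔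
      (LinearMap.ker (scalarSupertrace p q N)).map (scalarBlocks p q N) =
      sl (blockParity p q N) := by
  rw [map_ker_scalarSupertrace, ← sup_inf_assoc_of_le _ (nonscalar_le_sl hD),
    nonscalar_sup_scalarBlocks hD.ne_zero, top_inf_eq]

theorem finrank_ker_scalarSupertrace (hpq : 1 ≤ p + q) :
    Module.finrank ℂ (LinearMap.ker (scalarSupertrace p q N)) = p + q - 1 := by
  obtain ⟨a⟩ : Nonempty (Fin p ⊕ Fin q) := by
    rw [← Fintype.card_pos_iff, Fintype.card_sum, Fintype.card_fin, Fintype.card_fin]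
    exact hpq
  have h : scalarSupertrace p q N ≠ 0 := fun h0 => by
    have h1 : scalarSupertrace p q N (Pi.single a 1) = 0 := by rw [h0]; rfl
    rw [scalarSupertrace, LinearMap.comp_apply, supertrace_scalarBlocks,
      Finset.sum_eq_single a (fun b _ hb => by simp [hb]) (by simp)] at h1
    simp at h1
  have h1 := LinearMap.finrank_range_add_finrank_ker (scalarSupertrace p q N)
  rw [LinearMap.range_eq_top.2 (LinearMap.surjective h), finrank_top, Module.finrank_self,
    Module.finrank_fintype_fun_eq_card, Fintype.card_sum, Fintype.card_fin, Fintype.card_fin] at h1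
  omega

theorem one_mem_ker_scalarSupertrace : (1 : (Fin p ⊕ Fin p) → ℂ) ∈
    LinearMap.ker (scalarSupertrace p p N) := by
  rw [LinearMap.mem_ker, scalarSupertrace, LinearMap.comp_apply, supertrace_scalarBlocks]
  have h1 : (1 : ZMod 2).val = 1 := rfl
  simp [blockType, h1]

/-- Block diagonal matrices are the sum of the diagonal summands with r > 0 and the block scalars.
By the modular law only block scalars inside `blockSL` could be missing, and there are none, since
the scalar t has supertrace ±t on its block. -/
theorem diagonal_eq_blockSL (hD : IsGauge φ D) :
    (⨆ x ∈ (diagonalIndices p q N : Set _), blockIrrep D x) = blockSL p q N := by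
  have hle : (⨆ x ∈ (diagonalIndices p q N : Set _), blockIrrep D x) ≤ blockSL p q N :=
    iSup₂_le fun x hx => by
      have hx' : x.1.1 = x.1.2 ∧ x.2 ≠ 0 := by simpa [diagonalIndices] using hx
      exact blockIrrep_le_blockSL hD hx'.1 hx'.2
  have hsc : LinearMap.range (scalarBlocks p q N) ⊓ blockSL p q N = ⊥ := by
    rw [eq_bot_iff]
    rintro _ ⟨⟨t, rfl⟩, -, ht⟩
    have : t = 0 := by
      funext a
      have h := ht a
      simp only [scalarBlocks_apply, Matrix.diagonal_apply_eq] at h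
      rw [← Finset.sum_mul, sum_neg_one_pow_val_fin] at h
      simpa using h
    rw [this, map_zero]
    exact zero_mem _
  refine le_antisymm hle fun M hM => ?_
  have hM' : M ∈ ((⨆ x ∈ (diagonalIndices p q N : Set _), blockIrrep D x) ⊔
      LinearMap.range (scalarBlocks p q N)) ⊓ blockSL p q N := by
    refine ⟨?_, hM⟩
    rw [SetLike.mem_coe, ← sum_blockEmb_blockProj hD.ne_zero M]
    refine Submodule.sum_mem _ fun a _ => Submodule.sum_mem _ fun b _ => ?_
    by_cases hab : a = b
    · subst hab
      refine blockEmb_mem_of_blockIrrep_le (fun r => ?_) _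
      by_cases hr : r = 0
      · subst hr
        exact (blockIrrep_diag_zero_le hD.ne_zero a).trans le_sup_right
      · refine (le_biSup (blockIrrep D) ?_).trans le_sup_left
        simpa [diagonalIndices] using hr
    · have : blockProj D a b M = 0 := by
        rw [blockProj_apply]
        have : (Matrix.of fun k l => (D (a, k))⁻¹ * M (a, k) (b, l) * D (b, l)) = 0 := by
          ext k l
          simp [hM.1 (a, k) (b, l) hab]
        rw [this, zero_mul]
      rw [this, map_zero]
      exact zero_mem _
  rwa [sup_inf_assoc_of_le _ hle, hsc, sup_bot_eq] at hM'

end Subspaces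

/-! ### Multiplicities and dimensions. -/

section Labels

variable {p q N : ℕ}

theorem sum_sum_ite_eq {M : Type*} [AddCommMonoid M] (n : ℕ) (x y : M) :
    ∑ i : Fin n, ∑ k : Fin n, (if i = k then x else y) = n • x + (n * (n - 1)) • y := by
  have h : ∀ i : Fin n, ∑ k : Fin n, (if i = k then x else y) = x + (n - 1) • y := by
    intro i
    rw [← Finset.add_sum_erase _ _ (Finset.mem_univ i), if_pos rfl,
      Finset.sum_congr rfl (fun k hk => if_neg (Finset.ne_of_mem_erase hk).symm)]
    simp
  simp only [h]
  simp [mul_smul]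

theorem sum_filter_label (P : ((Fin p ⊕ Fin q) × (Fin p ⊕ Fin q)) × Fin (N + 1) → Prop)
    [DecidablePred P] :
    ∑ x ∈ Finset.univ.filter P, ({blockLabel x} : Multiset IrrepLabel) =
      ∑ a, ∑ b, ∑ r, if P ((a, b), r) then {blockLabel ((a, b), r)} else 0 := by
  rw [Finset.sum_filter, Fintype.sum_prod_type, Fintype.sum_prod_type]

theorem sum_fin_succ_label (g : ℕ → Multiset IrrepLabel) :
    ∑ r : Fin (N + 1), g r = ∑ r ∈ Finset.Icc 0 N, g r := by
  rw [Fin.sum_univ_eq_sum_range, Nat.range_succ_eq_Icc_zero]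

theorem sum_fin_ne_zero_label (g : ℕ → Multiset IrrepLabel) :
    ∑ r : Fin (N + 1), (if r = 0 then 0 else g r) = ∑ r ∈ Finset.Icc 1 N, g r := by
  rw [Fin.sum_univ_succ, if_pos rfl, zero_add]
  simp only [Fin.succ_ne_zero, if_false, Fin.val_succ]
  rw [Fin.sum_univ_eq_sum_range (fun r => g (r + 1)), Finset.range_eq_Ico,
    Finset.sum_Ico_add' g 0 N 1, zero_add]
  rfl

/-- Among ordered pairs of blocks, p + q are diagonal and lose r = 0, p(p-1) + q(q-1) are distinct
of equal type, and 2pq are of opposite type. -/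
theorem sum_label_nonscalar :
    ∑ x ∈ nonscalarIndices p q N, ({blockLabel x} : Multiset IrrepLabel) =
      (p + q) • ∑ r ∈ Finset.Icc 1 N, {rep r}
        + (p * (p - 1) + q * (q - 1)) • ∑ r ∈ Finset.Icc 0 N, {rep r}
        + (2 * p * q) • ∑ r ∈ Finset.Icc 0 N, {rep' r} := by
  rw [nonscalarIndices, sum_filter_label]
  have hd : ∀ a b : Fin p ⊕ Fin q, (∑ r : Fin (N + 1), if ¬(a = b ∧ r = 0) then
      ({blockLabel ((a, b), r)} : Multiset IrrepLabel) else 0) =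
      if a = b then ∑ r ∈ Finset.Icc 1 N, {rep r} else
        if blockType a = blockType b then ∑ r ∈ Finset.Icc 0 N, {rep r}
        else ∑ r ∈ Finset.Icc 0 N, {rep' r} := by
    intro a b
    split_ifs with h h'
    · subst h
      simpa [blockLabel] using sum_fin_ne_zero_label (N := N) fun r => {rep r}
    · simpa [blockLabel, h, h'] using sum_fin_succ_label (N := N) fun r => {rep r}
    · simpa [blockLabel, h, h'] using sum_fin_succ_label (N := N) fun r => {rep' r}
  simp only [hd, Fintype.sum_sum_type, Sum.inl.injEq, Sum.inr.injEq, reduceCtorEq, if_false,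
    blockType, Sum.elim_inl, Sum.elim_inr, zero_ne_one, one_ne_zero, if_true,
    Finset.sum_add_distrib, sum_sum_ite_eq, Finset.sum_const, Finset.card_univ, Fintype.card_fin]
  module

theorem sum_label_diagonal :
    ∑ x ∈ diagonalIndices p q N, ({blockLabel x} : Multiset IrrepLabel) =
      (p + q) • ∑ r ∈ Finset.Icc 1 N, {rep r} := by
  rw [diagonalIndices, sum_filter_label]
  have hd : ∀ a b : Fin p ⊕ Fin q, (∑ r : Fin (N + 1), if (a = b ∧ r ≠ 0) then
      ({blockLabel ((a, b), r)} : Multiset IrrepLabel) else 0) =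
      if a = b then ∑ r ∈ Finset.Icc 1 N, {rep r} else 0 := by
    intro a b
    split_ifs with h
    · subst h
      simpa [blockLabel] using sum_fin_ne_zero_label (N := N) fun r => {rep r}
    · simp [h]
  simp only [hd, Finset.sum_ite_eq, Finset.mem_univ, if_true, Finset.sum_const, Finset.card_univ,
    Fintype.card_sum, Fintype.card_fin]

end Labels

section Cardinalities

variable {p q N : ℕ}

theorem card_blockParity (s : ZMod 2) : Fintype.card {i // blockParity p q N i = s} =
    if s = 0 then p * (N + 1) + q * N else p * N + q * (N + 1) := by
  have h2 : (2 : ZMod 2) = 0 := rfl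
  have hk : ∀ t : ZMod 2, (∑ k : Fin (2 * N + 1), if ((k : ℕ) : ZMod 2) + t = s then 1 else 0) =
      if t = s then N + 1 else N := by
    intro t
    rw [Fin.sum_univ_eq_sum_range (fun k => if (k : ZMod 2) + t = s then 1 else 0),
      sum_range_two_mul_add_one]
    push_cast
    simp only [h2, zero_mul, zero_add]
    revert s t
    have := (by decide : ∀ s t : ZMod 2, (1 + t = s ↔ ¬ t = s))
    intro s t
    simp only [this]
    by_cases h : t = s <;> simp [h]
  rw [Fintype.card_subtype, Finset.card_filter, Fintype.sum_prod_type]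
  simp only [blockParity_eq, hk, Fintype.sum_sum_type, blockType, Sum.elim_inl, Sum.elim_inr]
  rcases (by decide : ∀ x : ZMod 2, x = 0 ∨ x = 1) s with rfl | rfl <;> simp

end Cardinalities

/-! ### The adjoint decompositions. -/

section AdjointDecomposition

variable {p q N : ℕ} {φ : sl21 →ₗ[ℂ] Matrix (BlockIndex p q N) (BlockIndex p q N) ℂ}
  {D : BlockIndex p q N → ℂ}

/-- The nonscalar summands together with a space of matrices with scalar diagonal blocks. -/
theorem adjoint_decomposesInto_sup (hφ : IsPrincipalEmbedding p q N φ) (hD : IsGauge φ D)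
    (C : Submodule ℂ ((Fin p ⊕ Fin q) → ℂ)) :
    AdjointDecomposesInto φ
      ((⨆ x ∈ (nonscalarIndices p q N : Set _), blockIrrep D x) ⊔ C.map (scalarBlocks p q N))
      ((p + q) • ∑ r ∈ Finset.Icc 1 N, {rep r}
        + (p * (p - 1) + q * (q - 1)) • ∑ r ∈ Finset.Icc 0 N, {rep r}
        + (2 * p * q) • ∑ r ∈ Finset.Icc 0 N, {rep' r}
        + Module.finrank ℂ C • {rep 0}) := by
  rw [← sum_label_nonscalar,
    LinearEquiv.finrank_eq (Submodule.equivMapOfInjective _ scalarBlocks_injective C)]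
  refine (decomposesInto_finset (isIrrep_blockIrrep hφ hD) (blockIrrep_independent hD.ne_zero)
    _).sup (decomposesInto_trivial ?_ ?_)
    ((disjoint_scalarBlocks hD.ne_zero).mono_right LinearMap.map_le_range)
  · rintro x _ ⟨t, -, rfl⟩
    exact sbracket_scalarBlocks (hφ.mem_blockSL x).1 t
  · rintro _ ⟨t, -, rfl⟩
    exact scalarBlocks_even t

/-- All block scalars are annihilated by the action, so any complement of the identity among those
of supertrace zero is invariant. The resulting M is a model of the quotient psl(m|m). -/
theorem exists_complement_of_one {φ : sl21 →ₗ[ℂ] Matrix (BlockIndex p p N) (BlockIndex p p N) ℂ}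
    (hφ : IsPrincipalEmbedding p p N φ) (hp : 1 ≤ p) :
    ∃ M : Submodule ℂ (Matrix (BlockIndex p p N) (BlockIndex p p N) ℂ),
      Disjoint (Submodule.span ℂ {1}) M ∧ Submodule.span ℂ {1} ⊔ M = sl (blockParity p p N) ∧
      AdjointDecomposesInto φ M
        ((p + p) • ∑ r ∈ Finset.Icc 1 N, {rep r}
          + (p * (p - 1) + p * (p - 1)) • ∑ r ∈ Finset.Icc 0 N, {rep r}
          + (2 * p * p) • ∑ r ∈ Finset.Icc 0 N, {rep' r}
          + (p + p - 2) • {rep 0}) := by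
  obtain ⟨D, hD⟩ := hφ.exists_isGauge
  -- A complement in the space of all block scalars; since the identity has supertrace zero here,
  -- its intersection with Z is a complement inside Z by the modular law.
  obtain ⟨C₀, hC₀⟩ := Submodule.exists_isCompl (Submodule.span ℂ {(1 : (Fin p ⊕ Fin p) → ℂ)})
  set Z := LinearMap.ker (scalarSupertrace p p N)
  have h1 : Submodule.span ℂ {(1 : (Fin p ⊕ Fin p) → ℂ)} ≤ Z := by
    rw [Submodule.span_singleton_le_iff_mem]
    exact one_mem_ker_scalarSupertrace
  have hsup : Submodule.span ℂ {(1 : (Fin p ⊕ Fin p) → ℂ)} ⊔ C₀ ⊓ Z = Z := by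
    rw [← sup_inf_assoc_of_le _ h1, hC₀.sup_eq_top, top_inf_eq]
  have hdis : Disjoint (Submodule.span ℂ {(1 : (Fin p ⊕ Fin p) → ℂ)}) (C₀ ⊓ Z) :=
    hC₀.disjoint.mono_right inf_le_left
  have hspan : (Submodule.span ℂ {(1 : (Fin p ⊕ Fin p) → ℂ)}).map (scalarBlocks p p N) =
      Submodule.span ℂ {1} := by
    rw [Submodule.map_span, Set.image_singleton, scalarBlocks_one]
  have hrank : Module.finrank ℂ (C₀ ⊓ Z : Submodule ℂ _) = p + p - 2 := by
    have h := Submodule.finrank_sup_add_finrank_inf_eq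
      (Submodule.span ℂ {(1 : (Fin p ⊕ Fin p) → ℂ)}) (C₀ ⊓ Z)
    have hne : (1 : (Fin p ⊕ Fin p) → ℂ) ≠ 0 := fun h0 => by
      simpa using congrFun h0 (Sum.inl ⟨0, hp⟩)
    rw [hsup, hdis.eq_bot, finrank_bot, finrank_span_singleton hne,
      finrank_ker_scalarSupertrace (by omega)] at h
    omega
  refine ⟨_, ?_, ?_, hrank ▸ adjoint_decomposesInto_sup hφ hD (C₀ ⊓ Z)⟩
  · rw [sup_comm, ← hspan]
    refine Disjoint.disjoint_sup_right_of_disjoint_sup_left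
      (Submodule.disjoint_map scalarBlocks_injective hdis) ?_
    rw [← Submodule.map_sup, hsup]
    exact ((disjoint_scalarBlocks hD.ne_zero).mono_right LinearMap.map_le_range).symm
  · rw [sup_left_comm, ← hspan, ← Submodule.map_sup, hsup]
    exact nonscalar_sup_map_ker hD

theorem adjoint_sl_decomposesInto (hpq : 1 ≤ p + q) (hφ : IsPrincipalEmbedding p q N φ) :
    AdjointDecomposesInto φ (sl (blockParity p q N))
      ((p + q) • ∑ r ∈ Finset.Icc 1 N, {rep r}
        + (p * (p - 1) + q * (q - 1)) • ∑ r ∈ Finset.Icc 0 N, {rep r}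
        + (2 * p * q) • ∑ r ∈ Finset.Icc 0 N, {rep' r}
        + (p + q - 1) • {rep 0}) := by
  obtain ⟨D, hD⟩ := hφ.exists_isGauge
  have h := adjoint_decomposesInto_sup hφ hD (LinearMap.ker (scalarSupertrace p q N))
  rwa [nonscalar_sup_map_ker hD, finrank_ker_scalarSupertrace hpq] at h

theorem adjoint_blockSL_decomposesInto (hφ : IsPrincipalEmbedding p q N φ) :
    AdjointDecomposesInto φ (blockSL p q N) ((p + q) • ∑ r ∈ Finset.Icc 1 N, {rep r}) := by
  obtain ⟨D, hD⟩ := hφ.exists_isGauge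
  rw [← sum_label_diagonal, ← diagonal_eq_blockSL hD]
  exact decomposesInto_finset (isIrrep_blockIrrep hφ hD) (blockIrrep_independent hD.ne_zero) _

end AdjointDecomposition

end SuperSL

theorem mainTheorem3 (p q N : ℕ) (hpq : 1 ≤ p + q) (hN : 1 ≤ N) :
    -- the ambient algebra is `sl(m|n)` with `m = p(2j+1) + 2qj`, `n = 2pj + q(2j+1)`, `N = 2j`
    Fintype.card {i // SuperSL.blockParity p q N i = 0} = p * (N + 1) + q * N ∧
    Fintype.card {i // SuperSL.blockParity p q N i = 1} = p * N + q * (N + 1) ∧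
    -- principal embeddings exist
    (∃ φ, SuperSL.IsPrincipalEmbedding p q N φ) ∧
    ∀ φ, SuperSL.IsPrincipalEmbedding p q N φ →
      -- the adjoint of `sl(m|n)`
      SuperSL.AdjointDecomposesInto φ (SuperSL.sl (SuperSL.blockParity p q N))
        ((p + q) • ∑ r ∈ Finset.Icc 1 N, {SuperSL.rep r}
          + (p * (p - 1) + q * (q - 1)) • ∑ r ∈ Finset.Icc 0 N, {SuperSL.rep r}
          + (2 * p * q) • ∑ r ∈ Finset.Icc 0 N, {SuperSL.rep' r}
          + (p + q - 1) • {SuperSL.rep 0}) ∧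
      -- for `p = q` one trivial summand can be taken to be the centre
      (p = q → ∃ M : Submodule ℂ (Matrix (SuperSL.BlockIndex p q N) (SuperSL.BlockIndex p q N) ℂ),
        Disjoint (Submodule.span ℂ {1}) M ∧
        Submodule.span ℂ {1} ⊔ M = SuperSL.sl (SuperSL.blockParity p q N) ∧
        SuperSL.AdjointDecomposesInto φ M
          ((p + q) • ∑ r ∈ Finset.Icc 1 N, {SuperSL.rep r}
            + (p * (p - 1) + q * (q - 1)) • ∑ r ∈ Finset.Icc 0 N, {SuperSL.rep r}
            + (2 * p * q) • ∑ r ∈ Finset.Icc 0 N, {SuperSL.rep' r}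
            + (p + q - 2) • {SuperSL.rep 0})) ∧
      -- the adjoint of `p sl(2j+1|2j) ⊕ q sl(2j|2j+1)`
      SuperSL.AdjointDecomposesInto φ (SuperSL.blockSL p q N)
        ((p + q) • ∑ r ∈ Finset.Icc 1 N, {SuperSL.rep r}) ∧
      -- the adjoint of `sl(2j+1|2j)` and of `sl(2j|2j+1)`
      (p + q = 1 →
        SuperSL.AdjointDecomposesInto φ (SuperSL.sl (SuperSL.blockParity p q N))
          (∑ r ∈ Finset.Icc 1 N, {SuperSL.rep r})) := by
  refine ⟨SuperSL.card_blockParity 0, SuperSL.card_blockParity 1,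
    ⟨_, SuperSL.standardEmbedding_isPrincipal hpq hN⟩, fun φ hφ => ?_⟩
  have hsl := SuperSL.adjoint_sl_decomposesInto hpq hφ
  refine ⟨hsl, ?_, SuperSL.adjoint_blockSL_decomposesInto hφ, fun h1 => ?_⟩
  · rintro rfl
    exact SuperSL.exists_complement_of_one hφ (by omega)
  -- With a single block there are no off-diagonal pairs; the truncated subtraction 0 - 1 is
  -- harmless because it is multiplied by 0.
  · have hp : p * (p - 1) + q * (q - 1) = 0 ∧ 2 * p * q = 0 := by
      obtain ⟨rfl, rfl⟩ | ⟨rfl, rfl⟩ : (p = 0 ∧ q = 1) ∨ (p = 1 ∧ q = 0) := by omega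
      · simp
      · simp
    simpa [h1, hp.1, hp.2] using hsl
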